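/- Let $R$ be a commutative ring with unit. Let $G$ be a finite, connected, acyclic directed graph (multiple edges allowed) embedded in the plane, with edge weights in $R$ (all equal to $1$ in the unweighted case). Let $G$ have $n$ distinct left endpoints and $n$ distinct right endpoints, all on the outside face, and suppose that the left endpoints are segregated from the right endpoints there: the boundary walk of the outside face can be cut into two arcs such that every left endpoint is visited on the first arc and every right endpoint on the second. (A vertex may be both a left and a right endpoint.) The Gessel--Viennot matrix $V$ of $G$ is the $n\times n$ matrix whose entry $V_{i,j}$ is the total weight of all directed paths from left endpoint $i$ to right endpoint $j$, where the weight of a path is the product of its edge weights and the trivial path has weight $1$. The transit-free resolution $G'$ of $G$ is the following weighted bipartite graph. Remove all edges that enter a left endpoint or leave a right endpoint, and then repeatedly delete sources and sinks that are not endpoints. In what remains, split in place each transit vertex (a vertex with both incoming and outgoing edges) into a white vertex carrying the incoming edges and a black vertex carrying the outgoing edges, joined by a new edge of weight $1$. Left endpoints are black and right endpoints are white. A vertex that is both a left and a right endpoint is likewise replaced by a black and a white vertex joined by an edge of weight $1$. A decoration of the edges of a bipartite plane graph by signs is Kasteleyn flat if each finite face has an odd number of negative sides exactly when its number of sides is divisible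 by $4$. A Kasteleyn--Percus matrix is the bipartite adjacency matrix, with rows indexed by black vertices, columns by white vertices, and entries the sums of the weights of the connecting edges multiplied by the signs of a Kasteleyn-flat decoration. A deleted pivot of a matrix $M$ at $(i,j)$, possible when $M_{i,j}$ divides all entries in row $i$ and column $j$, subtracts $M_{k,j}/M_{i,j}$ times row $i$ from each row $k\neq i$ and then deletes row $i$ and column $j$. Then $G'$ is planar, with an embedding induced by that of $G$: contracting the new edges restores the cyclic orders of the remaining edges at the vertices of $G$, the outside face of $G'$ is the one containing the outside face of $G$, and all components of $G'$ lie side by side on it. Moreover: 1. If the left endpoints are exactly the sources of $G$ and the right endpoints are exactly the sinks, then $V$ is obtained by a sequence of deleted pivots from a Kasteleyn--Percus matrix $M$ of $G'$ with this embedding. 2. In general, $V$ is obtained from a Kasteleyn--Percus matrix $M$ of $G'$ with this embedding by a sequence of deleted pivots followed by elementary row and column operations (multiplying a row or column by a unit of $R$, or adding a multiple of one row or column to another). -/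

import Mathlib

open Function

/-! ### Directed multigraphs -/

/-- A directed multigraph with vertex set `V` and edge set `E`. -/
structure DirectedMultigraph (V E : Type*) where
  tail : E → V
  head : E → V

namespace DirectedMultigraph

section Basic

variable {V E : Type*} (G : DirectedMultigraph V E)

/-- There is an edge from `u` to `v`. -/
def Step (u v : V) : Prop := ∃ e, G.tail e = u ∧ G.head e = v

/-- `u` and `v` lie in the same connected component of the underlying undirected graph. -/
def SameComponent (u v : V) : Prop := Relation.EqvGen G.Step u v

/-- The set of connected components. -/
def Components : Type _ := Quot G.Step

/-- The underlying undirected graph is connected (in particular it has a vertex). -/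
def Connected : Prop := Nonempty V ∧ ∀ u v, G.SameComponent u v

/-- There is no directed cycle (in particular no self-loop). -/
def Acyclic : Prop := ∀ v, ¬ Relation.TransGen G.Step v v

def IsSource (v : V) : Prop := ∀ e, G.head e ≠ v

def IsSink (v : V) : Prop := ∀ e, G.tail e ≠ v

def IsIsolated (v : V) : Prop := G.IsSource v ∧ G.IsSink v

/-- The list `p` of edges is a directed path from `u` to `v`; the empty list is the trivial path
at `u`.  (In an acyclic graph no vertex is visited twice.) -/
def IsPath : V → V → List E → Prop
  | u, v, [] => u = v
  | u, v, e :: p => G.tail e = u ∧ IsPath (G.head e) v p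

/-- The Gessel-Viennot matrix: the `(i, j)` entry is the total weight of all directed paths from
left endpoint `i` to right endpoint `j`, the weight of a path being the product of the weights of
its edges.  (In a finite acyclic graph there are finitely many paths.) -/
noncomputable def gesselViennot {R ι κ : Type*} [CommRing R] (w : E → R)
    (left : ι → V) (right : κ → V) : Matrix ι κ R :=
  fun i j => ∑ᶠ p : {p : List E // G.IsPath (left i) (right j) p}, (p.1.map w).prod

/-! ### Planar embeddings as rotation systems -/

/-- The dart `(e, false)` is `e` traversed from tail to head, and `(e, true)` is `e` traversed
from head to tail.  A dart starts at its origin. -/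
def origin (x : E × Bool) : V := if x.2 then G.head x.1 else G.tail x.1

end Basic

/-- The same edge, traversed in the opposite direction. -/
def reverse {E : Type*} : Equiv.Perm (E × Bool) where
  toFun x := (x.1, !x.2)
  invFun x := (x.1, !x.2)
  left_inv x := by simp
  right_inv x := by simp

/-- The permutation which sends each dart to the next dart of the boundary walk of the face at its
side, when `rot` sends each dart to the next one around its origin. -/
def faceWalk {E : Type*} (rot : Equiv.Perm (E × Bool)) : Equiv.Perm (E × Bool) :=
  reverse.trans rot

/-- A planar embedding of a finite graph, with a marked infinite face, up to isotopy: a cyclic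
order of the darts at each vertex, with Euler characteristic `2` on each connected component.
The cycles of `faceWalk rot` are the boundary walks of the faces; a component that consists of an
isolated vertex has one face and no boundary walk.  The set `outer` consists of the darts on the
boundary of the infinite face.  When the graph is connected, this is the usual notion of a graph
embedded in the sphere with a marked face.  When the graph is not connected, each component has
exactly one boundary walk on the infinite face: the components lie side by side, none of them
inside a finite face of another, so that each finite face has exactly one boundary walk. -/
structure PlanarEmbedding {V E : Type*} (G : DirectedMultigraph V E) where
  /-- The next dart around the origin. -/
  rot : Equiv.Perm (E × Bool)
  sameCycle_rot_iff : ∀ x y, rot.SameCycle x y ↔ G.origin x = G.origin y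
  /-- Vertices minus edges plus faces is twice the number of components.  The genus formula
  makes the left side minus the right side nonpositive on every component. -/
  euler : Nat.card V + (Nat.card (Quot fun x y => faceWalk rot x = y)
      + Nat.card {v // G.IsIsolated v}) = Nat.card E + 2 * Nat.card G.Components
  /-- The darts on the boundary of the infinite face. -/
  outer : Set (E × Bool)
  faceWalk_mem_outer : ∀ x, faceWalk rot x ∈ outer ↔ x ∈ outer
  exists_outer : ∀ x, ∃ y ∈ outer, G.SameComponent (G.origin x) (G.origin y)
  outer_unique : ∀ x ∈ outer, ∀ y ∈ outer, G.SameComponent (G.origin x) (G.origin y) →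
    (faceWalk rot).SameCycle x y

namespace PlanarEmbedding

variable {V E : Type*} {G : DirectedMultigraph V E} (emb : G.PlanarEmbedding)

/-- The number of sides of the face whose boundary walk contains the dart `x`. -/
noncomputable def sides (x : E × Bool) : ℕ := minimalPeriod (faceWalk emb.rot) x

/-- For a connected graph: all vertices in `A` and in `B` are on the boundary of the infinite face,
and `A` is segregated from `B` there.  That is, the closed boundary walk of the infinite face can
be cut into two successive arcs such that each vertex in `A` is visited on the first arc and each
vertex in `B` on the second.  The arcs share their end corners; since a corner belongs to only
one vertex, this matters only for vertices in both `A` and `B`.  (If there are no edges, the only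
vertex is on the infinite face, and there is nothing to separate.) -/
def Segregated (A B : Set V) : Prop :=
  IsEmpty E ∨ ∃ x ∈ emb.outer, ∃ k ≤ emb.sides x,
    (∀ a ∈ A, ∃ i ≤ k, G.origin ((faceWalk emb.rot)^[i] x) = a) ∧
    (∀ b ∈ B, ∃ i, k ≤ i ∧ i ≤ emb.sides x ∧ G.origin ((faceWalk emb.rot)^[i] x) = b)

/-- A sign decoration of the edges is Kasteleyn flat (for a bipartite graph): each finite face has
an odd number of negative sides if and only if its number of sides is divisible by `4`.  An edge
with the same face at both sides counts twice as a side of this face. -/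
def KasteleynFlat (sign : E → ℤˣ) : Prop :=
  ∀ x ∉ emb.outer,
    (Odd ((Finset.range (emb.sides x)).filter
      fun i => sign ((faceWalk emb.rot)^[i] x).1 = -1).card ↔ 4 ∣ emb.sides x)

end PlanarEmbedding

/-- `M` is a Kasteleyn-Percus matrix of a weighted bipartite planar graph with black vertices `B`
and white vertices `W` (every edge has its tail in `B` and its head in `W`): the bipartite
adjacency matrix, with the weights multiplied by the signs of a Kasteleyn-flat decoration. -/
def IsKasteleynPercus {R B W E : Type*} [CommRing R] {G : DirectedMultigraph (B ⊕ W) E}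
    (emb : G.PlanarEmbedding) (w : E → R) (M : Matrix B W R) : Prop :=
  (∀ e, (∃ b, G.tail e = Sum.inl b) ∧ ∃ c, G.head e = Sum.inr c) ∧
  ∃ sign : E → ℤˣ, emb.KasteleynFlat sign ∧ ∀ b c,
    M b c = ∑ᶠ e : {e // G.tail e = Sum.inl b ∧ G.head e = Sum.inr c},
      ((sign e.1 : ℤ) : R) * w e.1

/-! ### The transit-free resolution -/

section Resolution

variable {V E : Type*} (G : DirectedMultigraph V E) {n : ℕ} (left right : Fin n → V)

/-- The edges that are removed before the transit vertices are split: edges into left endpoints and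
edges out of right endpoints are removed, and then sources and sinks which are not endpoints are
repeatedly deleted, together with their edges. -/
inductive Deleted : E → Prop
  | into_left (e : E) : G.head e ∈ Set.range left → Deleted e
  | out_of_right (e : E) : G.tail e ∈ Set.range right → Deleted e
  | source (e : E) : G.tail e ∉ Set.range left → G.tail e ∉ Set.range right →
      (∀ e', G.head e' = G.tail e → Deleted e') → Deleted e
  | sink (e : E) : G.head e ∉ Set.range left → G.head e ∉ Set.range right →
      (∀ e', G.tail e' = G.head e → Deleted e') → Deleted e

/-- A transit vertex of what is left: it has both an incoming and an outgoing edge. -/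
def IsTransit (v : V) : Prop :=
  (∃ e, ¬ G.Deleted left right e ∧ G.head e = v) ∧ ∃ e, ¬ G.Deleted left right e ∧ G.tail e = v

/-- The black vertices of the resolution: the left endpoints, and one copy of each transit vertex,
where the outgoing edges are attached. -/
def Black : Type _ := {v // v ∈ Set.range left ∨ G.IsTransit left right v}

/-- The white vertices of the resolution: the right endpoints, and one copy of each transit vertex,
where the incoming edges are attached. -/
def White : Type _ := {v // v ∈ Set.range right ∨ G.IsTransit left right v}

/-- The edges of the resolution: the remaining edges of the graph, and a new edge joining the black
copy and the white copy of each vertex that has both, which are the transit vertices and the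
vertices that are both a left and a right endpoint. -/
def ResolutionEdge : Type _ :=
  {e // ¬ G.Deleted left right e} ⊕
    {v // (v ∈ Set.range left ∨ G.IsTransit left right v) ∧
      (v ∈ Set.range right ∨ G.IsTransit left right v)}

variable {G left right}

theorem tail_mem_black {e : E} (he : ¬ G.Deleted left right e) :
    G.tail e ∈ Set.range left ∨ G.IsTransit left right (G.tail e) := by
  by_contra h
  push Not at h
  have hr : G.tail e ∉ Set.range right := fun hr => he (.out_of_right e hr)
  refine he (.source e h.1 hr fun e' he' => ?_)
  by_contra hd
  exact h.2 ⟨⟨e', hd, he'⟩, e, he, rfl⟩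

theorem head_mem_white {e : E} (he : ¬ G.Deleted left right e) :
    G.head e ∈ Set.range right ∨ G.IsTransit left right (G.head e) := by
  by_contra h
  push Not at h
  have hl : G.head e ∉ Set.range left := fun hl => he (.into_left e hl)
  refine he (.sink e hl h.1 fun e' he' => ?_)
  by_contra hd
  exact h.2 ⟨⟨e, he, rfl⟩, e', hd, he'⟩

variable (G left right)

/-- The transit-free resolution, a bipartite graph whose edges point from black to white. -/
def resolution : DirectedMultigraph (G.Black left right ⊕ G.White left right)
    (G.ResolutionEdge left right) where
  tail
    | .inl e => .inl ⟨G.tail e.1, tail_mem_black e.2⟩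
    | .inr v => .inl ⟨v.1, v.2.1⟩
  head
    | .inl e => .inr ⟨G.head e.1, head_mem_white e.2⟩
    | .inr v => .inr ⟨v.1, v.2.2⟩

/-- The weights of the resolution (without signs): new edges have weight `1`. -/
def resolutionWeight {R : Type*} [CommRing R] (w : E → R) : G.ResolutionEdge left right → R
  | .inl e => w e.1
  | .inr _ => 1

/-- The left endpoints as vertices of the resolution. -/
def leftVertex (i : Fin n) : G.Black left right := ⟨left i, .inl ⟨i, rfl⟩⟩

/-- The right endpoints as vertices of the resolution. -/
def rightVertex (i : Fin n) : G.White left right := ⟨right i, .inl ⟨i, rfl⟩⟩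

/-- Around its origin, `y` is the next dart after `x` whose edge is not deleted. -/
def NextKept (rot : Equiv.Perm (E × Bool)) (x y : E × Bool) : Prop :=
  ¬ G.Deleted left right y.1 ∧ ∃ m, rot^[m + 1] x = y ∧
    ∀ i < m, G.Deleted left right (rot^[i + 1] x).1

variable {G}

/-- The side of the dart belongs to the infinite face once the deleted edges are removed: the
infinite face merges with all faces that it reaches across deleted edges. -/
inductive OuterAfterDeletion (emb : G.PlanarEmbedding) : E × Bool → Prop
  | outer (x) : x ∈ emb.outer → OuterAfterDeletion emb x
  | walk (x) : OuterAfterDeletion emb x → OuterAfterDeletion emb (faceWalk emb.rot x)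
  | cross (x) : G.Deleted left right x.1 → OuterAfterDeletion emb x →
      OuterAfterDeletion emb (reverse x)

variable {left right}

/-- The embedding of the resolution comes from the embedding `emb` of `G`, by removing the deleted
edges and splitting each transit vertex in place: contraction of the new edges restores the cyclic
order of the remaining edges around each vertex of `G`, and the infinite face is the one
that contains the infinite face of `G`. -/
structure PlanarEmbedding.IsInduced (emb : G.PlanarEmbedding)
    (emb' : (G.resolution left right).PlanarEmbedding) : Prop where
  rot_eq : ∀ (e f : {e // ¬ G.Deleted left right e}) (a b : Bool),
    G.NextKept left right emb.rot (e.1, a) (f.1, b) →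
      emb'.rot (.inl e, a) = (.inl f, b) ∨
      ∃ v c, emb'.rot (.inl e, a) = (.inr v, c) ∧ emb'.rot (.inr v, !c) = (.inl f, b)
  outer_iff : ∀ (e : {e // ¬ G.Deleted left right e}) (a : Bool),
    (.inl e, a) ∈ emb'.outer ↔ OuterAfterDeletion left right emb (e.1, a)

end Resolution

end DirectedMultigraph

/-! ### Matrix operations -/

section MatrixOperations

variable {R I J : Type*} [CommRing R]

/-- `DeletedPivotsReach M S T N`: a sequence of deleted pivots, starting with `M`, ends with the
matrix with rows `S` and columns `T` whose entries are those of `N`.  The entries of `N` in deleted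
rows and columns are irrelevant.  In a pivot at `(i, j)`, `c k` is the quotient of the entries
at `(k, j)` and `(i, j)`; the pivot requires that the entry at `(i, j)` divide all entries in
its row and column. -/
inductive DeletedPivotsReach (M : Matrix I J R) : Set I → Set J → Matrix I J R → Prop
  | nil : DeletedPivotsReach M Set.univ Set.univ M
  | pivot {S : Set I} {T : Set J} {N : Matrix I J R} (i : I) (j : J) (c : I → R) :
      DeletedPivotsReach M S T N → i ∈ S → j ∈ T →
      (∀ k ∈ S \ {i}, N k j = c k * N i j) → (∀ l ∈ T \ {j}, N i j ∣ N i l) →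
      DeletedPivotsReach M (S \ {i}) (T \ {j}) (fun k l => N k l - c k * N i l)

/-- `N` is obtained from `M` by deleted pivots; the rows and columns of `M` which remain are
labelled by the maps `r` and `s`. -/
def ObtainedByDeletedPivots {K L : Type*} (M : Matrix I J R) (r : K → I) (s : L → J)
    (N : Matrix K L R) : Prop :=
  Injective r ∧ Injective s ∧
    ∃ P, DeletedPivotsReach M (Set.range r) (Set.range s) P ∧ N = P.submatrix r s

/-- `N` arises from `M` by one elementary row or column operation: multiplying a row or column by a
unit, or adding a multiple of a row or column to another one. -/
inductive ElementaryOperation [DecidableEq I] [DecidableEq J] (M : Matrix I J R) :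
    Matrix I J R → Prop
  | scaleRow (i : I) (u : Rˣ) : ElementaryOperation M (M.updateRow i ((u : R) • M i))
  | addRow (i k : I) (c : R) : i ≠ k → ElementaryOperation M (M.updateRow k (M k + c • M i))
  | scaleCol (j : J) (u : Rˣ) :
      ElementaryOperation M (M.updateCol j ((u : R) • fun i => M i j))
  | addCol (j l : J) (c : R) : j ≠ l →
      ElementaryOperation M (M.updateCol l ((fun i => M i l) + c • fun i => M i j))

/-- `N` is obtained from `M` by elementary row and column operations. -/
def ObtainedByElementaryOperations [DecidableEq I] [DecidableEq J] (M N : Matrix I J R) : Prop :=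
  Relation.ReflTransGen ElementaryOperation M N

end MatrixOperations

/-! Planarity is used in homological form over `ZMod 2`, for the rotation `σ` and the reversal `α`
of the darts: every edge set with even degree at each vertex is the boundary of a union of faces
(`IsPlanar`). A dimension count makes this equivalent to Euler's formula (`isPlanar_iff`). Unlike
the formula, it passes readily through deletion of edges (`IsPlanar.restrict`), coning off a face
(`IsPlanar.star`) and splitting of vertices (`exists_resolution_potential`).

The geometric heart is a count of direction changes. Cone off the outside face with a vertex at
infinity, drop the deleted edges, and keep only spokes from infinity to left endpoints and from
right endpoints to infinity. Now every vertex has incoming and outgoing edges, hence at least two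
changes of direction around it; so does every face boundary that is not a directed closed walk. Each
corner is a change for exactly one of its vertex and its face. A directed face passes through
infinity, because the graph is acyclic, and segregation allows at most one in each sense. Euler's
formula then leaves no slack: every vertex and every undirected face has exactly two changes
(`uniqueSwitches_of_isPlanar`, `switches_of_segregated`).

Around a transit vertex this says that the incoming edges are consecutive, so that the vertex can be
split in place. Along a finite face it says that there are one local source and one local sink. Each
of the other `m` corners acquires a new edge as a side, so the face of the resolution has `2 * m +
2` sides, a multiple of `4` exactly when `m` is odd. Hence negative signs on the new edges at
transit vertices are Kasteleyn flat (`kasteleynFlat_resolutionEmbedding`).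

The rest is algebra. The matrix has the entry `-1` at each transit vertex, and the deleted pivot
there composes the edges into the vertex with the ways out of it. When sinks are treated first, what
remains are the sums over paths of kept edges between endpoints (`exists_deletedPivotsReach`). If
the endpoints are the sources and sinks, nothing was deleted and this is the Gessel-Viennot matrix.
In general, cutting each path at its last left endpoint and then at the first right endpoint after
it factors that matrix as `A * (N * B)`, with `A` and `B` unitriangular by acyclicity, hence a
sequence of row and column operations (`obtainedByElementaryOperations_gesselViennot`). -/

/-! ### Planarity of pairs of permutations -/

namespace DartPair

open Equiv

/-- Functions on `D` that are compatible with the relation `r`. -/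
def invariants {D : Type*} (r : D → D → Prop) : Submodule (ZMod 2) (D → ZMod 2) where
  carrier := {f | ∀ x y, r x y → f x = f y}
  add_mem' := fun ha hb x y h => by simp [ha x y h, hb x y h]
  zero_mem' := fun _ _ _ => rfl
  smul_mem' := fun c f hf x y h => by simp [hf x y h]

theorem finrank_invariants {D : Type*} [Finite D] (r : D → D → Prop) :
    Module.finrank (ZMod 2) (invariants r) = Nat.card (Quot r) := by
  classical
  let e : (Quot r → ZMod 2) ≃ₗ[ZMod 2] invariants r :=
    { toFun := fun f => ⟨fun x => f (Quot.mk r x), fun x y h => congrArg f (Quot.sound h)⟩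
      invFun := fun f => Quot.lift f.1 f.2
      map_add' := fun _ _ => rfl
      map_smul' := fun _ _ => rfl
      left_inv := fun f => by
        funext q
        induction q using Quot.ind
        rfl
      right_inv := fun f => rfl }
  have : Fintype (Quot r) := Fintype.ofFinite _
  rw [← e.finrank_eq, Module.finrank_fintype_fun_eq_card, Nat.card_eq_fintype_card]

theorem finrank_map_add_finrank_inf_ker {K V W : Type*} [Field K] [AddCommGroup V] [Module K V]
    [AddCommGroup W] [Module K W] [FiniteDimensional K V] (f : V →ₗ[K] W) (S : Submodule K V) :
    Module.finrank K (S.map f) + Module.finrank K (S ⊓ LinearMap.ker f : Submodule K V)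
      = Module.finrank K S := by
  rw [← LinearMap.finrank_range_add_finrank_ker (f.domRestrict S), LinearMap.range_domRestrict,
    LinearMap.ker_domRestrict, ← Submodule.map_comap_subtype, Submodule.finrank_map_subtype_eq]

variable {D : Type*}

/-- The map `f ↦ f + f ∘ π`. -/
def twist (π : Perm D) : (D → ZMod 2) →ₗ[ZMod 2] (D → ZMod 2) :=
  LinearMap.id + LinearMap.funLeft (ZMod 2) (ZMod 2) π

theorem twist_apply (π : Perm D) (f : D → ZMod 2) (x : D) : twist π f x = f x + f (π x) := rfl

theorem add_eq_zero_iff_eq_zmod_two (a b : ZMod 2) : a + b = 0 ↔ a = b := by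
  revert a b; decide

theorem ker_twist (π : Perm D) : LinearMap.ker (twist π) = invariants fun x y => π x = y := by
  ext f
  simp only [LinearMap.mem_ker, funext_iff, twist_apply, Pi.zero_apply,
    add_eq_zero_iff_eq_zmod_two]
  constructor
  · rintro h x y rfl
    exact h x
  · intro h x
    exact h x _ rfl

theorem range_twist_of_involutive [Finite D] (α : Perm D) (hα : ∀ x, α (α x) = x)
    (hne : ∀ x, α x ≠ x) : LinearMap.range (twist α) = LinearMap.ker (twist α) := by
  apply le_antisymm
  · rintro _ ⟨f, rfl⟩
    rw [LinearMap.mem_ker]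
    funext x
    simp only [twist_apply, hα, Pi.zero_apply]
    rw [add_eq_zero_iff_eq_zmod_two, add_comm]
  · intro h hh
    rw [LinearMap.mem_ker] at hh
    obtain ⟨m, ⟨e⟩⟩ := Finite.exists_equiv_fin D
    -- An invariant function is a sum over pairs `{x, α x}`; the enumeration selects one dart of
    -- each pair to carry the value.
    refine ⟨fun x => if e x < e (α x) then h x else 0, ?_⟩
    funext x
    have hx : h x = h (α x) := by
      rw [← add_eq_zero_iff_eq_zmod_two]; exact congrFun hh x
    rw [twist_apply]
    simp only [hα]
    have : e x ≠ e (α x) := fun h' => hne x (e.injective h').symm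
    rcases lt_or_gt_of_ne this with h1 | h1
    · simp [h1, h1.not_gt]
    · simp [h1, h1.not_gt, hx]

/-- The permutations `σ` and `α` generate a planar map: each cycle (in the homological sense) is
the boundary of a union of faces. -/
def IsPlanar (σ α : Perm D) : Prop :=
  ∀ h : D → ZMod 2, (∀ x, h (α x) = h x) → (∃ g : D → ZMod 2, ∀ x, h x = g x + g (σ x)) →
    ∃ p : D → ZMod 2, (∀ x, p (σ (α x)) = p x) ∧ ∀ x, h x = p x + p (α x)

/-- The matrix of `twist π` is `1` plus a permutation matrix. Transposition inverts the permutations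
and reverses the product, and it preserves the rank. -/
theorem finrank_range_twist_comp [Finite D] (σ α : Perm D) :
    Module.finrank (ZMod 2) (LinearMap.range ((twist α).comp (twist σ)))
      = Module.finrank (ZMod 2) (LinearMap.range ((twist σ⁻¹).comp (twist α⁻¹))) := by
  classical
  have : Fintype D := Fintype.ofFinite D
  have key : ∀ π : Perm D, (1 + π.permMatrix (ZMod 2)).mulVecLin = twist π := by
    intro π
    refine LinearMap.ext fun f => funext fun x => ?_
    simp [Matrix.permMatrix_mulVec, twist_apply]
  have := Matrix.rank_transpose ((1 + α.permMatrix (ZMod 2)) * (1 + σ.permMatrix (ZMod 2)))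
  rw [Matrix.transpose_mul, Matrix.transpose_add, Matrix.transpose_add, Matrix.transpose_one,
    Matrix.transpose_permMatrix, Matrix.transpose_permMatrix] at this
  rw [Matrix.rank, Matrix.rank, Matrix.mulVecLin_mul, Matrix.mulVecLin_mul, key, key, key,
    key] at this
  exact this.symm

theorem two_mul_finrank_ker_twist [Finite D] (α : Perm D) (hα : ∀ x, α (α x) = x)
    (hne : ∀ x, α x ≠ x) :
    2 * Module.finrank (ZMod 2) (LinearMap.ker (twist α)) = Nat.card D := by
  have : Fintype D := Fintype.ofFinite D
  have h := LinearMap.finrank_range_add_finrank_ker (twist α)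
  rw [range_twist_of_involutive α hα hne, Module.finrank_fintype_fun_eq_card] at h
  rw [Nat.card_eq_fintype_card]
  omega

/-- Planarity in the homological sense is equivalent to Euler's formula. -/
theorem isPlanar_iff [Finite D] (σ α : Perm D) (hα : ∀ x, α (α x) = x) (hne : ∀ x, α x ≠ x) :
    IsPlanar σ α ↔
      2 * (Nat.card (Quot fun x y => σ x = y) + Nat.card (Quot fun x y => σ (α x) = y)) =
        Nat.card D + 4 * Nat.card (Quot fun x y => σ x = y ∨ α x = y) := by
  classical
  have : Fintype D := Fintype.ofFinite D
  -- `Z` is the space of cycles and `B` the space of boundaries. With `v` vertices, `m` edges, `f`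
  -- faces and `c` components of the dart pair, `B` has dimension `f - c` and `Z` has dimension `m -
  -- v + c`; planarity is `Z = B`.
  set Z : Submodule (ZMod 2) (D → ZMod 2) :=
    (LinearMap.ker ((twist α).comp (twist σ))).map (twist σ) with hZ
  set F : Submodule (ZMod 2) (D → ZMod 2) := invariants fun x y => σ (α x) = y with hF
  set B : Submodule (ZMod 2) (D → ZMod 2) := F.map (twist α) with hB
  have hαinv : α⁻¹ = α := by
    ext x
    rw [Equiv.Perm.inv_eq_iff_eq, hα]
  have hBZ : B ≤ Z := by
    rintro _ ⟨p, hp, rfl⟩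
    have hpσ : twist σ p = twist α p := by
      funext x
      rw [twist_apply, twist_apply]
      congr 1
      have := hp (α x) (σ x) (by simp [hα])
      exact this.symm
    refine ⟨p, ?_, hpσ⟩
    change (twist α) ((twist σ) p) = 0
    rw [hpσ, ← LinearMap.mem_ker, ← range_twist_of_involutive α hα hne]
    exact ⟨p, rfl⟩
  have hplanar : IsPlanar σ α ↔ Z ≤ B := by
    constructor
    · rintro H _ ⟨g, hg, rfl⟩
      obtain ⟨p, hp, hp'⟩ := H (twist σ g) (fun x => by
        have := congrFun (show twist α (twist σ g) = 0 from hg) x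
        rw [twist_apply, Pi.zero_apply, add_eq_zero_iff_eq_zmod_two] at this
        exact this.symm) ⟨g, fun x => rfl⟩
      refine ⟨p, ?_, funext fun x => (hp' x).symm⟩
      rintro x _ rfl
      exact (hp x).symm
    · rintro H h hh ⟨g, hg⟩
      obtain ⟨p, hp, hp'⟩ := H (show h ∈ Z from ⟨g, by
        change twist α (twist σ g) = 0
        funext x
        rw [twist_apply, Pi.zero_apply, add_eq_zero_iff_eq_zmod_two, twist_apply, twist_apply,
          ← hg, ← hg, hh], funext fun x => (hg x).symm⟩)
      exact ⟨p, fun x => (hp x _ rfl).symm, fun x => by rw [← hp']; rfl⟩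
  have hdim : Z ≤ B ↔ Module.finrank (ZMod 2) B = Module.finrank (ZMod 2) Z := by
    constructor
    · intro h
      rw [le_antisymm h hBZ]
    · intro h
      rw [Submodule.eq_of_le_of_finrank_eq hBZ h]
  have hI : ∀ S : Submodule (ZMod 2) (D → ZMod 2),
      (∀ f, f ∈ S ↔ (∀ x, f (σ x) = f x) ∧ ∀ x, f (α x) = f x) →
      Module.finrank (ZMod 2) S = Nat.card (Quot fun x y => σ x = y ∨ α x = y) := by
    intro S hS
    suffices h : S = invariants fun x y => σ x = y ∨ α x = y by rw [h, finrank_invariants]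
    ext f
    rw [hS]
    constructor
    · rintro ⟨h1, h2⟩ x y (rfl | rfl)
      · exact (h1 x).symm
      · exact (h2 x).symm
    · intro h
      exact ⟨fun x => (h x _ (Or.inl rfl)).symm, fun x => (h x _ (Or.inr rfl)).symm⟩
  have e1 := finrank_map_add_finrank_inf_ker (twist α) F
  rw [hI (F ⊓ LinearMap.ker (twist α)) ?_, hF, finrank_invariants, ← hF, ← hB] at e1
  swap
  · intro f
    rw [ker_twist]
    constructor
    · rintro ⟨h1, h2⟩
      have h3 : ∀ x, f (α x) = f x := fun x => (h2 x _ rfl).symm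
      refine ⟨fun x => ?_, h3⟩
      have := h1 (α x) (σ x) (by simp [hα])
      rw [← this, h3]
    · rintro ⟨h1, h2⟩
      refine ⟨?_, ?_⟩
      · rintro x _ rfl
        rw [h1, h2]
      · rintro x _ rfl
        rw [h2]
  have e2 := finrank_map_add_finrank_inf_ker (twist σ)
    (LinearMap.ker ((twist α).comp (twist σ)))
  rw [inf_eq_right.2 (LinearMap.ker_le_ker_comp _ _), ← hZ] at e2
  -- After transposition, the range of `twist α⁻¹` is its kernel, on which `twist σ⁻¹` vanishes
  -- exactly at functions constant on components. This yields the rank of the composite.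
  have e3 := LinearMap.finrank_range_add_finrank_ker ((twist α).comp (twist σ))
  rw [finrank_range_twist_comp, hαinv, LinearMap.range_comp, Module.finrank_fintype_fun_eq_card,
    range_twist_of_involutive α hα hne] at e3
  have e4 := finrank_map_add_finrank_inf_ker (twist σ⁻¹) (LinearMap.ker (twist α))
  rw [hI (LinearMap.ker (twist α) ⊓ LinearMap.ker (twist σ⁻¹)) ?_] at e4
  swap
  · intro f
    rw [ker_twist, ker_twist]
    constructor
    · rintro ⟨h1, h2⟩
      refine ⟨fun x => ?_, fun x => (h1 x _ rfl).symm⟩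
      exact h2 (σ x) x (by simp)
    · rintro ⟨h1, h2⟩
      refine ⟨?_, ?_⟩
      · rintro x _ rfl
        rw [h2]
      · rintro x _ rfl
        obtain ⟨y, rfl⟩ := σ.surjective x
        simp [h1]
  have e5 := two_mul_finrank_ker_twist α hα hne
  rw [ker_twist σ, finrank_invariants] at e2
  rw [← Nat.card_eq_fintype_card] at e3
  rw [hplanar, hdim]
  omega

end DartPair

/-! ### First return maps -/

namespace DartPair

open Equiv

variable {D : Type*}

/-- `y` is the first point satisfying `P` on the orbit of `x` under `σ`, after `x` itself. -/
inductive Next (σ : Perm D) (P : D → Prop) : D → D → Prop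
  | here (x : D) : P (σ x) → Next σ P x (σ x)
  | skip (x y : D) : ¬ P (σ x) → Next σ P (σ x) y → Next σ P x y

variable {σ α : Perm D} {P : D → Prop}

theorem Next.mem {x y : D} (h : Next σ P x y) : P y := by
  induction h with
  | here x h => exact h
  | skip x y _ _ ih => exact ih

theorem Next.unique {x y z : D} (h : Next σ P x y) (h' : Next σ P x z) : y = z := by
  induction h with
  | here x h =>
    cases h' with
    | here _ _ => rfl
    | skip _ _ h1 _ => exact absurd h h1
  | skip x y h1 _ ih =>
    cases h' with
    | here _ h => exact absurd h h1
    | skip _ _ _ h2 => exact ih h2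

theorem next_iff {x y : D} :
    Next σ P x y ↔ ∃ m, σ^[m + 1] x = y ∧ (∀ i < m, ¬ P (σ^[i + 1] x)) ∧ P y := by
  constructor
  · intro h
    induction h with
    | here x h => exact ⟨0, rfl, by simp, h⟩
    | skip x y h1 _ ih =>
      obtain ⟨m, hm, hi, hy⟩ := ih
      refine ⟨m + 1, hm, fun i hi' => ?_, hy⟩
      cases i with
      | zero => exact h1
      | succ i => exact hi i (by omega)
  · rintro ⟨m, hm, hi, hy⟩
    induction m generalizing x with
    | zero =>
      subst hm
      exact .here x hy
    | succ m ih =>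
      exact .skip x y (hi 0 (by omega)) (ih hm fun i hi' => hi (i + 1) (by omega))

theorem Next.sameCycle {x y : D} (h : Next σ P x y) : σ.SameCycle x y := by
  induction h with
  | here x _ => exact Perm.sameCycle_apply_right.2 (Perm.SameCycle.refl _ _)
  | skip x y _ _ ih => exact Perm.sameCycle_apply_left.1 ih

theorem Next.eq_of_eq {x x' y : D} (h : Next σ P x y) (h' : Next σ P x' y) (hx : P x)
    (hx' : P x') : x = x' := by
  rw [next_iff] at h h'
  obtain ⟨m, hm, hi, -⟩ := h
  obtain ⟨m', hm', hi', -⟩ := h'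
  wlog hle : m ≤ m' generalizing x x' m m'
  · exact (this hx' hx m' hm' hi' m hm hi (by omega)).symm
  obtain ⟨d, rfl⟩ := Nat.exists_eq_add_of_le hle
  have : x = σ^[d] x' := by
    apply σ.injective.iterate (m + 1)
    rw [hm, ← hm', ← iterate_add_apply, show m + 1 + d = m + d + 1 by omega]
  cases d with
  | zero => exact this
  | succ d => exact absurd (this ▸ hx) (hi' d (by omega))

theorem exists_iterate_of_sameCycle [Finite D] {x y : D} (h : σ.SameCycle x y) :
    ∃ i, σ^[i] x = y := by
  obtain ⟨i, hi⟩ := h.exists_nat_pow_eq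
  exact ⟨i, by rw [Perm.iterate_eq_pow, hi]⟩

theorem sameCycle_iterate (σ : Perm D) (i : ℕ) (x : D) : σ.SameCycle x (σ^[i] x) :=
  ⟨i, by rw [Perm.iterate_eq_pow, zpow_natCast]⟩

theorem exists_next [Finite D] {x z : D} (h : σ.SameCycle x z) (hz : P z) :
    ∃ y, Next σ P x y := by
  classical
  have : ∃ m, P (σ^[m + 1] x) := by
    obtain ⟨i, hi⟩ := exists_iterate_of_sameCycle (Perm.sameCycle_apply_left.2 h)
    exact ⟨i, by rwa [iterate_succ_apply, hi]⟩
  exact ⟨_, next_iff.2 ⟨Nat.find this, rfl, fun i hi => Nat.find_min this hi,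
    Nat.find_spec this⟩⟩

/-- The first return map of `σ` to `P`. -/
noncomputable def firstReturn [Finite D] (σ : Perm D) (P : D → Prop) : Perm {x // P x} :=
  Equiv.ofBijective
    (fun x => ⟨(exists_next (Perm.SameCycle.refl σ x.1) x.2).choose,
      (exists_next (Perm.SameCycle.refl σ x.1) x.2).choose_spec.mem⟩)
    (Finite.injective_iff_bijective.1 fun x y h => by
      have hx := (exists_next (Perm.SameCycle.refl σ x.1) x.2).choose_spec
      have hy := (exists_next (Perm.SameCycle.refl σ y.1) y.2).choose_spec
      rw [← Subtype.mk.inj h] at hy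
      exact Subtype.ext (hx.eq_of_eq hy x.2 y.2))

theorem next_firstReturn [Finite D] (x : {x // P x}) : Next σ P x.1 (firstReturn σ P x).1 :=
  (exists_next (Perm.SameCycle.refl σ x.1) x.2).choose_spec

theorem firstReturn_eq_iff [Finite D] {x y : {x // P x}} :
    firstReturn σ P x = y ↔ Next σ P x.1 y.1 :=
  ⟨fun h => h ▸ next_firstReturn x, fun h => Subtype.ext ((next_firstReturn x).unique h)⟩

theorem firstReturn_sameCycle_iff [Finite D] {x y : {x // P x}} :
    (firstReturn σ P).SameCycle x y ↔ σ.SameCycle x.1 y.1 := by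
  constructor
  · intro h
    obtain ⟨i, rfl⟩ := exists_iterate_of_sameCycle h
    induction i with
    | zero => exact Perm.SameCycle.refl _ _
    | succ i ih =>
      rw [iterate_succ_apply']
      exact (ih (sameCycle_iterate _ i x)).trans (next_firstReturn _).sameCycle
  · intro h
    obtain ⟨i, hi⟩ := exists_iterate_of_sameCycle h
    clear h
    induction i using Nat.strong_induction_on generalizing x with
    | _ i ih =>
      cases i with
      | zero => exact (Subtype.ext hi : x = y) ▸ Perm.SameCycle.refl _ _
      | succ i =>
        obtain ⟨m, hm, hm', -⟩ := next_iff.1 (next_firstReturn (σ := σ) x)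
        have hle : m ≤ i := by
          by_contra hlt
          exact hm' i (by omega) (hi ▸ y.2)
        rw [← Perm.sameCycle_apply_left]
        refine ih (i - m) (by omega) ?_
        rw [← hm, ← iterate_add_apply, ← hi, show i - m + (m + 1) = i + 1 by omega]

/-! ### Switches -/

theorem exists_switch [Finite D] {π : Perm D} (out : D → Bool) {x y : D} (h : π.SameCycle x y)
    (hxy : out x ≠ out y) :
    ∃ z, π.SameCycle x z ∧ out z = out x ∧ out (π z) ≠ out x := by
  obtain ⟨i, rfl⟩ := exists_iterate_of_sameCycle h
  clear h
  induction i generalizing x with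
  | zero => exact absurd rfl hxy
  | succ i ih =>
    by_cases hx : out (π x) = out x
    · obtain ⟨z, h1, h2, h3⟩ := ih (x := π x) (by rwa [hx])
      exact ⟨z, Perm.sameCycle_apply_left.1 h1, by rw [h2, hx], by rwa [← hx]⟩
    · exact ⟨x, Perm.SameCycle.refl _ _, rfl, hx⟩

theorem quot_mk_eq_iff {π : Perm D} [Finite D] {x y : D} :
    Quot.mk (fun x y => π x = y) x = Quot.mk (fun x y => π x = y) y ↔ π.SameCycle x y := by
  rw [Quot.eq]
  constructor
  · intro h
    induction h with
    | rel x y h => exact h ▸ Perm.sameCycle_apply_right.2 (Perm.SameCycle.refl _ _)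
    | refl x => exact Perm.SameCycle.refl _ _
    | symm x y _ ih => exact ih.symm
    | trans x y z _ _ ih1 ih2 => exact ih1.trans ih2
  · intro h
    obtain ⟨i, rfl⟩ := exists_iterate_of_sameCycle h
    clear h
    induction i generalizing x with
    | zero => exact .refl _
    | succ i ih => exact .trans _ _ _ (.rel _ _ rfl) ih

/-- Each cycle of `π` has at most one switch from `b` to `!b`, for each `b`. -/
def UniqueSwitches (π : Perm D) (out : D → Bool) : Prop :=
  ∀ x y, π.SameCycle x y → out x = out y → out (π x) ≠ out x → out (π y) ≠ out y → x = y

/-- A count without slack. Each vertex cycle and each non-monochromatic face needs two switches, at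
most two faces are monochromatic, and there are as many switches as darts. Since there is at least
one component, Euler's formula forces equality everywhere. -/
theorem uniqueSwitches_of_isPlanar [Finite D] [Nonempty D] (hα : ∀ x, α (α x) = x)
    (hplanar : IsPlanar σ α) (out : D → Bool) (hout : ∀ x, out (α x) = !out x)
    (hσ : ∀ x, ∃ y, σ.SameCycle x y ∧ out x ≠ out y)
    (hφ : ∀ x y, (∀ z, Perm.SameCycle (α.trans σ) x z → out z = out x) →
      (∀ z, Perm.SameCycle (α.trans σ) y z → out z = out y) → out x = out y →
      Perm.SameCycle (α.trans σ) x y) :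
    UniqueSwitches σ out ∧ UniqueSwitches (α.trans σ) out := by
  classical
  set φ : Perm D := α.trans σ with hφdef
  have hne : ∀ x, α x ≠ x := fun x h => by
    have := hout x
    rw [h] at this
    cases hx : out x <;> simp [hx] at this
  have heuler := (isPlanar_iff σ α hα hne).1 hplanar
  have hk : 0 < Nat.card (Quot fun x y => σ x = y ∨ α x = y) := by
    have : Nonempty (Quot fun x y => σ x = y ∨ α x = y) := ⟨Quot.mk _ (Classical.arbitrary D)⟩
    exact Nat.card_pos
  let Qσ := Quot fun x y => σ x = y
  let Qφ := Quot fun x y => φ x = y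
  let mono : Qφ → Prop := fun q => ∃ x, Quot.mk _ x = q ∧ ∀ z, φ.SameCycle x z → out z = out x
  let Sσ := {x : D // out (σ x) ≠ out x}
  let Sφ := {x : D // out (φ x) ≠ out x}
  -- The corner between `α x` and `σ (α x)` is a switch of the face exactly when it is not one of
  -- the vertex, since reversal flips `out`.
  have hS : Nat.card Sσ + Nat.card Sφ = Nat.card D := by
    have e1 : Nat.card Sφ = Nat.card {x : D // ¬ out (σ x) ≠ out x} := by
      refine Nat.card_congr (α.subtypeEquiv fun x => ?_)
      change out (σ (α x)) ≠ out x ↔ _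
      rw [hout, not_not]
      cases out x <;> cases out (σ (α x)) <;> simp
    rw [e1, ← Nat.card_sum]
    exact Nat.card_congr (Equiv.sumCompl _)
  have hmono : Nat.card {q : Qφ // mono q} ≤ 2 := by
    have : Nat.card Bool = 2 := by simp
    rw [← this]
    refine Nat.card_le_card_of_injective (fun q => out q.2.choose) ?_
    rintro ⟨q, hq⟩ ⟨q', hq'⟩ h
    have h1 := hq.choose_spec
    have h2 := hq'.choose_spec
    apply Subtype.ext
    change q = q'
    rw [← h1.1, ← h2.1]
    exact quot_mk_eq_iff.2 (hφ _ _ h1.2 h2.2 h)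
  have hcompl : Nat.card {q : Qφ // mono q} + Nat.card {q : Qφ // ¬ mono q} = Nat.card Qφ := by
    rw [← Nat.card_sum]
    exact Nat.card_congr (Equiv.sumCompl _)
  let fσ : Sσ → Qσ × Bool := fun x => (Quot.mk _ x.1, out x.1)
  have hfσ : Surjective fσ := by
    rintro ⟨q, b⟩
    induction q using Quot.ind with | _ x => ?_
    obtain ⟨y, hy, hne⟩ := hσ x
    obtain ⟨z, z', hz, hzz', hzb, hz'⟩ :
        ∃ z z', σ.SameCycle x z ∧ σ.SameCycle z z' ∧ out z = b ∧ out z ≠ out z' := by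
      by_cases hb : out x = b
      · exact ⟨x, y, Perm.SameCycle.refl _ _, hy, hb, hne⟩
      · refine ⟨y, x, hy, hy.symm, ?_, hne.symm⟩
        revert hb hne
        cases out x <;> cases out y <;> cases b <;> simp
    obtain ⟨u, hu1, hu2, hu3⟩ := exists_switch out hzz' hz'
    refine ⟨⟨u, by rwa [hu2]⟩, Prod.ext ?_ (hu2.trans hzb)⟩
    exact quot_mk_eq_iff.2 (hz.trans hu1).symm
  have hnm : ∀ x : Sφ, ¬ mono (Quot.mk _ x.1) := by
    rintro ⟨x, hx⟩ ⟨y, hy, hy'⟩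
    have hyx := quot_mk_eq_iff.1 hy
    exact hx ((hy' _ (Perm.sameCycle_apply_right.2 hyx)).trans (hy' _ hyx).symm)
  let fφ : Sφ → {q : Qφ // ¬ mono q} × Bool := fun x => (⟨Quot.mk _ x.1, hnm x⟩, out x.1)
  have hfφ : Surjective fφ := by
    rintro ⟨⟨q, hq⟩, b⟩
    induction q using Quot.ind with | _ x => ?_
    obtain ⟨y, hy, hne⟩ : ∃ y, φ.SameCycle x y ∧ out x ≠ out y := by
      by_contra hcon
      push Not at hcon
      exact hq ⟨x, rfl, fun z hz => (hcon z hz).symm⟩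
    obtain ⟨z, z', hz, hzz', hzb, hz'⟩ :
        ∃ z z', φ.SameCycle x z ∧ φ.SameCycle z z' ∧ out z = b ∧ out z ≠ out z' := by
      by_cases hb : out x = b
      · exact ⟨x, y, Perm.SameCycle.refl _ _, hy, hb, hne⟩
      · refine ⟨y, x, hy, hy.symm, ?_, hne.symm⟩
        revert hb hne
        cases out x <;> cases out y <;> cases b <;> simp
    obtain ⟨u, hu1, hu2, hu3⟩ := exists_switch out hzz' hz'
    refine ⟨⟨u, by rwa [hu2]⟩, Prod.ext (Subtype.ext ?_) (hu2.trans hzb)⟩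
    exact quot_mk_eq_iff.2 (hz.trans hu1).symm
  have c1 := Nat.card_le_card_of_surjective fσ hfσ
  have c2 := Nat.card_le_card_of_surjective fφ hfφ
  have hB : Nat.card Bool = 2 := by simp
  have d1 : Nat.card (Qσ × Bool) = Nat.card Qσ * 2 := by rw [Nat.card_prod, hB]
  have d2 : Nat.card ({q : Qφ // ¬ mono q} × Bool) = Nat.card {q : Qφ // ¬ mono q} * 2 := by
    rw [Nat.card_prod, hB]
  change 2 * (Nat.card Qσ + Nat.card Qφ) = _ at heuler
  -- The two surjections give lower bounds that already exhaust the number of darts, so both are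
  -- injective.
  have i1 := (hfσ.bijective_of_nat_card_le (by omega)).1
  have i2 := (hfφ.bijective_of_nat_card_le (by omega)).1
  constructor
  · intro x y hxy ho hx hy
    have := @i1 ⟨x, hx⟩ ⟨y, hy⟩ (Prod.ext (quot_mk_eq_iff.2 hxy) ho)
    exact Subtype.mk.inj this
  · intro x y hxy ho hx hy
    have := @i2 ⟨x, hx⟩ ⟨y, hy⟩ (Prod.ext (Subtype.ext (quot_mk_eq_iff.2 hxy)) ho)
    exact Subtype.mk.inj this

/-! ### Planarity after deletions -/

theorem add_self_zmod_two (a : ZMod 2) : a + a = 0 := by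
  revert a; decide

/-- A cycle on the part `P` of a planar map bounds a union of faces of the whole map. -/
theorem IsPlanar.exists_potential [Finite D] (hplanar : IsPlanar σ α) (hα : ∀ x, α (α x) = x)
    (hP : ∀ x, P x → P (α x)) (h : D → ZMod 2) (hh : ∀ x, P x → h (α x) = h x)
    (g : {x // P x} → ZMod 2) (hg : ∀ x : {x // P x}, h x = g x + g (firstReturn σ P x)) :
    ∃ p : D → ZMod 2, (∀ x, p (σ (α x)) = p x) ∧ (∀ x, ¬ P x → p x = p (α x)) ∧
      ∀ x, P x → h x = p x + p (α x) := by
  classical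
  -- Extended by zero to the deleted edges, the cycle remains a cycle: its witness is constant along
  -- each run of skipped darts, with the value at the next kept dart. On a vertex cycle without kept
  -- darts any constant serves.
  let g' : D → ZMod 2 := fun x => if hx : P x then g ⟨x, hx⟩ else
    if hy : ∃ y, Next σ P x y then g ⟨hy.choose, hy.choose_spec.mem⟩ else 0
  let h' : D → ZMod 2 := fun x => if P x then h x else 0
  have hg'n : ∀ x y (hn : Next σ P x y), ¬ P x → g' x = g ⟨y, hn.mem⟩ := by
    intro x y hn hx
    have hy : ∃ y, Next σ P x y := ⟨y, hn⟩
    simp only [g', dif_neg hx, dif_pos hy]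
    congr 2
    exact hy.choose_spec.unique hn
  have hg's : ∀ x y (hn : Next σ P x y), g' (σ x) = g ⟨y, hn.mem⟩ := by
    intro x y hn
    cases hn with
    | here _ h => simp [g', h]
    | skip _ _ h1 h2 => exact hg'n _ _ h2 h1
  obtain ⟨p, hp, hp'⟩ := hplanar h' (by
    intro x
    by_cases hx : P x
    · simp [h', hx, hP x hx, hh x hx]
    · have : ¬ P (α x) := fun h => hx (hα x ▸ hP _ h)
      simp [h', hx, this]) ⟨g', by
    intro x
    by_cases hx : P x
    · rw [hg's _ _ (next_firstReturn ⟨x, hx⟩)]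
      simp [h', g', hx, hg ⟨x, hx⟩]
    · simp only [h', if_neg hx]
      by_cases hy : ∃ y, Next σ P x y
      · obtain ⟨y, hy⟩ := hy
        rw [hg'n _ _ hy hx, hg's _ _ hy, add_self_zmod_two]
      · have h1 : ¬ P (σ x) := fun h => hy ⟨_, .here _ h⟩
        have h2 : ¬ ∃ y, Next σ P (σ x) y := fun ⟨y, h⟩ => hy ⟨y, .skip _ _ h1 h⟩
        simp [g', hx, hy, h1, h2]⟩
  refine ⟨p, hp, fun x hx => ?_, fun x hx => ?_⟩
  · rw [← add_eq_zero_iff_eq_zmod_two, ← hp']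
    simp [h', hx]
  · rw [← hp']
    simp [h', hx]

/-- Face functions that agree across deleted edges descend to the faces of the remaining graph,
because each skipped dart merges the faces at its two sides. -/
theorem Next.apply_eq {β : Type*} {p : D → β} (hp : ∀ x, p (σ (α x)) = p x)
    (hα : ∀ x, α (α x) = x) (hp' : ∀ x, ¬ P x → p x = p (α x)) {x y : D} (h : Next σ P x y) :
    p y = p (α x) := by
  induction h with
  | here x _ => rw [← hp (α x), hα]
  | skip x y h1 _ ih => rw [ih, ← hp' _ h1, ← hp (α x), hα]

theorem IsPlanar.restrict [Finite D] (hplanar : IsPlanar σ α) (hα : ∀ x, α (α x) = x)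
    (hP : ∀ x, P (α x) ↔ P x) : IsPlanar (firstReturn σ P) (α.subtypePerm hP) := by
  classical
  rintro h hh ⟨g, hg⟩
  let h' : D → ZMod 2 := fun x => if hx : P x then h ⟨x, hx⟩ else 0
  obtain ⟨p, hp, hpn, hpp⟩ := hplanar.exists_potential hα (fun x => (hP x).2) h' (by
      intro x hx
      have := hh ⟨x, hx⟩
      simp only [h', hx, (hP x).2 hx, dif_pos]
      exact this) g (by
      intro x
      rw [← hg]
      simp [h', x.2])
  refine ⟨fun x => p x, fun x => ?_, fun x => ?_⟩
  · have := (next_firstReturn (σ := σ) (α.subtypePerm hP x)).apply_eq hp hα hpn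
    refine this.trans ?_
    simp [hα]
  · have := hpp x.1 x.2
    simp only [h', x.2, dif_pos] at this
    exact this

/-! ### Joining a new vertex inside a face to all its corners -/

section Star

variable (σ α) (O : D → Prop)

open Classical in
/-- The rotation after a new vertex is added to the face `O` and joined to all its corners.  The
new darts are `(y, false)`, inserted just before `y`, and `(y, true)`, at the new vertex. -/
noncomputable def starRot (hO : ∀ x, O (σ (α x)) ↔ O x) : Perm (D ⊕ {y // O y} × Bool) where
  toFun
    | .inl x => if h : O (σ x) then .inr (⟨σ x, h⟩, false) else .inl (σ x)
    | .inr (y, false) => .inl y.1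
    | .inr (y, true) => .inr (⟨α.symm (σ.symm y.1), by rw [← hO]; simpa using y.2⟩, true)
  invFun
    | .inl x => if h : O x then .inr (⟨x, h⟩, false) else .inl (σ.symm x)
    | .inr (y, false) => .inl (σ.symm y.1)
    | .inr (y, true) => .inr (⟨σ (α y.1), (hO _).2 y.2⟩, true)
  left_inv := by
    rintro (x | ⟨y, _ | _⟩)
    · by_cases h : O (σ x) <;> simp [h]
    · simp [y.2]
    · simp
  right_inv := by
    rintro (x | ⟨y, _ | _⟩)
    · by_cases h : O x <;> simp [h]
    · simp [y.2]
    · simp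

/-- The reversal of darts after a new vertex is added. -/
def starRev : Perm (D ⊕ {y // O y} × Bool) where
  toFun
    | .inl x => .inl (α x)
    | .inr (y, b) => .inr (y, !b)
  invFun
    | .inl x => .inl (α.symm x)
    | .inr (y, b) => .inr (y, !b)
  left_inv := by rintro (x | ⟨y, b⟩) <;> simp
  right_inv := by rintro (x | ⟨y, b⟩) <;> simp

variable {σ α O}

/-- The spokes cut the face into triangles, one for each old side. Adding suitable triangle
boundaries clears a cycle from all spokes and leaves a cycle of the old map. -/
theorem IsPlanar.star (hplanar : IsPlanar σ α) (hα : ∀ x, α (α x) = x)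
    (hO : ∀ x, O (σ (α x)) ↔ O x) : IsPlanar (starRot σ α O hO) (starRev α O) := by
  classical
  rintro h hh ⟨g, hg⟩
  have hαs : ∀ x, α.symm x = α x := fun x => by rw [symm_apply_eq, hα]
  -- The coefficient of the triangle on the side `x` is read off from the witness at the new vertex:
  -- consecutive coefficients differ by the value of `h` on the spoke between them.
  let t : D → ZMod 2 := fun x => if hx : O x then g (.inr (⟨x, hx⟩, true)) else 0
  have ht : ∀ y : {y // O y}, ∀ b, h (.inr (y, b)) = t y + t (α (σ.symm y)) := by
    intro y b
    have h1 : h (.inr (y, b)) = h (.inr (y, true)) := by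
      cases b
      · exact hh (.inr (y, true))
      · rfl
    have hy : O (α (σ.symm y)) := by rw [← hO, hα, apply_symm_apply]; exact y.2
    rw [h1, hg]
    simp only [t, dif_pos y.2, dif_pos hy]
    congr 2
    simp [starRot, hαs]
  have htri : ∀ x (hx : O (σ x)), g (.inr (⟨σ x, hx⟩, false)) =
       g (.inl (σ x)) + t (σ x) + t (α x) := by
    intro x hx
    have h1 := ht ⟨σ x, hx⟩ false
    rw [hg] at h1
    have e : starRot σ α O hO (.inr (⟨σ x, hx⟩, false)) = .inl (σ x) := rfl
    rw [e] at h1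
    simp only [symm_apply_apply] at h1
    rw [add_assoc, ← h1, add_comm (g (.inl (σ x))), add_assoc, add_self_zmod_two, add_zero]
  obtain ⟨p, hp, hpp⟩ := hplanar (fun x => h (.inl x) + t x + t (α x)) (by
      intro x
      have := hh (.inl x)
      change h (.inl (α x)) = _ at this
      rw [this, hα]
      ring) ⟨fun x => g (.inl x) + t x, by
      intro x
      rw [hg]
      by_cases hx : O (σ x)
      · have e : starRot σ α O hO (.inl x) = .inr (⟨σ x, hx⟩, false) := by simp [starRot, hx]
        rw [e, htri x hx]
        have : t (α x) + t (α x) = 0 := add_self_zmod_two _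
        linear_combination this
      · have e : starRot σ α O hO (.inl x) = .inl (σ x) := by simp [starRot, hx]
        have h1 : t (σ x) = 0 := by simp [t, hx]
        have h2 : t (α x) = 0 := by
          have : ¬ O (α x) := by rw [← hO, hα]; exact hx
          simp [t, this]
        simp only [e, h1, h2]
        ring⟩
  -- Each triangle gets the potential of the old face plus its own coefficient. The dart `(y, true)`
  -- lies in the triangle of `y`, and `(y, false)` in that of the preceding side `α (σ.symm y)`.
  refine ⟨fun z => z.elim (fun x => p x + t x) (fun z =>
    if z.2 then p z.1 + t z.1 else p z.1 + t (α (σ.symm z.1))), ?_, ?_⟩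
  · rintro (x | ⟨y, _ | _⟩)
    · change Sum.elim _ _ (starRot σ α O hO (.inl (α x))) = _
      by_cases hx : O (σ (α x))
      · have e : starRot σ α O hO (.inl (α x)) = .inr (⟨σ (α x), hx⟩, false) := by
          simp [starRot, hx]
        rw [e]
        simp [hp, hα]
      · have e : starRot σ α O hO (.inl (α x)) = .inl (σ (α x)) := by simp [starRot, hx]
        have hx' := hx
        rw [hO] at hx'
        rw [e]
        simp [hp, t, hx, hx']
    · change Sum.elim _ _ (starRot σ α O hO (.inr (y, true))) = _
      have h1 := hp (α (σ.symm y))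
      rw [hα, apply_symm_apply] at h1
      simp [starRot, hαs, h1]
    · change Sum.elim _ _ (starRot σ α O hO (.inr (y, false))) = _
      simp [starRot]
  · rintro (x | ⟨y, b⟩)
    · have h1 := hpp x
      have h2 : t x + t x = 0 := add_self_zmod_two _
      have h3 : t (α x) + t (α x) = 0 := add_self_zmod_two _
      simp only [starRev, coe_fn_mk, Sum.elim_inl]
      linear_combination h1 - h2 - h3
    · rw [ht]
      have h2 : p y + p y = 0 := add_self_zmod_two _
      cases b
      · simp only [starRev, coe_fn_mk, Sum.elim_inr]
        simp
        linear_combination -h2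
      · simp only [starRev, coe_fn_mk, Sum.elim_inr]
        simp
        linear_combination -h2

end Star

end DartPair

/-! ### Euler's formula for graphs with isolated vertices -/

namespace DirectedMultigraph

open DartPair Equiv

section Euler

variable {V E : Type*} (G : DirectedMultigraph V E)

theorem reverse_reverse {E : Type*} (x : E × Bool) : reverse (reverse x) = x := by
  simp [reverse]

theorem reverse_ne {E : Type*} (x : E × Bool) : reverse x ≠ x := by
  rcases x with ⟨e, b⟩
  cases b <;> simp [reverse]

theorem not_isIsolated_origin (x : E × Bool) : ¬ G.IsIsolated (G.origin x) := by
  rintro ⟨h1, h2⟩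
  rcases x with ⟨e, _ | _⟩
  · exact h2 e rfl
  · exact h1 e rfl

theorem exists_origin_eq {v : V} (hv : ¬ G.IsIsolated v) : ∃ x, G.origin x = v := by
  simp only [IsIsolated, IsSource, IsSink, not_and_or, not_forall, not_not] at hv
  rcases hv with ⟨e, he⟩ | ⟨e, he⟩
  · exact ⟨(e, true), he⟩
  · exact ⟨(e, false), he⟩

theorem sameComponent_reverse (x : E × Bool) :
    G.SameComponent (G.origin x) (G.origin (reverse x)) := by
  rcases x with ⟨e, _ | _⟩
  · exact .rel _ _ ⟨e, rfl, rfl⟩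
  · exact .symm _ _ (.rel _ _ ⟨e, rfl, rfl⟩)

variable {G} {rot : Perm (E × Bool)}
  (hrot : ∀ x y, rot.SameCycle x y ↔ G.origin x = G.origin y)

include hrot

theorem origin_rot (x : E × Bool) : G.origin (rot x) = G.origin x :=
  ((hrot _ _).1 (Perm.sameCycle_apply_right.2 (Perm.SameCycle.refl _ _))).symm

theorem card_vertices [Finite V] [Finite E] : Nat.card V =
    Nat.card (Quot fun x y => rot x = y) + Nat.card {v // G.IsIsolated v} := by
  rw [← Nat.card_sum]
  refine (Nat.card_congr (Equiv.ofBijective (Sum.elim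
    (Quot.lift G.origin fun x y (h : rot x = y) => h ▸ (origin_rot hrot x).symm)
    Subtype.val) ⟨?_, ?_⟩)).symm
  · rintro (x | x) (y | y) h
    · induction x using Quot.ind
      induction y using Quot.ind
      exact congrArg Sum.inl (quot_mk_eq_iff.2 ((hrot _ _).2 h))
    · induction x using Quot.ind with | _ x => ?_
      have h : G.origin x = y.1 := h
      exact absurd y.2 (h ▸ G.not_isIsolated_origin x)
    · induction y using Quot.ind with | _ y => ?_
      have h : x.1 = G.origin y := h
      exact absurd x.2 (h ▸ G.not_isIsolated_origin y)
    · exact congrArg Sum.inr (Subtype.ext h)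
  · intro v
    by_cases hv : G.IsIsolated v
    · exact ⟨.inr ⟨v, hv⟩, rfl⟩
    · obtain ⟨x, rfl⟩ := G.exists_origin_eq hv
      exact ⟨.inl (Quot.mk _ x), rfl⟩

theorem quot_mk_eq_of_origin_eq [Finite E] {x y : E × Bool} (h : G.origin x = G.origin y) :
    Quot.mk (fun x y => rot x = y ∨ reverse x = y) x
      = Quot.mk (fun x y => rot x = y ∨ reverse x = y) y := by
  have h1 := Quot.eqvGen_exact (quot_mk_eq_iff.2 ((hrot _ _).2 h))
  exact Quot.eqvGen_sound (h1.mono fun _ _ h => Or.inl h)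

theorem card_components [Finite V] [Finite E] : Nat.card G.Components =
    Nat.card (Quot fun x y => rot x = y ∨ reverse x = y) + Nat.card {v // G.IsIsolated v} := by
  classical
  rw [← Nat.card_sum]
  let R : E × Bool → E × Bool → Prop := fun x y => rot x = y ∨ reverse x = y
  let f : V → Quot R ⊕ {v // G.IsIsolated v} := fun v =>
    if hv : G.IsIsolated v then .inr ⟨v, hv⟩ else .inl (Quot.mk _ (G.exists_origin_eq hv).choose)
  have hf : ∀ x, f (G.origin x) = .inl (Quot.mk _ x) := by
    intro x
    have hx := G.not_isIsolated_origin x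
    simp only [f, dif_neg hx]
    exact congrArg Sum.inl
      (quot_mk_eq_of_origin_eq hrot (G.exists_origin_eq hx).choose_spec)
  refine Nat.card_congr
    { toFun := Quot.lift f ?_
      invFun := Sum.elim (Quot.lift (fun x => Quot.mk _ (G.origin x)) ?_)
        (fun v => Quot.mk _ v.1)
      left_inv := ?_
      right_inv := ?_ }
  · rintro u v ⟨e, rfl, rfl⟩
    have h1 := hf (e, false)
    have h2 := hf (e, true)
    change f (G.tail e) = _ at h1
    change f (G.head e) = _ at h2
    rw [h1, h2]
    exact congrArg Sum.inl (Quot.sound (Or.inr rfl))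
  · rintro x _ (rfl | rfl)
    · rw [origin_rot hrot]
    · exact Quot.eqvGen_sound (G.sameComponent_reverse x)
  · intro q
    induction q using Quot.ind with | _ v => ?_
    by_cases hv : G.IsIsolated v
    · simp only [f, dif_pos hv]
      rfl
    · obtain ⟨x, rfl⟩ := G.exists_origin_eq hv
      simp only [hf]
      rfl
  · rintro (x | v)
    · induction x using Quot.ind with | _ x => ?_
      exact hf x
    · exact dif_pos v.2

/-- Isolated vertices are invisible to the darts, but each contributes `2` to both sides of Euler's
formula: a vertex and a face on one side, twice a component on the other. -/
theorem euler_iff_isPlanar [Finite V] [Finite E] :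
    Nat.card V + (Nat.card (Quot fun x y => faceWalk rot x = y)
      + Nat.card {v // G.IsIsolated v}) = Nat.card E + 2 * Nat.card G.Components ↔
    IsPlanar rot reverse := by
  rw [isPlanar_iff _ _ reverse_reverse reverse_ne, card_vertices hrot, card_components hrot,
    Nat.card_prod]
  have : Nat.card Bool = 2 := by simp
  rw [this]
  change Nat.card _ + _ + (Nat.card (Quot fun x y => rot (reverse x) = y) + _) = _ ↔ _
  omega

end Euler

/-! ### Acyclicity and routes between endpoints -/

section Routes

variable {V E : Type*} (G : DirectedMultigraph V E)

theorem Acyclic.wellFounded [Finite V] {G : DirectedMultigraph V E} (h : G.Acyclic) :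
    WellFounded G.Step := by
  have : Std.Irrefl (Relation.TransGen G.Step) := ⟨h⟩
  exact (Finite.wellFounded_of_trans_of_irrefl (Relation.TransGen G.Step)).mono
    (by intro a b h; exact .single h)

theorem Acyclic.wellFounded_flip [Finite V] {G : DirectedMultigraph V E} (h : G.Acyclic) :
    WellFounded (flip G.Step) := by
  have : Std.Irrefl (flip (Relation.TransGen G.Step)) := ⟨fun a => h a⟩
  have : IsTrans V (flip (Relation.TransGen G.Step)) := ⟨fun a b c h1 h2 => h2.trans h1⟩
  exact (Finite.wellFounded_of_trans_of_irrefl (flip (Relation.TransGen G.Step))).mono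
    (by intro a b h; exact .single h)

/-- In an acyclic graph, no closed walk follows the directions of the edges. -/
theorem Acyclic.not_forall_step {D : Type*} [Finite D] {G : DirectedMultigraph V E}
    (h : G.Acyclic) {π : Perm D} {org : D → V} {x : D}
    (hx : ∀ z, π.SameCycle x z → G.Step (org z) (org (π z))) : False := by
  have key : ∀ i, Relation.TransGen G.Step (org x) (org (π^[i + 1] x)) := by
    intro i
    induction i with
    | zero => exact .single (hx _ (Perm.SameCycle.refl _ _))
    | succ i ih =>
      rw [iterate_succ_apply']
      exact ih.tail (hx _ (sameCycle_iterate _ _ _))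
  obtain ⟨i, hi⟩ := exists_iterate_of_sameCycle
    (Perm.sameCycle_apply_left.2 (Perm.SameCycle.refl π x))
  have := key i
  rw [iterate_succ_apply, hi] at this
  exact h _ this

theorem Acyclic.not_forall_step_symm {D : Type*} [Finite D] {G : DirectedMultigraph V E}
    (h : G.Acyclic) {π : Perm D} {org : D → V} {x : D}
    (hx : ∀ z, π.SameCycle x z → G.Step (org (π z)) (org z)) : False := by
  refine h.not_forall_step (π := π⁻¹) (org := org) (x := x) fun z hz => ?_
  have := hx (π⁻¹ z) (Perm.sameCycle_inv.1 (Perm.sameCycle_apply_right.2 hz))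
  simpa using this

variable {n : ℕ} (left right : Fin n → V)

/-- `e'` can follow `e` on a directed path of edges that are not deleted. -/
def KeptStep (e e' : E) : Prop :=
  ¬ G.Deleted left right e ∧ ¬ G.Deleted left right e' ∧ G.head e = G.tail e'

variable {G left right}

/-- A kept edge whose tail is not a left endpoint has a kept predecessor, since otherwise the tail
would have been removed as a source. By acyclicity, tracing back stops. -/
theorem exists_keptStep_left [Finite V] (hacyc : G.Acyclic) {e : E}
    (he : ¬ G.Deleted left right e) : ∃ e₀, ¬ G.Deleted left right e₀ ∧
      G.tail e₀ ∈ Set.range left ∧ Relation.ReflTransGen (G.KeptStep left right) e₀ e := by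
  induction hv : G.tail e using hacyc.wellFounded.induction generalizing e with
  | _ v ih =>
    subst hv
    rcases tail_mem_black he with h | ⟨⟨e', he', hh⟩, -⟩
    · exact ⟨e, he, h, .refl⟩
    · obtain ⟨e₀, h0, h1, h2⟩ := ih (G.tail e') ⟨e', rfl, hh⟩ he' rfl
      exact ⟨e₀, h0, h1, h2.tail ⟨he', he, hh⟩⟩

theorem exists_keptStep_right [Finite V] (hacyc : G.Acyclic) {e : E}
    (he : ¬ G.Deleted left right e) : ∃ e₁, ¬ G.Deleted left right e₁ ∧
      G.head e₁ ∈ Set.range right ∧ Relation.ReflTransGen (G.KeptStep left right) e e₁ := by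
  induction hv : G.head e using hacyc.wellFounded_flip.induction generalizing e with
  | _ v ih =>
    subst hv
    rcases head_mem_white he with h | ⟨-, ⟨e', he', hh⟩⟩
    · exact ⟨e, he, h, .refl⟩
    · obtain ⟨e₀, h0, h1, h2⟩ := ih (G.head e') ⟨e', hh, rfl⟩ he' rfl
      exact ⟨e₀, h0, h1, h2.head ⟨he, he', hh.symm⟩⟩

end Routes

end DirectedMultigraph

/-! ### Rotation and faces after the deletion -/

namespace DirectedMultigraph

open DartPair Equiv

section KeptDarts

variable {V E : Type*} {G : DirectedMultigraph V E} {n : ℕ}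

variable (G) in
/-- The dart is on an edge that is not deleted. -/
def KeptDart (left right : Fin n → V) (x : E × Bool) : Prop := ¬ G.Deleted left right x.1

variable {left right : Fin n → V}

theorem keptDart_reverse_iff (x : E × Bool) :
    G.KeptDart left right (reverse x) ↔ G.KeptDart left right x := Iff.rfl

theorem not_mem_left_of_kept_head {e : E} (he : ¬ G.Deleted left right e) :
    G.head e ∉ Set.range left := fun h => he (.into_left e h)

theorem not_mem_right_of_kept_tail {e : E} (he : ¬ G.Deleted left right e) :
    G.tail e ∉ Set.range right := fun h => he (.out_of_right e h)

theorem isTransit_tail {e : E} (he : ¬ G.Deleted left right e) (h : G.tail e ∉ Set.range left) :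
    G.IsTransit left right (G.tail e) := (tail_mem_black he).resolve_left h

theorem isTransit_head {e : E} (he : ¬ G.Deleted left right e) (h : G.head e ∉ Set.range right) :
    G.IsTransit left right (G.head e) := (head_mem_white he).resolve_left h

theorem IsTransit.not_mem_left {v : V} (h : G.IsTransit left right v) : v ∉ Set.range left := by
  obtain ⟨⟨e, he, rfl⟩, -⟩ := h
  exact not_mem_left_of_kept_head he

theorem IsTransit.not_mem_right {v : V} (h : G.IsTransit left right v) : v ∉ Set.range right := by
  obtain ⟨-, ⟨e, he, rfl⟩⟩ := h
  exact not_mem_right_of_kept_tail he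

variable [Finite E] (emb : G.PlanarEmbedding)

variable (left right) in
/-- The next dart around the origin whose edge is not deleted. -/
noncomputable def keptRot : Perm {x // G.KeptDart left right x} :=
  firstReturn emb.rot (G.KeptDart left right)

variable (left right) in
/-- The face permutation after the deletion. -/
noncomputable def keptFace : Perm {x // G.KeptDart left right x} :=
  Equiv.trans (reverse.subtypePerm keptDart_reverse_iff) (keptRot left right emb)

theorem keptRot_sameCycle_iff {x y : {x // G.KeptDart left right x}} :
    (keptRot left right emb).SameCycle x y ↔ G.origin x.1 = G.origin y.1 := by
  rw [keptRot, firstReturn_sameCycle_iff, emb.sameCycle_rot_iff]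

theorem origin_keptRot (x : {x // G.KeptDart left right x}) :
    G.origin (keptRot left right emb x).1 = G.origin x.1 :=
  (keptRot_sameCycle_iff emb).1 (Perm.sameCycle_apply_left.2 (Perm.SameCycle.refl _ _))

theorem origin_keptFace (x : {x // G.KeptDart left right x}) :
    G.origin (keptFace left right emb x).1 = G.origin (reverse x.1) :=
  origin_keptRot emb _

omit [Finite E] in
theorem nextKept_iff {x y : E × Bool} :
    G.NextKept left right emb.rot x y ↔ Next emb.rot (G.KeptDart left right) x y := by
  rw [next_iff]
  constructor
  · rintro ⟨h, m, hm, hi⟩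
    exact ⟨m, hm, fun i hi' => not_not.2 (hi i hi'), h⟩
  · rintro ⟨m, hm, hi, h⟩
    exact ⟨h, m, hm, fun i hi' => not_not.1 (hi i hi')⟩

theorem outerAfterDeletion_faceWalk_iff (x : E × Bool) :
    OuterAfterDeletion left right emb (emb.rot (reverse x)) ↔
      OuterAfterDeletion left right emb x := by
  refine ⟨fun h => ?_, fun h => .walk x h⟩
  obtain ⟨i, hi⟩ := exists_iterate_of_sameCycle (Perm.sameCycle_apply_left.2
    (Perm.SameCycle.refl (faceWalk emb.rot) x))
  rw [← hi]
  clear hi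
  change OuterAfterDeletion left right emb (faceWalk emb.rot x) at h
  induction i with
  | zero => exact h
  | succ i ih =>
    rw [iterate_succ_apply']
    exact .walk _ ih

omit [Finite E] in
theorem outerAfterDeletion_reverse_iff {x : E × Bool} (hx : ¬ G.KeptDart left right x) :
    OuterAfterDeletion left right emb x ↔ OuterAfterDeletion left right emb (reverse x) := by
  have hd : G.Deleted left right x.1 := not_not.1 hx
  exact ⟨fun h => .cross x hd h, fun h => by
    simpa only [reverse_reverse] using OuterAfterDeletion.cross (reverse x) hd h⟩

theorem outerAfterDeletion_of_next {x y : E × Bool}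
    (h : Next emb.rot (G.KeptDart left right) x y) :
    OuterAfterDeletion left right emb y ↔ OuterAfterDeletion left right emb (reverse x) := by
  have := h.apply_eq (p := OuterAfterDeletion left right emb) (α := reverse)
    (fun x => propext (outerAfterDeletion_faceWalk_iff emb x)) reverse_reverse
    (fun x hx => propext (outerAfterDeletion_reverse_iff emb hx))
  rw [this]

theorem outerAfterDeletion_keptFace_iff (x : {x // G.KeptDart left right x}) :
    OuterAfterDeletion left right emb (keptFace left right emb x).1 ↔
      OuterAfterDeletion left right emb x.1 := by
  have h := outerAfterDeletion_of_next emb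
    (next_firstReturn (σ := emb.rot) (reverse.subtypePerm keptDart_reverse_iff x))
  refine h.trans ?_
  simp [reverse_reverse]

/-- No boundary walk of a face follows the directions of the edges. -/
theorem exists_keptFace_ne (hacyc : G.Acyclic) (x : {x // G.KeptDart left right x}) :
    ∃ y, (keptFace left right emb).SameCycle x y ∧ x.1.2 ≠ y.1.2 := by
  by_contra hcon
  push Not at hcon
  cases hb : x.1.2 with
  | false =>
    refine hacyc.not_forall_step (π := keptFace left right emb)
      (org := fun z => G.origin z.1) (x := x) fun z hz => ?_
    rw [origin_keptFace]
    have : z.1.2 = false := by rw [← hcon z hz, hb]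
    exact ⟨z.1.1, by simp [origin, this], by simp [origin, reverse, this]⟩
  | true =>
    refine hacyc.not_forall_step_symm (π := keptFace left right emb)
      (org := fun z => G.origin z.1) (x := x) fun z hz => ?_
    rw [origin_keptFace]
    have : z.1.2 = true := by rw [← hcon z hz, hb]
    exact ⟨z.1.1, by simp [origin, reverse, this], by simp [origin, this]⟩

end KeptDarts

/-! ### The graph joined to a vertex at infinity -/

section Star

variable {V E : Type*} {G : DirectedMultigraph V E} {n : ℕ} (left right : Fin n → V)
  (emb : G.PlanarEmbedding) (x₀ : E × Bool) (k : ℕ)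

/-- A corner on the left arc at a left endpoint that still has an edge. -/
def LeftCorner (y : E × Bool) : Prop :=
  (∃ i ≤ k, (faceWalk emb.rot)^[i] x₀ = y) ∧ G.origin y ∈ Set.range left ∧
    ∃ e, ¬ G.Deleted left right e ∧ G.tail e = G.origin y

/-- A corner on the right arc at a right endpoint that still has an edge. -/
def RightCorner (y : E × Bool) : Prop :=
  (∃ i, k ≤ i ∧ i ≤ emb.sides x₀ ∧ (faceWalk emb.rot)^[i] x₀ = y) ∧
    G.origin y ∈ Set.range right ∧ ∃ e, ¬ G.Deleted left right e ∧ G.head e = G.origin y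

/-- The darts that remain when the graph is joined to a new vertex at infinity: the edges that are
not deleted, and the new edges at left and right corners. -/
def StarKept : (E × Bool) ⊕ {y // y ∈ emb.outer} × Bool → Prop
  | .inl x => G.KeptDart left right x
  | .inr z => LeftCorner left right emb x₀ k z.1 ∨ RightCorner left right emb x₀ k z.1

open Classical in
/-- The direction of the darts: the new edges point from infinity to left corners and from right
corners to infinity. -/
noncomputable def starOut : (E × Bool) ⊕ {y // y ∈ emb.outer} × Bool → Bool
  | .inl x => x.2
  | .inr (y, b) => if G.origin y.1 ∈ Set.range left then !b else b

variable {left right emb x₀ k}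

theorem RightCorner.not_mem_left {y : E × Bool} (h : RightCorner left right emb x₀ k y) :
    G.origin y ∉ Set.range left := by
  obtain ⟨-, -, e, he, h⟩ := h
  exact h ▸ not_mem_left_of_kept_head he

theorem LeftCorner.not_rightCorner {y : E × Bool} (h : LeftCorner left right emb x₀ k y) :
    ¬ RightCorner left right emb x₀ k y := fun h' => h'.not_mem_left h.2.1

theorem starKept_starRev_iff (z : (E × Bool) ⊕ {y // y ∈ emb.outer} × Bool) :
    StarKept left right emb x₀ k (starRev reverse (· ∈ emb.outer) z) ↔
      StarKept left right emb x₀ k z := by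
  rcases z with x | ⟨y, b⟩
  · exact Iff.rfl
  · exact Iff.rfl

theorem starOut_starRev (z : (E × Bool) ⊕ {y // y ∈ emb.outer} × Bool) :
    starOut left emb (starRev reverse (· ∈ emb.outer) z) = !starOut left emb z := by
  rcases z with ⟨e, b⟩ | ⟨y, b⟩
  · rfl
  · by_cases h : G.origin y.1 ∈ Set.range left <;> simp [starRev, starOut, h]

variable (emb) in
/-- The rotation of the graph joined to a new vertex at infinity. -/
noncomputable abbrev infRot : Perm ((E × Bool) ⊕ {y // y ∈ emb.outer} × Bool) :=
  starRot emb.rot reverse (· ∈ emb.outer) emb.faceWalk_mem_outer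

/-- The vertices of the graph joined to a new vertex at infinity. -/
def starOrigin : (E × Bool) ⊕ {y // y ∈ emb.outer} × Bool → Option V
  | .inl x => some (G.origin x)
  | .inr (y, false) => some (G.origin y.1)
  | .inr (_, true) => none

theorem infRot_inl_of_mem {x : E × Bool} (h : emb.rot x ∈ emb.outer) :
    infRot emb (.inl x) = .inr (⟨emb.rot x, h⟩, false) := by
  simp [infRot, starRot, h]

theorem infRot_inl_of_notMem {x : E × Bool} (h : emb.rot x ∉ emb.outer) :
    infRot emb (.inl x) = .inl (emb.rot x) := by
  simp [infRot, starRot, h]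

theorem infRot_inr_false (y : {y // y ∈ emb.outer}) :
    infRot emb (.inr (y, false)) = .inl y.1 := rfl

theorem infRot_inr_true {y y' : {y // y ∈ emb.outer}} (h : faceWalk emb.rot y.1 = y'.1) :
    infRot emb (.inr (y', true)) = .inr (y, true) := by
  have : reverse.symm (emb.rot.symm y'.1) = y.1 := by
    rw [← h]
    simp [faceWalk]
  simp [infRot, starRot, this]

theorem starOrigin_infRot (z : (E × Bool) ⊕ {y // y ∈ emb.outer} × Bool) :
    starOrigin (infRot emb z) = starOrigin z := by
  rcases z with x | ⟨y, _ | _⟩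
  · by_cases h : emb.rot x ∈ emb.outer
    · rw [infRot_inl_of_mem h]
      simp [starOrigin, origin_rot emb.sameCycle_rot_iff]
    · rw [infRot_inl_of_notMem h]
      simp [starOrigin, origin_rot emb.sameCycle_rot_iff]
  · rfl
  · rfl

theorem infRot_sameCycle_inl_rot (x : E × Bool) :
    (infRot emb).SameCycle (.inl x) (.inl (emb.rot x)) := by
  by_cases h : emb.rot x ∈ emb.outer
  · rw [← Perm.sameCycle_apply_left, infRot_inl_of_mem h, ← Perm.sameCycle_apply_left,
      infRot_inr_false]
  · rw [← Perm.sameCycle_apply_left, infRot_inl_of_notMem h]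

theorem infRot_sameCycle_inl [Finite E] {x y : E × Bool} (h : G.origin x = G.origin y) :
    (infRot emb).SameCycle (.inl x) (.inl y) := by
  obtain ⟨i, rfl⟩ := exists_iterate_of_sameCycle ((emb.sameCycle_rot_iff x y).2 h)
  clear h
  induction i with
  | zero => rfl
  | succ i ih =>
    rw [iterate_succ_apply']
    exact ih.trans (infRot_sameCycle_inl_rot _)

theorem infRot_sameCycle_inr_false [Finite E] {x : E × Bool} {y : {y // y ∈ emb.outer}}
    (h : G.origin x = G.origin y.1) : (infRot emb).SameCycle (.inl x) (.inr (y, false)) := by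
  rw [← Perm.sameCycle_apply_right, infRot_inr_false]
  exact infRot_sameCycle_inl h

theorem iterate_faceWalk_mem_outer {x : E × Bool} (hx : x ∈ emb.outer) (i : ℕ) :
    (faceWalk emb.rot)^[i] x ∈ emb.outer := by
  induction i with
  | zero => exact hx
  | succ i ih => rwa [iterate_succ_apply', emb.faceWalk_mem_outer]

/-- Seen from infinity the corners appear in the reverse order of the boundary walk, so rotation
lowers the index. -/
theorem infRot_iterate_inr_true (hx₀ : x₀ ∈ emb.outer) (i d : ℕ) :
    (infRot emb)^[d] (.inr (⟨_, iterate_faceWalk_mem_outer hx₀ (i + d)⟩, true)) =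
      .inr (⟨_, iterate_faceWalk_mem_outer hx₀ i⟩, true) := by
  induction d with
  | zero => rfl
  | succ d ih =>
    rw [iterate_succ_apply, infRot_inr_true (y := ⟨_, iterate_faceWalk_mem_outer hx₀ (i + d)⟩)]
    · exact ih
    · exact (iterate_succ_apply' _ _ _).symm

theorem infRot_sameCycle_inr_true [Finite E] (hconn : G.Connected)
    (y y' : {y // y ∈ emb.outer}) :
    (infRot emb).SameCycle (.inr (y, true)) (.inr (y', true)) := by
  obtain ⟨i, hi⟩ := exists_iterate_of_sameCycle
    (emb.outer_unique y'.1 y'.2 y.1 y.2 (hconn.2 _ _))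
  have h := infRot_iterate_inr_true y'.2 0 i
  have e : y = ⟨_, iterate_faceWalk_mem_outer y'.2 (0 + i)⟩ :=
    Subtype.ext (by rw [zero_add]; exact hi.symm)
  rw [e]
  have := sameCycle_iterate (infRot emb) i
    (.inr (⟨_, iterate_faceWalk_mem_outer y'.2 (0 + i)⟩, true))
  rwa [h] at this

/-- Walking around infinity from the corner `b`, the first corner met is between the corner `a` and
the corner `b` on the boundary walk. -/
theorem exists_index_of_next [Finite E] (hx₀ : x₀ ∈ emb.outer) {a b : ℕ} (hab : a < b)
    {y : {y // y ∈ emb.outer}} (hy : (faceWalk emb.rot)^[b] x₀ = y.1)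
    (ha : ∀ t, StarKept left right emb x₀ k
      (.inr (⟨_, iterate_faceWalk_mem_outer hx₀ a⟩, t)))
    {z : (E × Bool) ⊕ {y // y ∈ emb.outer} × Bool}
    (hn : Next (infRot emb) (StarKept left right emb x₀ k) (.inr (y, true)) z) :
    ∃ c, a ≤ c ∧ c < b ∧ z = .inr (⟨_, iterate_faceWalk_mem_outer hx₀ c⟩, true) := by
  obtain ⟨m, hm, hmi, -⟩ := next_iff.1 hn
  have e : ∀ d ≤ b, (infRot emb)^[d] (.inr (y, true)) =
      .inr (⟨_, iterate_faceWalk_mem_outer hx₀ (b - d)⟩, true) := by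
    intro d hd
    have := infRot_iterate_inr_true hx₀ (b - d) d
    rw [← this]
    congr 3
    apply Subtype.ext
    rw [← hy, Nat.sub_add_cancel hd]
  have hle : m + 1 ≤ b - a := by
    by_contra hlt
    apply hmi (b - a - 1) (by omega)
    rw [show b - a - 1 + 1 = b - a by omega, e _ (by omega)]
    have : b - (b - a) = a := by omega
    simp only [this]
    exact ha true
  refine ⟨b - (m + 1), by omega, by omega, ?_⟩
  rw [← hm, e _ (by omega)]

end Star

end DirectedMultigraph

/-! ### Segregation forces unique direction changes -/

namespace DirectedMultigraph

open DartPair Equiv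

variable {V E : Type*} {G : DirectedMultigraph V E} {n : ℕ} {left right : Fin n → V}
  {emb : G.PlanarEmbedding} {x₀ : E × Bool} {k : ℕ}

theorem minimalPeriod_dvd_sub {D : Type*} (π : Perm D) {x : D} {a b : ℕ} (hab : a ≤ b)
    (h : π^[a] x = π^[b] x) : minimalPeriod π x ∣ b - a := by
  apply IsPeriodicPt.minimalPeriod_dvd
  apply π.injective.iterate a
  rw [← iterate_add_apply, Nat.add_sub_cancel' hab, h]

theorem starOut_leftCorner {y : {y // y ∈ emb.outer}} (b : Bool)
    (h : LeftCorner left right emb x₀ k y.1) : starOut left emb (.inr (y, b)) = !b := by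
  simp only [starOut, if_pos h.2.1]

theorem starOut_rightCorner {y : {y // y ∈ emb.outer}} (b : Bool)
    (h : RightCorner left right emb x₀ k y.1) : starOut left emb (.inr (y, b)) = b := by
  simp only [starOut, if_neg h.not_mem_left]

/-- Between two left corners of the first arc there is no right corner, so the direction at infinity
can change only after the left corner of least index. -/
theorem false_of_leftCorner_lt [Finite E] (hx₀ : x₀ ∈ emb.outer) {i i' : ℕ} (hi : i < i')
    (hi' : i' ≤ k) (hl : LeftCorner left right emb x₀ k ((faceWalk emb.rot)^[i] x₀))
    {y : {y // y ∈ emb.outer}} (hy : (faceWalk emb.rot)^[i'] x₀ = y.1)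
    {z : (E × Bool) ⊕ {y // y ∈ emb.outer} × Bool}
    (hn : Next (infRot emb) (StarKept left right emb x₀ k) (.inr (y, true)) z)
    (hz : starOut left emb z = true) : False := by
  obtain ⟨c, hc1, hc2, rfl⟩ := exists_index_of_next hx₀ hi hy (fun _ => Or.inl hl) hn
  rcases hn.mem with h | h
  · rw [starOut_leftCorner _ h] at hz
    simp at hz
  · obtain ⟨⟨j, hj1, hj2, hj⟩, -⟩ := id h
    -- The arcs can share a corner across the end of the walk, at the indices `0` and `emb.sides
    -- x₀`. There the corner would be both left and right, which is impossible once it has kept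
    -- edges.
    have hdvd := minimalPeriod_dvd_sub (faceWalk emb.rot) (by omega) hj.symm
    have hle := Nat.le_of_dvd (by omega) hdvd
    change j ≤ minimalPeriod (faceWalk emb.rot) x₀ at hj2
    have h1 : i = 0 := by omega
    have h2 : c = 0 := by omega
    subst h1 h2
    exact hl.not_rightCorner h

theorem false_of_rightCorner_lt [Finite E] (hx₀ : x₀ ∈ emb.outer) {j j' : ℕ} (hj : j < j')
    (hj' : j' ≤ emb.sides x₀) (hk : k ≤ j)
    (hr : RightCorner left right emb x₀ k ((faceWalk emb.rot)^[j] x₀))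
    {y : {y // y ∈ emb.outer}} (hy : (faceWalk emb.rot)^[j'] x₀ = y.1)
    {z : (E × Bool) ⊕ {y // y ∈ emb.outer} × Bool}
    (hn : Next (infRot emb) (StarKept left right emb x₀ k) (.inr (y, true)) z)
    (hz : starOut left emb z = false) : False := by
  obtain ⟨c, hc1, hc2, rfl⟩ := exists_index_of_next hx₀ hj hy (fun _ => Or.inr hr) hn
  rcases hn.mem with h | h
  · obtain ⟨⟨i, hi1, hi⟩, -⟩ := id h
    have hdvd := minimalPeriod_dvd_sub (faceWalk emb.rot) (by omega) hi
    change j' ≤ minimalPeriod (faceWalk emb.rot) x₀ at hj'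
    have h1 : c - i = 0 := Nat.eq_zero_of_dvd_of_lt hdvd (by omega)
    have h2 : c = j := by omega
    subst h2
    exact h.not_rightCorner hr
  · rw [starOut_rightCorner _ h] at hz
    simp at hz

/-- Around infinity there is at most one change of each kind between left and right corners. -/
theorem eq_of_switch_at_infinity [Finite E] (hx₀ : x₀ ∈ emb.outer)
    {y y' : {y // y ∈ emb.outer}} {z z' : (E × Bool) ⊕ {y // y ∈ emb.outer} × Bool}
    (hy : StarKept left right emb x₀ k (.inr (y, true)))
    (hy' : StarKept left right emb x₀ k (.inr (y', true)))
    (hn : Next (infRot emb) (StarKept left right emb x₀ k) (.inr (y, true)) z)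
    (hn' : Next (infRot emb) (StarKept left right emb x₀ k) (.inr (y', true)) z')
    (hyy' : starOut left emb (.inr (y, true)) = starOut left emb (.inr (y', true)))
    (hz : starOut left emb z ≠ starOut left emb (.inr (y, true)))
    (hz' : starOut left emb z' ≠ starOut left emb (.inr (y', true))) : y = y' := by
  rcases hy with hy | hy <;> rcases hy' with hy' | hy'
  · rw [starOut_leftCorner _ hy] at hz
    rw [starOut_leftCorner _ hy'] at hz'
    obtain ⟨⟨i, hi, hiy⟩, -⟩ := id hy
    obtain ⟨⟨i', hi', hiy'⟩, -⟩ := id hy'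
    rcases lt_trichotomy i i' with h | h | h
    · exact (false_of_leftCorner_lt hx₀ h hi' (hiy ▸ hy) hiy' hn' (by simpa using hz')).elim
    · subst h
      exact Subtype.ext (hiy.symm.trans hiy')
    · exact (false_of_leftCorner_lt hx₀ h hi (hiy' ▸ hy') hiy hn (by simpa using hz)).elim
  · rw [starOut_leftCorner _ hy, starOut_rightCorner _ hy'] at hyy'
    simp at hyy'
  · rw [starOut_leftCorner _ hy', starOut_rightCorner _ hy] at hyy'
    simp at hyy'
  · rw [starOut_rightCorner _ hy] at hz
    rw [starOut_rightCorner _ hy'] at hz'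
    obtain ⟨⟨i, hik, hi, hiy⟩, -⟩ := id hy
    obtain ⟨⟨i', hik', hi', hiy'⟩, -⟩ := id hy'
    rcases lt_trichotomy i i' with h | h | h
    · exact (false_of_rightCorner_lt hx₀ h hi' hik (hiy ▸ hy) hiy' hn' (by simpa using hz')).elim
    · subst h
      exact Subtype.ext (hiy.symm.trans hiy')
    · exact (false_of_rightCorner_lt hx₀ h hi hik' (hiy' ▸ hy') hiy hn (by simpa using hz)).elim

/-- Kept spokes end only at endpoints, so at any other vertex joining to infinity does not alter the
return map. -/
theorem next_infRot_of_transit [Finite E] {x y : E × Bool}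
    (h : Next emb.rot (G.KeptDart left right) x y)
    (hl : G.origin x ∉ Set.range left) (hr : G.origin x ∉ Set.range right) :
    Next (infRot emb) (StarKept left right emb x₀ k) (.inl x) (.inl y) := by
  have notKept : ∀ x (hx : emb.rot x ∈ emb.outer), G.origin x ∉ Set.range left →
      G.origin x ∉ Set.range right →
      ¬ StarKept left right emb x₀ k (.inr (⟨emb.rot x, hx⟩, false)) := by
    intro x hx hl hr h
    have ho := origin_rot emb.sameCycle_rot_iff x
    rcases h with h | h
    · exact hl (ho ▸ h.2.1)
    · exact hr (ho ▸ h.2.1)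
  have skip : ∀ x (hx : emb.rot x ∈ emb.outer) z, G.origin x ∉ Set.range left →
      G.origin x ∉ Set.range right →
      Next (infRot emb) (StarKept left right emb x₀ k) (.inr (⟨emb.rot x, hx⟩, false)) z →
      Next (infRot emb) (StarKept left right emb x₀ k) (.inl x) z := by
    intro x hx z hl hr h
    refine .skip _ _ ?_ ?_
    · rw [infRot_inl_of_mem hx]
      exact notKept x hx hl hr
    · rw [infRot_inl_of_mem hx]
      exact h
  induction h with
  | here x hx =>
    by_cases ho : emb.rot x ∈ emb.outer
    · refine skip x ho _ hl hr ?_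
      exact .here (σ := infRot emb) (.inr (⟨emb.rot x, ho⟩, false)) hx
    · have := Next.here (σ := infRot emb) (P := StarKept left right emb x₀ k) (.inl x)
      rw [infRot_inl_of_notMem ho] at this
      exact this hx
  | skip x y hx _ ih =>
    rw [origin_rot emb.sameCycle_rot_iff] at ih
    by_cases ho : emb.rot x ∈ emb.outer
    · refine skip x ho _ hl hr ?_
      exact .skip (σ := infRot emb) (.inr (⟨emb.rot x, ho⟩, false)) _ hx (ih hl hr)
    · refine .skip _ _ ?_ ?_
      · rw [infRot_inl_of_notMem ho]
        exact hx
      · rw [infRot_inl_of_notMem ho]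
        exact ih hl hr

/-- All corners swept between `x` and `y` belong to one merged face. If that face is not the outside
one, none of them carries a spoke. -/
theorem next_infRot_of_not_outer [Finite E] {x y : E × Bool}
    (h : Next emb.rot (G.KeptDart left right) x y)
    (hx : ¬ OuterAfterDeletion left right emb (reverse x)) :
    Next (infRot emb) (StarKept left right emb x₀ k) (.inl x) (.inl y) := by
  have notOuter : ∀ x, ¬ OuterAfterDeletion left right emb (reverse x) →
      infRot emb (.inl x) = .inl (emb.rot x) := by
    intro x hx
    apply infRot_inl_of_notMem
    intro ho
    apply hx
    rw [← outerAfterDeletion_faceWalk_iff, reverse_reverse]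
    exact .outer _ ho
  induction h with
  | here x h =>
    have := Next.here (σ := infRot emb) (P := StarKept left right emb x₀ k) (.inl x)
    rw [notOuter x hx] at this
    exact this h
  | skip x y h _ ih =>
    refine .skip _ _ ?_ ?_
    · rw [notOuter x hx]
      exact h
    · rw [notOuter x hx]
      apply ih
      rw [← outerAfterDeletion_reverse_iff emb h]
      rwa [← outerAfterDeletion_faceWalk_iff, reverse_reverse] at hx

section Switches

variable [Finite V] [Finite E]

/-- The consequences of segregation: around each transit vertex, the incoming edges are consecutive,
and each finite face has exactly one local source and one local sink. -/
theorem switches_of_segregated (hconn : G.Connected) (hacyc : G.Acyclic) (hx₀ : x₀ ∈ emb.outer)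
    (hL : ∀ a ∈ Set.range left, ∃ i ≤ k, G.origin ((faceWalk emb.rot)^[i] x₀) = a)
    (hR : ∀ b ∈ Set.range right, ∃ i, k ≤ i ∧ i ≤ emb.sides x₀ ∧
      G.origin ((faceWalk emb.rot)^[i] x₀) = b) :
    (∀ x y : {x // G.KeptDart left right x}, G.origin x.1 = G.origin y.1 →
      G.origin x.1 ∉ Set.range left → G.origin x.1 ∉ Set.range right → x.1.2 = y.1.2 →
      (keptRot left right emb x).1.2 ≠ x.1.2 → (keptRot left right emb y).1.2 ≠ y.1.2 → x = y) ∧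
    (∀ x y : {x // G.KeptDart left right x}, ¬ OuterAfterDeletion left right emb x.1 →
      (keptFace left right emb).SameCycle x y → x.1.2 = y.1.2 →
      (keptFace left right emb x).1.2 ≠ x.1.2 → (keptFace left right emb y).1.2 ≠ y.1.2 →
      x = y) := by
  by_cases hne : Nonempty {x // G.KeptDart left right x}
  swap
  · exact ⟨fun x => (hne ⟨x⟩).elim, fun x => (hne ⟨x⟩).elim⟩
  set P := StarKept left right emb x₀ k with hP
  let τ := firstReturn (infRot emb) P
  let A : Perm {z // P z} :=
    (starRev reverse (· ∈ emb.outer)).subtypePerm starKept_starRev_iff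
  let out : {z // P z} → Bool := fun z => starOut left emb z.1
  have hrev : ∀ z, starRev reverse (· ∈ emb.outer) (starRev reverse (· ∈ emb.outer) z) = z := by
    rintro (x | ⟨y, b⟩)
    · exact congrArg Sum.inl (reverse_reverse x)
    · simp [starRev]
  have hplanar : IsPlanar τ A :=
    (((euler_iff_isPlanar emb.sameCycle_rot_iff).1 emb.euler).star reverse_reverse
      emb.faceWalk_mem_outer).restrict hrev starKept_starRev_iff
  have hcyc : ∀ {z z' : {z // P z}}, (infRot emb).SameCycle z.1 z'.1 → τ.SameCycle z z' :=
    fun h => firstReturn_sameCycle_iff.2 h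
  have hleft : ∀ v ∈ Set.range left, (∃ e, ¬ G.Deleted left right e ∧ G.tail e = v) →
      ∃ y : {y // y ∈ emb.outer}, G.origin y.1 = v ∧ LeftCorner left right emb x₀ k y.1 := by
    intro v hv he
    obtain ⟨i, hi, rfl⟩ := hL v hv
    exact ⟨⟨_, iterate_faceWalk_mem_outer hx₀ i⟩, rfl, ⟨i, hi, rfl⟩, hv, he⟩
  have hright : ∀ v ∈ Set.range right, (∃ e, ¬ G.Deleted left right e ∧ G.head e = v) →
      ∃ y : {y // y ∈ emb.outer}, G.origin y.1 = v ∧ RightCorner left right emb x₀ k y.1 := by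
    intro v hv he
    obtain ⟨i, hi, hi', rfl⟩ := hR v hv
    exact ⟨⟨_, iterate_faceWalk_mem_outer hx₀ i⟩, rfl, ⟨i, hi, hi', rfl⟩, hv, he⟩
  -- Both directions occur at every vertex: transit vertices have them already, endpoints acquire
  -- the missing one from a spoke, and at infinity a route from a left to a right endpoint, followed
  -- forwards or backwards, yields a spoke of the other kind.
  have hσ : ∀ z : {z // P z}, ∃ z', τ.SameCycle z z' ∧ out z ≠ out z' := by
    rintro ⟨⟨e, b⟩ | ⟨y, b⟩, hz⟩
    · have he : ¬ G.Deleted left right e := hz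
      cases b with
      | false =>
        by_cases hl : G.tail e ∈ Set.range left
        · obtain ⟨y, hy, hy'⟩ := hleft _ hl ⟨e, he, rfl⟩
          refine ⟨⟨.inr (y, false), Or.inl hy'⟩, hcyc (infRot_sameCycle_inr_false hy.symm), ?_⟩
          simp only [out, starOut_leftCorner _ hy']
          simp [starOut]
        · obtain ⟨⟨e', he', hee'⟩, -⟩ := isTransit_tail he hl
          refine ⟨⟨.inl (e', true), he'⟩, hcyc (infRot_sameCycle_inl ?_), by simp [out, starOut]⟩
          simp [origin, hee']
      | true =>
        by_cases hr : G.head e ∈ Set.range right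
        · obtain ⟨y, hy, hy'⟩ := hright _ hr ⟨e, he, rfl⟩
          refine ⟨⟨.inr (y, false), Or.inr hy'⟩, hcyc (infRot_sameCycle_inr_false hy.symm), ?_⟩
          simp only [out, starOut_rightCorner _ hy']
          simp [starOut]
        · obtain ⟨-, ⟨e', he', hee'⟩⟩ := isTransit_head he hr
          refine ⟨⟨.inl (e', false), he'⟩, hcyc (infRot_sameCycle_inl ?_), by simp [out, starOut]⟩
          simp [origin, hee']
    · cases b with
      | false =>
        rcases id hz with h | h
        · obtain ⟨-, -, e, he, hey⟩ := id h
          refine ⟨⟨.inl (e, false), he⟩, hcyc (infRot_sameCycle_inr_false ?_).symm, ?_⟩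
          · simp [origin, hey]
          · simp only [out, starOut_leftCorner _ h]
            simp [starOut]
        · obtain ⟨-, -, e, he, hey⟩ := id h
          refine ⟨⟨.inl (e, true), he⟩, hcyc (infRot_sameCycle_inr_false ?_).symm, ?_⟩
          · simp [origin, hey]
          · simp only [out, starOut_rightCorner _ h]
            simp [starOut]
      | true =>
        rcases id hz with h | h
        · obtain ⟨-, -, e, he, hey⟩ := id h
          obtain ⟨e₁, h1, h2, -⟩ := exists_keptStep_right hacyc he
          obtain ⟨y', -, hy'⟩ := hright _ h2 ⟨e₁, h1, rfl⟩
          refine ⟨⟨.inr (y', true), Or.inr hy'⟩, hcyc (infRot_sameCycle_inr_true hconn _ _), ?_⟩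
          simp only [out, starOut_leftCorner _ h, starOut_rightCorner _ hy']
          simp
        · obtain ⟨-, -, e, he, hey⟩ := id h
          obtain ⟨e₁, h1, h2, -⟩ := exists_keptStep_left hacyc he
          obtain ⟨y', -, hy'⟩ := hleft _ h2 ⟨e₁, h1, rfl⟩
          refine ⟨⟨.inr (y', true), Or.inl hy'⟩, hcyc (infRot_sameCycle_inr_true hconn _ _), ?_⟩
          simp only [out, starOut_leftCorner _ hy', starOut_rightCorner _ h]
          simp
  have horg : ∀ z, starOrigin (τ z).1 = starOrigin z.1 := by
    intro z
    obtain ⟨i, hi⟩ := exists_iterate_of_sameCycle (next_firstReturn (σ := infRot emb) z).sameCycle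
    change starOrigin (firstReturn (infRot emb) P z).1 = _
    rw [← hi]
    clear hi
    induction i with
    | zero => rfl
    | succ i ih => rw [iterate_succ_apply', starOrigin_infRot, ih]
  -- A directed face avoiding infinity would be a directed closed walk in the acyclic graph. Leaving
  -- infinity requires arriving there first, so only arriving darts need be found.
  have hinf : ∀ x, (∀ z, Perm.SameCycle (A.trans τ) x z → out z = out x) →
      ∃ y : {y // y ∈ emb.outer}, ∃ hy, Perm.SameCycle (A.trans τ) x ⟨.inr (y, false), hy⟩ := by
    intro x hx
    by_contra hcon
    push Not at hcon
    have hinl : ∀ z, Perm.SameCycle (A.trans τ) x z → ∃ u hu, z = ⟨.inl u, hu⟩ := by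
      rintro ⟨u | ⟨y, _ | _⟩, hz⟩ hxz
      · exact ⟨u, hz, rfl⟩
      · exact (hcon y hz hxz).elim
      · exfalso
        obtain ⟨⟨w, hw⟩, hwz⟩ := (A.trans τ).surjective ⟨.inr (y, true), hz⟩
        have h1 := horg (A ⟨w, hw⟩)
        change starOrigin ((A.trans τ) ⟨w, hw⟩).1 = starOrigin (starRev reverse (· ∈ emb.outer) w)
          at h1
        rw [hwz] at h1
        rcases w with u | ⟨y', _ | _⟩
        · simp [starOrigin, starRev] at h1
        · refine hcon y' hw ?_
          rw [← Perm.sameCycle_apply_right, hwz]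
          exact hxz
        · simp [starOrigin, starRev] at h1
    have horg' : ∀ u hu u' hu', (A.trans τ) ⟨.inl u, hu⟩ = ⟨.inl u', hu'⟩ →
        G.origin u' = G.origin (reverse u) := by
      intro u hu u' hu' h
      have h1 := horg (A ⟨.inl u, hu⟩)
      change starOrigin ((A.trans τ) ⟨.inl u, hu⟩).1 = _ at h1
      rw [h] at h1
      exact Option.some.inj h1
    let org : {z // P z} → V := fun z => z.1.elim G.origin fun w => G.origin w.1.1
    cases hb : out x with
    | false =>
      refine hacyc.not_forall_step (π := A.trans τ) (org := org) (x := x) fun z hz => ?_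
      obtain ⟨u, hu, hzu⟩ := hinl z hz
      obtain ⟨u', hu', hzu'⟩ := hinl _ (Perm.sameCycle_apply_right.2 hz)
      have h1 : u.2 = false := by rw [← hb, ← hx z hz, hzu]; rfl
      rw [hzu']
      have h2 := horg' u hu u' hu' (by rw [← hzu, hzu'])
      rw [hzu]
      refine ⟨u.1, ?_, ?_⟩
      · simp [org, origin, h1]
      · change _ = G.origin u'
        rw [h2]
        simp [origin, reverse, h1]
    | true =>
      refine hacyc.not_forall_step_symm (π := A.trans τ) (org := org) (x := x) fun z hz => ?_
      obtain ⟨u, hu, hzu⟩ := hinl z hz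
      obtain ⟨u', hu', hzu'⟩ := hinl _ (Perm.sameCycle_apply_right.2 hz)
      have h1 : u.2 = true := by rw [← hb, ← hx z hz, hzu]; rfl
      rw [hzu']
      have h2 := horg' u hu u' hu' (by rw [← hzu, hzu'])
      rw [hzu]
      refine ⟨u.1, ?_, ?_⟩
      · change _ = G.origin u'
        rw [h2]
        simp [origin, reverse, h1]
      · simp [org, origin, h1]
  have hout : ∀ z, out (A z) = !out z := fun z => starOut_starRev z.1
  have : Nonempty {z // P z} := hne.map fun x => ⟨.inl x.1, x.2⟩
  obtain ⟨U1, U2⟩ := uniqueSwitches_of_isPlanar (fun z => Subtype.ext (hrev z.1)) hplanar out hout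
    hσ (by
      intro x y hx hy hxy
      obtain ⟨u, hu, hxu⟩ := hinf x hx
      obtain ⟨v, hv, hyv⟩ := hinf y hy
      -- Where a directed face passes infinity, the rotation there switches from `!out x` to `out
      -- x`. That switch is unique, so two directed faces of the same sense coincide.
      have key : ∀ (x : {z // P z}) (u : {y // y ∈ emb.outer}) hu,
          (∀ z, Perm.SameCycle (A.trans τ) x z → out z = out x) →
          Perm.SameCycle (A.trans τ) x ⟨.inr (u, false), hu⟩ →
          starOut left emb (.inr (u, true)) = !out x ∧
          starOut left emb (τ ⟨.inr (u, true), hu⟩).1 = out x := by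
        intro x u hu hx hxu
        have h1 := hout ⟨.inr (u, false), hu⟩
        rw [hx _ hxu] at h1
        exact ⟨h1, hx _ (Perm.sameCycle_apply_right.2 hxu)⟩
      obtain ⟨k1, k2⟩ := key x u hu hx hxu
      obtain ⟨k3, k4⟩ := key y v hv hy hyv
      have huv : u = v := eq_of_switch_at_infinity hx₀ hu hv
        (next_firstReturn (P := P) ⟨.inr (u, true), hu⟩)
        (next_firstReturn (P := P) ⟨.inr (v, true), hv⟩) (by rw [k1, k3, hxy])
        (by rw [k1]; change starOut left emb (τ ⟨.inr (u, true), hu⟩).1 ≠ _; rw [k2]; simp)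
        (by rw [k3]; change starOut left emb (τ ⟨.inr (v, true), hv⟩).1 ≠ _; rw [k4]; simp)
      subst huv
      exact hxu.trans hyv.symm)
  -- At transit vertices and inside finite faces no kept spoke intervenes, so the uniqueness
  -- transfers from the joined graph to `keptRot` and `keptFace`.
  constructor
  · intro x y hxy hl hr ho hx hy
    have hτ : ∀ x : {x // G.KeptDart left right x}, G.origin x.1 ∉ Set.range left →
        G.origin x.1 ∉ Set.range right →
        τ ⟨.inl x.1, x.2⟩ = ⟨.inl (keptRot left right emb x).1, (keptRot left right emb x).2⟩ :=
      fun x hl hr => firstReturn_eq_iff.2 (next_infRot_of_transit (next_firstReturn x) hl hr)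
    have := U1 ⟨.inl x.1, x.2⟩ ⟨.inl y.1, y.2⟩ (hcyc (infRot_sameCycle_inl hxy)) ho
      (by rw [hτ x hl hr]; exact hx) (by rw [hτ y (hxy ▸ hl) (hxy ▸ hr)]; exact hy)
    exact Subtype.ext (Sum.inl.inj (Subtype.mk.inj this))
  · intro x y hxo hxy ho hx hy
    have hτ : ∀ x : {x // G.KeptDart left right x}, ¬ OuterAfterDeletion left right emb x.1 →
        (A.trans τ) ⟨.inl x.1, x.2⟩ =
          ⟨.inl (keptFace left right emb x).1, (keptFace left right emb x).2⟩ :=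
      fun x hx => firstReturn_eq_iff.2 (next_infRot_of_not_outer
        (next_firstReturn (reverse.subtypePerm keptDart_reverse_iff x))
        (by simpa [reverse_reverse] using hx))
    have hcy : Perm.SameCycle (A.trans τ) ⟨.inl x.1, x.2⟩ ⟨.inl y.1, y.2⟩ ∧
        ¬ OuterAfterDeletion left right emb y.1 := by
      obtain ⟨i, rfl⟩ := exists_iterate_of_sameCycle hxy
      clear hxy ho hy
      induction i with
      | zero => exact ⟨Perm.SameCycle.refl _ _, hxo⟩
      | succ i ih =>
        rw [iterate_succ_apply']
        refine ⟨?_, fun h => ih.2 ((outerAfterDeletion_keptFace_iff emb _).1 h)⟩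
        rw [← hτ _ ih.2]
        exact Perm.sameCycle_apply_right.2 ih.1
    have := U2 ⟨.inl x.1, x.2⟩ ⟨.inl y.1, y.2⟩ hcy.1 ho
      (by rw [hτ x hxo]; exact hx) (by rw [hτ y hcy.2]; exact hy)
    exact Subtype.ext (Sum.inl.inj (Subtype.mk.inj this))

end Switches

end DirectedMultigraph

/-! ### The rotation system of the resolution -/

namespace DirectedMultigraph

open DartPair Equiv

section Resolution

variable {V E : Type*} {G : DirectedMultigraph V E} {n : ℕ} {left right : Fin n → V}

instance [Finite V] : Finite (G.Black left right) :=
  inferInstanceAs (Finite {v // v ∈ Set.range left ∨ G.IsTransit left right v})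

instance [Finite V] : Finite (G.White left right) :=
  inferInstanceAs (Finite {v // v ∈ Set.range right ∨ G.IsTransit left right v})

instance [Finite V] [Finite E] : Finite (G.ResolutionEdge left right) :=
  inferInstanceAs (Finite ({e // ¬ G.Deleted left right e} ⊕
    {v // (v ∈ Set.range left ∨ G.IsTransit left right v) ∧
      (v ∈ Set.range right ∨ G.IsTransit left right v)}))

variable (G left right) in
/-- The vertices of the graph with a black and a white copy in the resolution. -/
abbrev SplitVertex : Type _ := {v // (v ∈ Set.range left ∨ G.IsTransit left right v) ∧
      (v ∈ Set.range right ∨ G.IsTransit left right v)}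

/-- The darts of the resolution on edges of the graph. -/
def oldDart (x : {x // G.KeptDart left right x}) : G.ResolutionEdge left right × Bool :=
  (.inl ⟨x.1.1, x.2⟩, x.1.2)

/-- The darts of the resolution on new edges. -/
def newDart (v : G.SplitVertex left right) (c : Bool) : G.ResolutionEdge left right × Bool :=
  (.inr v, c)

@[elab_as_elim]
theorem resolutionDart_cases {motive : G.ResolutionEdge left right × Bool → Prop}
    (old : ∀ x, motive (oldDart x)) (new : ∀ v c, motive (newDart v c)) (z) : motive z := by
  rcases z with ⟨e | v, c⟩
  · exact old ⟨(e.1, c), e.2⟩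
  · exact new v c

/-- The vertex of the graph from which the origin of a dart of the resolution comes. -/
def baseVertex : G.ResolutionEdge left right × Bool → V
  | (.inl e, a) => G.origin (e.1, a)
  | (.inr v, _) => v.1

theorem resolution_origin_eq_iff (z z' : G.ResolutionEdge left right × Bool) :
    (G.resolution left right).origin z = (G.resolution left right).origin z' ↔
      baseVertex z = baseVertex z' ∧ z.2 = z'.2 := by
  rcases z with ⟨e | v, _ | _⟩ <;> rcases z' with ⟨e' | v', _ | _⟩ <;>
    simp only [origin, resolution, baseVertex, and_true, and_false, reduceCtorEq, if_true, if_false,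
      Bool.false_eq_true] <;>
    first
    | exact ⟨fun h => Subtype.mk.inj (Sum.inl.inj h), fun h => congrArg Sum.inl (Subtype.ext h)⟩
    | exact ⟨fun h => Subtype.mk.inj (Sum.inr.inj h), fun h => congrArg Sum.inr (Subtype.ext h)⟩

theorem isTransit_of_kept {x y : {x // G.KeptDart left right x}}
    (h : G.origin x.1 = G.origin y.1) (hxy : x.1.2 ≠ y.1.2) :
    G.IsTransit left right (G.origin x.1) := by
  obtain ⟨⟨e, b⟩, he⟩ := x
  obtain ⟨⟨e', b'⟩, he'⟩ := y
  cases b <;> cases b'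
  · exact absurd rfl hxy
  · exact ⟨⟨e', he', h.symm⟩, ⟨e, he, rfl⟩⟩
  · exact ⟨⟨e, he, rfl⟩, ⟨e', he', h.symm⟩⟩
  · exact absurd rfl hxy

/-- A vertex that is both a left and a right endpoint has lost all its edges, so a kept dart leaves
only the transit case. -/
theorem SplitVertex.isTransit_of_kept (v : G.SplitVertex left right)
    {x : {x // G.KeptDart left right x}} (h : G.origin x.1 = v.1) :
    G.IsTransit left right v.1 := by
  obtain ⟨⟨e, b⟩, he⟩ := x
  cases b
  · refine v.2.2.resolve_left ?_
    rw [← h]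
    exact not_mem_right_of_kept_tail he
  · refine v.2.1.resolve_left ?_
    rw [← h]
    exact not_mem_left_of_kept_head he

theorem IsTransit.exists_kept {v : V} (h : G.IsTransit left right v) (b : Bool) :
    ∃ x : {x // G.KeptDart left right x}, G.origin x.1 = v ∧ x.1.2 = b := by
  obtain ⟨⟨e, he, hev⟩, e', he', hev'⟩ := h
  cases b
  · exact ⟨⟨(e', false), he'⟩, hev', rfl⟩
  · exact ⟨⟨(e, true), he⟩, hev, rfl⟩

variable [Finite E] (emb : G.PlanarEmbedding)

variable (left right) in
/-- Around each transit vertex, the incoming edges are consecutive. -/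
def UniqueTransitSwitches : Prop :=
  ∀ x y : {x // G.KeptDart left right x}, G.origin x.1 = G.origin y.1 →
    G.IsTransit left right (G.origin x.1) → x.1.2 = y.1.2 →
    (keptRot left right emb x).1.2 ≠ x.1.2 → (keptRot left right emb y).1.2 ≠ y.1.2 → x = y

theorem IsTransit.exists_switch {v : V} (h : G.IsTransit left right v) (c : Bool) :
    ∃ x : {x // G.KeptDart left right x}, G.origin x.1 = v ∧ x.1.2 = !c ∧
      (keptRot left right emb x).1.2 = c := by
  obtain ⟨x, hx, hxc⟩ := h.exists_kept (!c)
  obtain ⟨y, hy, hyc⟩ := h.exists_kept c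
  obtain ⟨z, h1, h2, h3⟩ := DartPair.exists_switch (π := keptRot left right emb)
    (fun x => x.1.2) ((keptRot_sameCycle_iff emb).2 (hx.trans hy.symm))
    (by simp [hxc, hyc])
  refine ⟨z, by rw [← hx, (keptRot_sameCycle_iff emb).1 h1], h2.trans hxc, ?_⟩
  rw [hxc] at h3
  simpa using h3

/-- A dart of a transit vertex at which the direction changes to `c`. -/
noncomputable def switchDart {v : V} (h : G.IsTransit left right v) (c : Bool) :
    {x // G.KeptDart left right x} := (h.exists_switch emb c).choose

theorem switchDart_spec {v : V} (h : G.IsTransit left right v) (c : Bool) :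
    G.origin (switchDart emb h c).1 = v ∧ (switchDart emb h c).1.2 = (!c) ∧
      (keptRot left right emb (switchDart emb h c)).1.2 = c :=
  (h.exists_switch emb c).choose_spec

open Classical in
/-- The next dart around the origin in the resolution. -/
noncomputable def resolutionNext :
    G.ResolutionEdge left right × Bool → G.ResolutionEdge left right × Bool
  | (.inl e, a) =>
    -- The new edge is inserted where the direction changes: the block of darts of direction `a`
    -- closes up through the new dart of the same direction, which stands in for the other block.
    if h : (keptRot left right emb ⟨(e.1, a), e.2⟩).1.2 = a then
      oldDart (keptRot left right emb ⟨(e.1, a), e.2⟩)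
    else
      have ht := isTransit_of_kept (origin_keptRot emb ⟨(e.1, a), e.2⟩).symm (Ne.symm h)
      newDart ⟨_, .inr ht, .inr ht⟩ a
  | (.inr v, c) =>
    if h : G.IsTransit left right v.1 then oldDart (keptRot left right emb (switchDart emb h c))
    else newDart v c

variable {emb}

theorem resolutionNext_oldDart_of_eq {x : {x // G.KeptDart left right x}}
    (h : (keptRot left right emb x).1.2 = x.1.2) :
    resolutionNext emb (oldDart x) = oldDart (keptRot left right emb x) := dif_pos h

theorem resolutionNext_newDart_of_isTransit {v : G.SplitVertex left right}
    (h : G.IsTransit left right v.1) (c : Bool) :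
    resolutionNext emb (newDart v c) = oldDart (keptRot left right emb (switchDart emb h c)) :=
  dif_pos h

theorem resolutionNext_newDart_of_not_isTransit {v : G.SplitVertex left right}
    (h : ¬ G.IsTransit left right v.1) (c : Bool) :
    resolutionNext emb (newDart v c) = newDart v c := dif_neg h

theorem UniqueTransitSwitches.switchDart_eq (hsw : UniqueTransitSwitches left right emb)
    {x : {x // G.KeptDart left right x}} (h : G.IsTransit left right (G.origin x.1)) {c : Bool}
    (hx : x.1.2 = !c) (hne : (keptRot left right emb x).1.2 ≠ x.1.2) :
    switchDart emb h c = x := by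
  obtain ⟨h1, h2, h3⟩ := switchDart_spec emb h c
  exact hsw _ _ h1 (h1.symm ▸ h) (h2.trans hx.symm) (by rw [h2, h3]; simp) hne

theorem UniqueTransitSwitches.resolutionNext_oldDart_of_ne
    (hsw : UniqueTransitSwitches left right emb) {x : {x // G.KeptDart left right x}}
    (h : (keptRot left right emb x).1.2 ≠ x.1.2) :
    ∃ v : G.SplitVertex left right, v.1 = G.origin x.1 ∧ G.IsTransit left right v.1 ∧
      resolutionNext emb (oldDart x) = newDart v x.1.2 ∧
      resolutionNext emb (newDart v (!x.1.2)) = oldDart (keptRot left right emb x) := by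
  have ht := isTransit_of_kept (origin_keptRot emb x).symm (Ne.symm h)
  refine ⟨⟨G.origin x.1, .inr ht, .inr ht⟩, rfl, ht, dif_neg h, ?_⟩
  rw [resolutionNext_newDart_of_isTransit ht, hsw.switchDart_eq ht (by simp) h]

theorem UniqueTransitSwitches.surjective_resolutionNext
    (hsw : UniqueTransitSwitches left right emb) : Surjective (resolutionNext (left := left)
      (right := right) emb) := by
  intro z
  induction z using resolutionDart_cases with
  | old y =>
    obtain ⟨x, rfl⟩ := (keptRot left right emb).surjective y
    by_cases h : (keptRot left right emb x).1.2 = x.1.2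
    · exact ⟨_, resolutionNext_oldDart_of_eq h⟩
    · obtain ⟨v, -, -, -, h⟩ := hsw.resolutionNext_oldDart_of_ne h
      exact ⟨_, h⟩
  | new v c =>
    by_cases h : G.IsTransit left right v.1
    · obtain ⟨h1, h2, h3⟩ := switchDart_spec emb h (!c)
      obtain ⟨w, hw, -, h4, -⟩ := hsw.resolutionNext_oldDart_of_ne
        (x := switchDart emb h (!c)) (by rw [h2, h3]; simp)
      have : w = v := Subtype.ext (hw.trans h1)
      refine ⟨_, h4.trans ?_⟩
      rw [this, h2, Bool.not_not]
    · exact ⟨_, resolutionNext_newDart_of_not_isTransit h c⟩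

variable [Finite V]

/-- The rotation of the resolution. -/
noncomputable def resolutionRot (hsw : UniqueTransitSwitches left right emb) :
    Perm (G.ResolutionEdge left right × Bool) :=
  Equiv.ofBijective (resolutionNext emb)
    (Finite.surjective_iff_bijective.1 hsw.surjective_resolutionNext)

variable (hsw : UniqueTransitSwitches left right emb)

theorem resolutionRot_apply (z : G.ResolutionEdge left right × Bool) :
    resolutionRot hsw z = resolutionNext emb z := rfl

theorem baseVertex_resolutionRot (z : G.ResolutionEdge left right × Bool) :
    baseVertex (resolutionRot hsw z) = baseVertex z ∧ (resolutionRot hsw z).2 = z.2 := by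
  rw [resolutionRot_apply]
  induction z using resolutionDart_cases with
  | old x =>
    by_cases h : (keptRot left right emb x).1.2 = x.1.2
    · rw [resolutionNext_oldDart_of_eq h]
      exact ⟨origin_keptRot emb x, h⟩
    · obtain ⟨v, hv, -, h, -⟩ := hsw.resolutionNext_oldDart_of_ne h
      rw [h]
      exact ⟨hv, rfl⟩
  | new v c =>
    by_cases h : G.IsTransit left right v.1
    · rw [resolutionNext_newDart_of_isTransit h]
      obtain ⟨h1, -, h3⟩ := switchDart_spec emb h c
      exact ⟨(origin_keptRot emb _).trans h1, h3⟩
    · rw [resolutionNext_newDart_of_not_isTransit h]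
      exact ⟨rfl, rfl⟩

/-- A function that is constant along the rotation takes the same values at the old darts and at
the new dart of a vertex. -/
theorem apply_oldDart_eq_apply_newDart {β : Type*} {f : G.ResolutionEdge left right × Bool → β}
    (hf : ∀ x, f (resolutionRot hsw (oldDart x)) = f (oldDart x))
    (v : G.SplitVertex left right) {x : {x // G.KeptDart left right x}}
    (hx : G.origin x.1 = v.1) : f (oldDart x) = f (newDart v x.1.2) := by
  obtain ⟨y, hy, hyb⟩ := (v.isTransit_of_kept hx).exists_kept (!x.1.2)
  obtain ⟨i, rfl⟩ := exists_iterate_of_sameCycle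
    ((keptRot_sameCycle_iff emb).2 (hx.trans hy.symm))
  clear hy
  induction i generalizing x with
  | zero => simp at hyb
  | succ i ih =>
    by_cases h : (keptRot left right emb x).1.2 = x.1.2
    · rw [← hf, resolutionRot_apply, resolutionNext_oldDart_of_eq h, ← h]
      refine ih ((origin_keptRot emb x).trans hx) ?_
      rw [h]
      exact hyb
    · obtain ⟨w, hw, -, h, -⟩ := hsw.resolutionNext_oldDart_of_ne h
      have : w = v := Subtype.ext (hw.trans hx)
      rw [← hf, resolutionRot_apply, h, this]

theorem sameCycle_oldDart_newDart (v : G.SplitVertex left right)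
    {x : {x // G.KeptDart left right x}} (hx : G.origin x.1 = v.1) :
    (resolutionRot hsw).SameCycle (oldDart x) (newDart v x.1.2) :=
  quot_mk_eq_iff.1 (apply_oldDart_eq_apply_newDart hsw
    (f := Quot.mk fun x y => resolutionRot hsw x = y) (fun _ =>
      (Quot.sound (r := fun x y => resolutionRot hsw x = y) rfl).symm) v hx)

theorem sameCycle_resolutionRot_iff (z z' : G.ResolutionEdge left right × Bool) :
    (resolutionRot hsw).SameCycle z z' ↔
      (G.resolution left right).origin z = (G.resolution left right).origin z' := by
  rw [resolution_origin_eq_iff]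
  constructor
  · intro h
    obtain ⟨i, rfl⟩ := exists_iterate_of_sameCycle h
    clear h
    induction i with
    | zero => exact ⟨rfl, rfl⟩
    | succ i ih =>
      rw [iterate_succ_apply']
      obtain ⟨h1, h2⟩ := baseVertex_resolutionRot hsw ((resolutionRot hsw)^[i] z)
      rw [h1, h2]
      exact ih
  · rintro ⟨h1, h2⟩
    induction z using resolutionDart_cases with
    | old x =>
      induction z' using resolutionDart_cases with
      | old y =>
        change G.origin x.1 = G.origin y.1 at h1
        change x.1.2 = y.1.2 at h2
        by_cases h : G.IsTransit left right (G.origin x.1)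
        · have hx := sameCycle_oldDart_newDart hsw (x := x) ⟨_, .inr h, .inr h⟩ rfl
          have hy := sameCycle_oldDart_newDart hsw (x := y) ⟨_, .inr h, .inr h⟩ h1.symm
          rw [← h2] at hy
          exact hx.trans hy.symm
        · have heq : ∀ w : {x // G.KeptDart left right x}, G.origin x.1 = G.origin w.1 →
              (keptRot left right emb w).1.2 = w.1.2 := by
            intro w hw
            by_contra hne
            exact h (hw ▸ isTransit_of_kept (origin_keptRot emb w).symm (Ne.symm hne))
          obtain ⟨i, rfl⟩ := exists_iterate_of_sameCycle ((keptRot_sameCycle_iff emb).2 h1)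
          clear h1 h2
          induction i with
          | zero => exact Perm.SameCycle.refl _ _
          | succ i ih =>
            rw [iterate_succ_apply',
              ← resolutionNext_oldDart_of_eq (heq _ ((keptRot_sameCycle_iff emb).1
                (sameCycle_iterate _ i x)))]
            exact Perm.sameCycle_apply_right.2 ih
      | new v c =>
        change x.1.2 = c at h2
        exact h2 ▸ sameCycle_oldDart_newDart hsw v h1
    | new v c =>
      induction z' using resolutionDart_cases with
      | old y =>
        change c = y.1.2 at h2
        exact h2 ▸ (sameCycle_oldDart_newDart hsw v h1.symm).symm
      | new v' c' =>
        have e1 : v = v' := Subtype.ext h1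
        have e2 : c = c' := h2
        rw [e1, e2]

/-! ### Faces of the resolution -/

variable (emb) in
open Classical in
/-- The extension to the resolution of a function on the faces after the deletion. -/
noncomputable def extendFace {β : Type*} (q : {x // G.KeptDart left right x} → β) (d : β) :
    G.ResolutionEdge left right × Bool → β
  | (.inl e, a) => q ⟨(e.1, a), e.2⟩
  | (.inr v, c) => if h : G.IsTransit left right v.1 then
      q (keptRot left right emb (switchDart emb h (!c))) else d

theorem faceWalk_resolutionRot_newDart_of_isTransit {v : G.SplitVertex left right}
    (h : G.IsTransit left right v.1) (c : Bool) :
    faceWalk (resolutionRot hsw) (newDart v c) =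
      oldDart (keptRot left right emb (switchDart emb h (!c))) :=
  resolutionNext_newDart_of_isTransit h (!c)

theorem faceWalk_resolutionRot_newDart_of_not_isTransit {v : G.SplitVertex left right}
    (h : ¬ G.IsTransit left right v.1) (c : Bool) :
    faceWalk (resolutionRot hsw) (newDart v c) = newDart v (!c) :=
  resolutionNext_newDart_of_not_isTransit h (!c)

theorem faceWalk_resolutionRot_oldDart_of_ne {x : {x // G.KeptDart left right x}}
    (h : (keptFace left right emb x).1.2 ≠ x.1.2) :
    faceWalk (resolutionRot hsw) (oldDart x) = oldDart (keptFace left right emb x) := by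
  refine resolutionNext_oldDart_of_eq (x := reverse.subtypePerm keptDart_reverse_iff x) ?_
  change (keptFace left right emb x).1.2 = !x.1.2
  revert h
  cases (keptFace left right emb x).1.2 <;> cases x.1.2 <;> simp

/-- A face walk reverses a dart before rotating, so keeping its direction at a corner means a change
of direction around the vertex. The walk then crosses the split vertex along its new edge. -/
theorem faceWalk_resolutionRot_oldDart_of_eq {x : {x // G.KeptDart left right x}}
    (h : (keptFace left right emb x).1.2 = x.1.2) :
    ∃ v : G.SplitVertex left right, G.IsTransit left right v.1 ∧
      faceWalk (resolutionRot hsw) (oldDart x) = newDart v (!x.1.2) ∧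
      faceWalk (resolutionRot hsw) (newDart v (!x.1.2)) =
        oldDart (keptFace left right emb x) := by
  obtain ⟨v, -, hv, h1, h2⟩ := hsw.resolutionNext_oldDart_of_ne
    (x := reverse.subtypePerm keptDart_reverse_iff x) (by
      change (keptFace left right emb x).1.2 ≠ !x.1.2
      rw [h]
      simp)
  exact ⟨v, hv, h1, h2⟩

omit [Finite V] in
theorem extendFace_newDart_of_isTransit {β : Type*} (q : {x // G.KeptDart left right x} → β)
    (d : β) {v : G.SplitVertex left right} (h : G.IsTransit left right v.1) (c : Bool) :
    extendFace emb q d (newDart v c) =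
      q (keptRot left right emb (switchDart emb h (!c))) := dif_pos h

omit [Finite V] in
theorem extendFace_newDart_of_not_isTransit {β : Type*} (q : {x // G.KeptDart left right x} → β)
    (d : β) {v : G.SplitVertex left right} (h : ¬ G.IsTransit left right v.1) (c : Bool) :
    extendFace emb q d (newDart v c) = d := dif_neg h

theorem extendFace_faceWalk {β : Type*} {q : {x // G.KeptDart left right x} → β} {d : β}
    (hq : ∀ x, q (keptFace left right emb x) = q x) (z : G.ResolutionEdge left right × Bool) :
    extendFace emb q d (faceWalk (resolutionRot hsw) z) = extendFace emb q d z := by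
  have hnew : ∀ v c, extendFace emb q d (faceWalk (resolutionRot hsw) (newDart v c)) =
      extendFace emb q d (newDart v c) := by
    intro v c
    by_cases h : G.IsTransit left right v.1
    · rw [faceWalk_resolutionRot_newDart_of_isTransit hsw h]
      exact (extendFace_newDart_of_isTransit q d h c).symm
    · rw [faceWalk_resolutionRot_newDart_of_not_isTransit hsw h,
        extendFace_newDart_of_not_isTransit q d h, extendFace_newDart_of_not_isTransit q d h]
  induction z using resolutionDart_cases with
  | old x =>
    by_cases h : (keptFace left right emb x).1.2 = x.1.2
    · obtain ⟨v, -, h1, h2⟩ := faceWalk_resolutionRot_oldDart_of_eq hsw h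
      rw [h1, ← hnew, h2]
      exact hq x
    · rw [faceWalk_resolutionRot_oldDart_of_ne hsw h]
      exact hq x
  | new v c => exact hnew v c

end Resolution

end DirectedMultigraph

/-! ### Planarity and the outside face of the resolution -/

namespace DirectedMultigraph

open DartPair Equiv

section Embedding

variable {V E : Type*} [Finite V] [Finite E] {G : DirectedMultigraph V E} {n : ℕ}
  {left right : Fin n → V} {emb : G.PlanarEmbedding}
  (hsw : UniqueTransitSwitches left right emb)

-- For a connected graph the outside face has only one boundary walk, and every other face merged
-- with it is reached across deleted edges, where the potential does not jump.
omit [Finite V] in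
theorem exists_constant_on_outer (hconn : G.Connected) {p : E × Bool → ZMod 2}
    (hp : ∀ x, p (emb.rot (reverse x)) = p x)
    (hpn : ∀ x, ¬ G.KeptDart left right x → p x = p (reverse x)) :
    ∃ d, ∀ x, OuterAfterDeletion left right emb x → p x = d := by
  by_cases hE : ∃ x₀, x₀ ∈ emb.outer
  · obtain ⟨x₀, hx₀⟩ := hE
    refine ⟨p x₀, fun x hx => ?_⟩
    induction hx with
    | outer x hx =>
      obtain ⟨i, rfl⟩ := exists_iterate_of_sameCycle
        (emb.outer_unique x₀ hx₀ x hx (hconn.2 _ _))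
      clear hx
      induction i with
      | zero => rfl
      | succ i ih =>
        rw [iterate_succ_apply', ← ih]
        exact hp _
    | walk x _ ih => exact (hp x).trans ih
    | cross x hd _ ih => rw [← hpn x (not_not.2 hd), ih]
  · refine ⟨0, fun x _ => ?_⟩
    obtain ⟨y, hy, -⟩ := emb.exists_outer x
    exact (hE ⟨y, hy⟩).elim

/-- Each cycle in the resolution is the boundary of a union of faces, in such a way that all
outer boundary walks have the same potential. -/
theorem exists_resolution_potential (hconn : G.Connected)
    (h g : G.ResolutionEdge left right × Bool → ZMod 2) (hh : ∀ z, h (reverse z) = h z)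
    (hg : ∀ z, h z = g z + g (resolutionRot hsw z)) :
    ∃ p : G.ResolutionEdge left right × Bool → ZMod 2,
      (∀ z, p (faceWalk (resolutionRot hsw) z) = p z) ∧ (∀ z, h z = p z + p (reverse z)) ∧
      ∃ d, ∀ z, extendFace emb (fun x => OuterAfterDeletion left right emb x.1) True z →
        p z = d := by
  classical
  -- To contract the new edges, the witness `g` of the resolution must match across the two halves
  -- of each transit vertex. Shifting it by this constant on all incoming darts compensates for the
  -- passage through the new edge.
  let corr : E × Bool → ZMod 2 := fun x =>
    if ht : x.2 = true ∧ G.IsTransit left right (G.origin x) then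
      g (newDart ⟨_, .inr ht.2, .inr ht.2⟩ false) + g (newDart ⟨_, .inr ht.2, .inr ht.2⟩ true) +
        h (newDart ⟨_, .inr ht.2, .inr ht.2⟩ false)
    else 0
  have hcorr : ∀ x y : E × Bool, G.origin x = G.origin y → x.2 = y.2 → corr x = corr y := by
    intro x y h1 h2
    simp only [corr, h1, h2]
  let h₀ : E × Bool → ZMod 2 := fun x =>
    if hx : G.KeptDart left right x then h (oldDart ⟨x, hx⟩) else 0
  have hh₀ : ∀ x : {x // G.KeptDart left right x}, h₀ x.1 = h (oldDart x) := fun x => dif_pos x.2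
  obtain ⟨p, hp, hpn, hpp⟩ := ((euler_iff_isPlanar emb.sameCycle_rot_iff).1
    emb.euler).exists_potential reverse_reverse (P := G.KeptDart left right)
    (fun x hx => hx) h₀ (fun x hx => by
      have := hh (oldDart ⟨x, hx⟩)
      rw [hh₀ ⟨x, hx⟩, ← this]
      exact hh₀ (reverse.subtypePerm keptDart_reverse_iff ⟨x, hx⟩))
    (fun x => g (oldDart x) + corr x.1) (by
      intro x
      change h₀ x.1 = g (oldDart x) + corr x.1 +
        (g (oldDart (keptRot left right emb x)) + corr (keptRot left right emb x).1)
      rw [hh₀, hg]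
      by_cases hx : (keptRot left right emb x).1.2 = x.1.2
      · rw [resolutionRot_apply, resolutionNext_oldDart_of_eq hx,
          hcorr _ x.1 (origin_keptRot emb x) hx]
        have := add_self_zmod_two (corr x.1)
        linear_combination -this
      · obtain ⟨v, hv, hvt, h1, h2⟩ := hsw.resolutionNext_oldDart_of_ne hx
        have e1 := hg (newDart v (!x.1.2))
        have e2 : h (newDart v true) = h (newDart v false) := hh (newDart v false)
        rw [resolutionRot_apply, h1]
        rw [resolutionRot_apply, h2] at e1
        have ht : G.IsTransit left right (G.origin x.1) := hv ▸ hvt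
        have hv' : v = ⟨_, .inr ht, .inr ht⟩ := Subtype.ext hv
        subst hv'
        have two : ∀ a : ZMod 2, a + a = 0 := add_self_zmod_two
        cases hb : x.1.2 with
        | false =>
          have hy : (keptRot left right emb x).1.2 = true := by simpa [hb] using hx
          have c1 : corr x.1 = 0 := by simp [corr, hb]
          have c2 : corr (keptRot left right emb x).1 =
              g (newDart ⟨_, .inr ht, .inr ht⟩ false) + g (newDart ⟨_, .inr ht, .inr ht⟩ true) +
              h (newDart ⟨_, .inr ht, .inr ht⟩ false) := by
            simp [corr, hy, origin_keptRot, ht]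
          rw [hb] at e1
          simp only [Bool.not_false] at e1
          rw [c1, c2, ← e2, e1]
          linear_combination -two (g (oldDart (keptRot left right emb x))) -
            two (g (newDart ⟨_, .inr ht, .inr ht⟩ true))
        | true =>
          have hy : (keptRot left right emb x).1.2 = false := by simpa [hb] using hx
          have c2 : corr (keptRot left right emb x).1 = 0 := by simp [corr, hy]
          have c1 : corr x.1 =
              g (newDart ⟨_, .inr ht, .inr ht⟩ false) + g (newDart ⟨_, .inr ht, .inr ht⟩ true) +
              h (newDart ⟨_, .inr ht, .inr ht⟩ false) := by
            simp [corr, hb, ht]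
          rw [hb] at e1
          simp only [Bool.not_true] at e1
          rw [c1, c2, e1]
          linear_combination -two (g (oldDart (keptRot left right emb x))) -
            two (g (newDart ⟨_, .inr ht, .inr ht⟩ false)))
  obtain ⟨d, hd⟩ := exists_constant_on_outer hconn hp hpn
  have hpface : ∀ x : {x // G.KeptDart left right x},
      p (keptFace left right emb x).1 = p x.1 := by
    intro x
    have := (next_firstReturn (σ := emb.rot)
      (reverse.subtypePerm keptDart_reverse_iff x)).apply_eq hp reverse_reverse hpn
    refine this.trans ?_
    simp [reverse_reverse]
  -- The default `d` gives the single-edge components the outer potential, so that all outer walks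
  -- agree.
  set p' := extendFace (left := left) (right := right) emb (fun x => p x.1) d with hp'
  have hface : ∀ z, p' (faceWalk (resolutionRot hsw) z) = p' z :=
    extendFace_faceWalk hsw hpface
  have hprot : ∀ z, p' (resolutionRot hsw z) = p' (reverse z) := by
    intro z
    rw [← hface (reverse z)]
    change _ = p' (resolutionRot hsw (reverse (reverse z)))
    rw [reverse_reverse]
  have hold : ∀ x : {x // G.KeptDart left right x},
      h (oldDart x) = p' (oldDart x) + p' (reverse (oldDart x)) := by
    intro x
    rw [← hh₀]
    exact hpp x.1 x.2
  -- The identity on new edges is forced by that on old ones: since `g + p'` is unchanged by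
  -- rotation at every old dart of a split vertex, it is unchanged at the new dart as well.
  have hnewconst : ∀ x, g (resolutionRot hsw (oldDart x)) + p' (resolutionRot hsw (oldDart x)) =
      g (oldDart x) + p' (oldDart x) := by
    intro x
    have e1 := hg (oldDart x)
    rw [hold, ← hprot] at e1
    have e2 := add_self_zmod_two (g (resolutionRot hsw (oldDart x)))
    have e3 := add_self_zmod_two (p' (oldDart x))
    linear_combination e1 + e2 - e3
  refine ⟨p', hface, fun z => ?_, d, fun z hz => ?_⟩
  · induction z using resolutionDart_cases with
    | old x => exact hold x
    | new v c =>
      rw [hg, ← hprot]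
      suffices hs : g (resolutionRot hsw (newDart v c)) + p' (resolutionRot hsw (newDart v c)) =
          g (newDart v c) + p' (newDart v c) by
        have e2 := add_self_zmod_two (g (newDart v c))
        have e3 := add_self_zmod_two (p' (resolutionRot hsw (newDart v c)))
        linear_combination hs + e2 - e3
      by_cases hv : G.IsTransit left right v.1
      · obtain ⟨h1, -, h3⟩ := switchDart_spec emb hv c
        have := apply_oldDart_eq_apply_newDart hsw (f := fun z => g z + p' z) hnewconst v
          ((origin_keptRot emb _).trans h1)
        rw [h3] at this
        rw [resolutionRot_apply, resolutionNext_newDart_of_isTransit hv]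
        exact this
      · rw [resolutionRot_apply, resolutionNext_newDart_of_not_isTransit hv]
  · induction z using resolutionDart_cases with
    | old x => exact hd _ hz
    | new v c =>
      by_cases hv : G.IsTransit left right v.1
      · rw [extendFace_newDart_of_isTransit _ _ hv] at hz
        rw [hp', extendFace_newDart_of_isTransit _ _ hv]
        exact hd _ hz
      · rw [hp', extendFace_newDart_of_not_isTransit _ _ hv]

theorem isPlanar_resolutionRot (hconn : G.Connected) :
    IsPlanar (resolutionRot hsw) reverse := by
  rintro h hh ⟨g, hg⟩
  obtain ⟨p, hp, hp', -⟩ := exists_resolution_potential hsw hconn h g hh hg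
  exact ⟨p, hp, hp'⟩

omit [Finite V] [Finite E] in
theorem sameComponent_resolution_of_keptStep {e e' : E}
    (h : Relation.ReflTransGen (G.KeptStep left right) e e') (he : ¬ G.Deleted left right e)
    (he' : ¬ G.Deleted left right e') :
    (G.resolution left right).SameComponent (.inl ⟨G.tail e, tail_mem_black he⟩)
      (.inl ⟨G.tail e', tail_mem_black he'⟩) := by
  induction h with
  | refl => exact .refl _
  | @tail e₁ e₂ _ h ih =>
    have hw := head_mem_white h.1
    have hb := tail_mem_black h.2.1
    refine (ih h.1).trans _ _ _ ((Relation.EqvGen.rel _ (.inr ⟨G.head e₁, hw⟩)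
      ⟨.inl ⟨e₁, h.1⟩, rfl, rfl⟩).trans _ _ _ (.symm _ _ (.rel _ _
        ⟨.inr ⟨G.head e₁, by rw [h.2.2]; exact hb, hw⟩, ?_, rfl⟩)))
    exact congrArg Sum.inl (Subtype.ext h.2.2)

omit [Finite V] [Finite E] in
theorem sameComponent_resolution_oldDart (x : {x // G.KeptDart left right x}) :
    (G.resolution left right).SameComponent
      (.inl ⟨G.tail x.1.1, tail_mem_black x.2⟩) ((G.resolution left right).origin (oldDart x)) := by
  obtain ⟨⟨e, _ | _⟩, he⟩ := x
  · exact .refl _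
  · exact .rel _ _ ⟨.inl ⟨e, he⟩, rfl, rfl⟩

-- Start at an outside corner of the endpoint and rotate to the first kept dart: the skipped edges
-- are deleted, so the side stays in the merged outside face.
omit [Finite V] in
theorem exists_outerAfterDeletion_at_left
    (hout : ∀ e, G.tail e ∈ Set.range left → ∃ y ∈ emb.outer, G.origin y = G.tail e) {e : E}
    (he : ¬ G.Deleted left right e) (hl : G.tail e ∈ Set.range left) :
    ∃ y : {x // G.KeptDart left right x}, OuterAfterDeletion left right emb y.1 ∧
      G.origin y.1 = G.tail e ∧ y.1.2 = false := by
  obtain ⟨y, hy, hye⟩ := hout e hl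
  let u := emb.rot.symm y
  have hu : emb.rot u = y := by simp [u]
  have hue : G.origin u = G.tail e := by
    rw [← hye, ← hu, origin_rot emb.sameCycle_rot_iff]
  obtain ⟨z, hz⟩ := exists_next (P := G.KeptDart left right) (z := (e, false))
    ((emb.sameCycle_rot_iff u (e, false)).2 hue) he
  have hzo : G.origin z = G.tail e := by
    rw [← hue, (emb.sameCycle_rot_iff u z).1 hz.sameCycle]
  refine ⟨⟨z, hz.mem⟩, ?_, hzo, ?_⟩
  · rw [outerAfterDeletion_of_next emb hz, ← outerAfterDeletion_faceWalk_iff, reverse_reverse, hu]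
    exact .outer _ hy
  · obtain ⟨f, _ | _⟩ := z
    · rfl
    · exact absurd ((show G.head f = _ from hzo).symm ▸ hl) (not_mem_left_of_kept_head hz.mem)

theorem exists_outer_resolution (hacyc : G.Acyclic)
    (hout : ∀ e, G.tail e ∈ Set.range left → ∃ y ∈ emb.outer, G.origin y = G.tail e)
    (z : G.ResolutionEdge left right × Bool) :
    ∃ z', extendFace emb (fun x => OuterAfterDeletion left right emb x.1) True z' ∧
      (G.resolution left right).SameComponent ((G.resolution left right).origin z)
        ((G.resolution left right).origin z') := by
  have old : ∀ x : {x // G.KeptDart left right x}, ∃ z',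
      extendFace emb (fun x => OuterAfterDeletion left right emb x.1) True z' ∧
      (G.resolution left right).SameComponent ((G.resolution left right).origin (oldDart x))
        ((G.resolution left right).origin z') := by
    intro x
    obtain ⟨e₀, h0, h1, h2⟩ := exists_keptStep_left hacyc x.2
    obtain ⟨y, hy, hye, hyb⟩ := exists_outerAfterDeletion_at_left hout h0 h1
    refine ⟨oldDart y, hy, ?_⟩
    have e1 := sameComponent_resolution_of_keptStep h2 h0 x.2
    have e2 : (G.resolution left right).origin (oldDart y) =
        .inl ⟨G.tail e₀, tail_mem_black h0⟩ :=
      (resolution_origin_eq_iff (oldDart y) (oldDart ⟨(e₀, false), h0⟩)).2 ⟨hye, hyb⟩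
    rw [e2]
    exact ((e1.trans _ _ _ (sameComponent_resolution_oldDart x))).symm
  induction z using resolutionDart_cases with
  | old x => exact old x
  | new v c =>
    by_cases hv : G.IsTransit left right v.1
    · obtain ⟨x, hx, hxc⟩ := hv.exists_kept c
      rw [(resolution_origin_eq_iff (newDart v c) (oldDart x)).2 ⟨hx.symm, hxc.symm⟩]
      exact old x
    · refine ⟨newDart v c, ?_, .refl _⟩
      rw [extendFace_newDart_of_not_isTransit _ _ hv]
      trivial

theorem apply_eq_of_sameComponent {V E β : Type*} {G : DirectedMultigraph V E} [Inhabited β]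
    {f : E × Bool → β} (hf : ∀ x y, G.origin x = G.origin y → f x = f y)
    (hrev : ∀ x, f (reverse x) = f x) {x y : E × Bool}
    (h : G.SameComponent (G.origin x) (G.origin y)) : f x = f y := by
  classical
  let F : V → β := fun v => if hv : ∃ x, G.origin x = v then f hv.choose else default
  have hF : ∀ x, F (G.origin x) = f x := by
    intro x
    have hx : ∃ y, G.origin y = G.origin x := ⟨x, rfl⟩
    simp only [F, dif_pos hx]
    exact hf _ _ hx.choose_spec
  have key : ∀ u v, G.SameComponent u v → F u = F v := by
    intro u v h
    induction h with
    | rel u v h =>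
      obtain ⟨e, rfl, rfl⟩ := h
      exact (hF (e, false)).trans ((hrev (e, false)).symm.trans (hF (e, true)).symm)
    | refl => rfl
    | symm _ _ _ ih => exact ih.symm
    | trans _ _ _ _ _ ih1 ih2 => exact ih1.trans ih2
  rw [← hF, ← hF, key _ _ h]

/-- The boundary of the face of `x` also has a potential that is constant on outer walks. Two
potentials with equal boundary differ by a constant on each component, so the indicator of this face
agrees at `x` and `y`. -/
theorem outer_unique_resolution (hconn : G.Connected)
    {x y : G.ResolutionEdge left right × Bool}
    (hx : extendFace emb (fun x => OuterAfterDeletion left right emb x.1) True x)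
    (hy : extendFace emb (fun x => OuterAfterDeletion left right emb x.1) True y)
    (hxy : (G.resolution left right).SameComponent ((G.resolution left right).origin x)
      ((G.resolution left right).origin y)) :
    (faceWalk (resolutionRot hsw)).SameCycle x y := by
  classical
  let p₀ : G.ResolutionEdge left right × Bool → ZMod 2 := fun z =>
    if (faceWalk (resolutionRot hsw)).SameCycle x z then 1 else 0
  have hp₀ : ∀ z, p₀ (faceWalk (resolutionRot hsw) z) = p₀ z := fun z => by
    simp only [p₀, Perm.sameCycle_apply_right]
  have hrot : ∀ {p : G.ResolutionEdge left right × Bool → ZMod 2},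
      (∀ z, p (faceWalk (resolutionRot hsw) z) = p z) →
      ∀ z, p (resolutionRot hsw z) = p (reverse z) := by
    intro p hp z
    rw [← hp (reverse z)]
    change _ = p (resolutionRot hsw (reverse (reverse z)))
    rw [reverse_reverse]
  obtain ⟨p, hp, hpp, d, hd⟩ := exists_resolution_potential hsw hconn
    (fun z => p₀ z + p₀ (reverse z)) p₀ (fun z => by rw [reverse_reverse, add_comm])
    (fun z => by rw [hrot hp₀])
  have hδrev : ∀ z, p (reverse z) + p₀ (reverse z) = p z + p₀ z := by
    intro z
    have e1 := hpp z
    have e2 := add_self_zmod_two (p z)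
    have e3 := add_self_zmod_two (p₀ (reverse z))
    linear_combination -e1 - e2 + e3
  have key := apply_eq_of_sameComponent (f := fun z => p z + p₀ z) (by
      intro z z' h
      obtain ⟨i, rfl⟩ := exists_iterate_of_sameCycle ((sameCycle_resolutionRot_iff hsw z z').2 h)
      clear h
      induction i with
      | zero => rfl
      | succ i ih =>
        rw [iterate_succ_apply', hrot hp, hrot hp₀, hδrev]
        exact ih) hδrev hxy
  have h1 : p₀ x = p₀ y := by
    change p x + p₀ x = p y + p₀ y at key
    rw [hd x hx, hd y hy] at key
    exact add_left_cancel key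
  have h2 : p₀ x = 1 := if_pos (Perm.SameCycle.refl _ _)
  by_contra hcon
  rw [h2] at h1
  simp [p₀, hcon] at h1

/-- The embedding of the resolution. -/
noncomputable def resolutionEmbedding (hconn : G.Connected) (hacyc : G.Acyclic)
    (hout : ∀ e, G.tail e ∈ Set.range left → ∃ y ∈ emb.outer, G.origin y = G.tail e) :
    (G.resolution left right).PlanarEmbedding where
  rot := resolutionRot hsw
  sameCycle_rot_iff := sameCycle_resolutionRot_iff hsw
  euler := (euler_iff_isPlanar (sameCycle_resolutionRot_iff hsw)).2
    (isPlanar_resolutionRot hsw hconn)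
  -- The default `True` handles vertices that are both left and right endpoints: they become
  -- single-edge components, whose only face is outside.
  outer := {z | extendFace emb (fun x => OuterAfterDeletion left right emb x.1) True z}
  faceWalk_mem_outer z := by
    have := extendFace_faceWalk hsw (d := True)
      (q := fun x => OuterAfterDeletion left right emb x.1)
      (fun x => propext (outerAfterDeletion_keptFace_iff emb x)) z
    exact iff_of_eq this
  exists_outer := exists_outer_resolution hacyc hout
  outer_unique _ hx _ hy hxy := outer_unique_resolution hsw hconn hx hy hxy

theorem isInduced_resolutionEmbedding (hconn : G.Connected) (hacyc : G.Acyclic)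
    (hout : ∀ e, G.tail e ∈ Set.range left → ∃ y ∈ emb.outer, G.origin y = G.tail e) :
    emb.IsInduced (resolutionEmbedding hsw hconn hacyc hout) where
  rot_eq e f a b h := by
    have hef : keptRot left right emb ⟨(e.1, a), e.2⟩ = ⟨(f.1, b), f.2⟩ :=
      firstReturn_eq_iff.2 ((nextKept_iff emb).1 h)
    by_cases hab : b = a
    · left
      have := resolutionNext_oldDart_of_eq (x := ⟨(e.1, a), e.2⟩) (emb := emb) (by rw [hef, hab])
      rw [hef] at this
      exact this
    · right
      obtain ⟨v, -, -, h1, h2⟩ := hsw.resolutionNext_oldDart_of_ne (x := ⟨(e.1, a), e.2⟩)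
        (by rw [hef]; exact hab)
      rw [hef] at h2
      exact ⟨v, a, h1, h2⟩
  outer_iff e a := Iff.rfl

end Embedding

end DirectedMultigraph

/-! ### Face lengths and Kasteleyn flatness -/

namespace DirectedMultigraph

open DartPair Equiv

theorem card_filter_range_minimalPeriod {D : Type*} [Fintype D] [DecidableEq D] (π : Perm D)
    (z : D) (p : D → Prop) [DecidablePred p] [DecidablePred (π.SameCycle z)] :
    ((Finset.range (minimalPeriod π z)).filter fun i => p (π^[i] z)).card =
      (Finset.univ.filter fun y => π.SameCycle z y ∧ p y).card := by
  refine Finset.card_bij (fun i _ => π^[i] z) ?_ ?_ ?_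
  · intro i hi
    simp only [Finset.mem_filter, Finset.mem_univ, true_and] at hi ⊢
    exact ⟨sameCycle_iterate _ _ _, hi.2⟩
  · intro i hi j hj h
    simp only [Finset.mem_filter, Finset.mem_range] at hi hj
    exact iterate_injOn_Iio_minimalPeriod hi.1 hj.1 h
  · intro y hy
    simp only [Finset.mem_filter, Finset.mem_univ, true_and] at hy
    obtain ⟨i, rfl⟩ := exists_iterate_of_sameCycle hy.1
    have hpos : 0 < minimalPeriod π z :=
      minimalPeriod_pos_of_mem_periodicPts (π.injective.mem_periodicPts z)
    refine ⟨i % minimalPeriod π z, ?_, iterate_mod_minimalPeriod_eq⟩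
    simp only [Finset.mem_filter, Finset.mem_range]
    exact ⟨Nat.mod_lt _ hpos, by rw [iterate_mod_minimalPeriod_eq]; exact hy.2⟩

section Flat

variable {V E : Type*} {G : DirectedMultigraph V E} {n : ℕ}
  {left right : Fin n → V}

variable (left right) in
/-- Inside each finite face, there is only one local source and only one local sink. -/
def UniqueFaceSwitches [Finite E] (emb : G.PlanarEmbedding) : Prop :=
  ∀ x y : {x // G.KeptDart left right x}, ¬ OuterAfterDeletion left right emb x.1 →
    (keptFace left right emb).SameCycle x y → x.1.2 = y.1.2 →
    (keptFace left right emb x).1.2 ≠ x.1.2 → (keptFace left right emb y).1.2 ≠ y.1.2 → x = y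

open Classical in
/-- The signs of the edges of the resolution: the new edges at transit vertices are negative. -/
noncomputable def resolutionSign : G.ResolutionEdge left right → ℤˣ
  | .inl _ => 1
  | .inr v => if G.IsTransit left right v.1 then -1 else 1

variable [Finite V] [Finite E] {emb : G.PlanarEmbedding}
  (hsw : UniqueTransitSwitches left right emb)

theorem sameCycle_oldDart_of_sameCycle {x y : {x // G.KeptDart left right x}}
    (h : (keptFace left right emb).SameCycle x y) :
    (faceWalk (resolutionRot hsw)).SameCycle (oldDart x) (oldDart y) := by
  obtain ⟨i, rfl⟩ := exists_iterate_of_sameCycle h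
  clear h
  induction i with
  | zero => exact Perm.SameCycle.refl _ _
  | succ i ih =>
    rw [iterate_succ_apply']
    refine ih.trans ?_
    set w := (keptFace left right emb)^[i] x
    by_cases hw : (keptFace left right emb w).1.2 = w.1.2
    · obtain ⟨v, -, h1, h2⟩ := faceWalk_resolutionRot_oldDart_of_eq hsw hw
      rw [← h2, Perm.sameCycle_apply_right, ← h1, Perm.sameCycle_apply_right]
    · rw [← faceWalk_resolutionRot_oldDart_of_ne hsw hw, Perm.sameCycle_apply_right]

theorem extendFace_eq_of_sameCycle {β : Type*} {q : {x // G.KeptDart left right x} → β} {d : β}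
    (hq : ∀ x, q (keptFace left right emb x) = q x) {z z' : G.ResolutionEdge left right × Bool}
    (h : (faceWalk (resolutionRot hsw)).SameCycle z z') :
    extendFace emb q d z' = extendFace emb q d z := by
  obtain ⟨i, rfl⟩ := exists_iterate_of_sameCycle h
  clear h
  induction i with
  | zero => rfl
  | succ i ih => rw [iterate_succ_apply', extendFace_faceWalk hsw hq, ih]

theorem sameCycle_of_sameCycle_oldDart {x y : {x // G.KeptDart left right x}}
    (h : (faceWalk (resolutionRot hsw)).SameCycle (oldDart x) (oldDart y)) :
    (keptFace left right emb).SameCycle x y := by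
  have := extendFace_eq_of_sameCycle hsw (d := True)
    (q := fun w => (keptFace left right emb).SameCycle x w)
    (fun w => propext Perm.sameCycle_apply_right) h
  exact (iff_of_eq this).2 (Perm.SameCycle.refl _ _)

theorem kasteleynFlat_resolutionEmbedding (hconn : G.Connected) (hacyc : G.Acyclic)
    (hout : ∀ e, G.tail e ∈ Set.range left → ∃ y ∈ emb.outer, G.origin y = G.tail e)
    (hface : UniqueFaceSwitches left right emb) :
    (resolutionEmbedding hsw hconn hacyc hout).KasteleynFlat resolutionSign := by
  classical
  have : Fintype (G.ResolutionEdge left right × Bool) := Fintype.ofFinite _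
  intro z hz
  set π := faceWalk (resolutionRot hsw) with hπ
  have houtq : ∀ x, (fun x : {x // G.KeptDart left right x} =>
      OuterAfterDeletion left right emb x.1) (keptFace left right emb x) =
      OuterAfterDeletion left right emb x.1 :=
    fun x => propext (outerAfterDeletion_keptFace_iff emb x)
  have hcyc : ∀ y, π.SameCycle z y →
      ¬ extendFace emb (fun x => OuterAfterDeletion left right emb x.1) True y := by
    intro y hy
    rw [extendFace_eq_of_sameCycle hsw houtq hy]
    exact hz
  have hnew : ∀ v c, π.SameCycle z (newDart v c) → G.IsTransit left right v.1 := by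
    intro v c h
    by_contra hv
    apply hcyc _ h
    rw [extendFace_newDart_of_not_isTransit _ _ hv]
    trivial
  let isNew : G.ResolutionEdge left right × Bool → Prop := fun y => ∃ v c, y = newDart v c
  have hold : ∀ x, ¬ isNew (oldDart x) := by
    rintro x ⟨v, c, h⟩
    have := congrArg Prod.fst h
    exact Sum.inl_ne_inr this
  have hcases : ∀ y, ¬ isNew y → ∃ x, y = oldDart x := by
    intro y hy
    induction y using resolutionDart_cases with
    | old x => exact ⟨x, rfl⟩
    | new v c => exact absurd ⟨v, c, rfl⟩ hy
  have hπnew : ∀ y, π.SameCycle z y → isNew y → ¬ isNew (π y) := by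
    rintro _ hy ⟨v, c, rfl⟩
    rw [hπ, faceWalk_resolutionRot_newDart_of_isTransit hsw (hnew _ _ hy)]
    exact hold _
  have hs : (resolutionEmbedding hsw hconn hacyc hout).sides z =
      (Finset.univ.filter fun y => π.SameCycle z y).card := by
    have := card_filter_range_minimalPeriod π z (fun _ => True)
    simp only [Finset.filter_true, Finset.card_range, and_true] at this
    exact this
  have hneg : ((Finset.range ((resolutionEmbedding hsw hconn hacyc hout).sides z)).filter
      fun i => resolutionSign ((faceWalk (resolutionEmbedding hsw hconn hacyc hout).rot)^[i] z).1
        = -1).card = (Finset.univ.filter fun y => π.SameCycle z y ∧ isNew y).card := by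
    refine (card_filter_range_minimalPeriod π z (fun y => resolutionSign y.1 = -1)).trans ?_
    congr 1
    ext y
    simp only [Finset.mem_filter, Finset.mem_univ, true_and, and_congr_right_iff]
    intro hy
    induction y using resolutionDart_cases with
    | old x =>
      refine iff_of_false ?_ (hold x)
      simp [oldDart, resolutionSign]
    | new v c =>
      have := hnew v c hy
      simp only [isNew, newDart, resolutionSign, this, if_true, true_iff]
      exact ⟨v, c, rfl⟩
  have hsplit : (Finset.univ.filter fun y => π.SameCycle z y).card =
      (Finset.univ.filter fun y => π.SameCycle z y ∧ isNew y).card +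
      ((Finset.univ.filter fun y => π.SameCycle z y ∧ ¬ isNew y ∧ isNew (π y)).card +
       (Finset.univ.filter fun y => π.SameCycle z y ∧ ¬ isNew y ∧ ¬ isNew (π y)).card) := by
    rw [← Finset.card_filter_add_card_filter_not (p := isNew), Finset.filter_filter,
      Finset.filter_filter,
      ← Finset.card_filter_add_card_filter_not (p := fun y => isNew (π y))
        (s := Finset.univ.filter fun y => π.SameCycle z y ∧ ¬ isNew y), Finset.filter_filter,
      Finset.filter_filter]
    simp only [and_assoc]
  -- On a finite face two new sides are never consecutive, so each is preceded by exactly one old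
  -- side.
  have hbij : (Finset.univ.filter fun y => π.SameCycle z y ∧ ¬ isNew y ∧ isNew (π y)).card =
      (Finset.univ.filter fun y => π.SameCycle z y ∧ isNew y).card := by
    refine Finset.card_bij (fun y _ => π y) ?_ (fun _ _ _ _ h => π.injective h) ?_
    · intro y hy
      simp only [Finset.mem_filter, Finset.mem_univ, true_and] at hy ⊢
      exact ⟨Perm.sameCycle_apply_right.2 hy.1, hy.2.2⟩
    · intro y hy
      obtain ⟨y, rfl⟩ := π.surjective y
      simp only [Finset.mem_filter, Finset.mem_univ, true_and, Perm.sameCycle_apply_right] at hy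
      refine ⟨y, ?_, rfl⟩
      simp only [Finset.mem_filter, Finset.mem_univ, true_and]
      exact ⟨hy.1, fun h => hπnew y hy.1 h hy.2, hy.2⟩
  have hsw' : ∀ x, ¬ isNew (π (oldDart x)) ↔ (keptFace left right emb x).1.2 ≠ x.1.2 := by
    intro x
    by_cases h : (keptFace left right emb x).1.2 = x.1.2
    · obtain ⟨v, -, h1, -⟩ := faceWalk_resolutionRot_oldDart_of_eq hsw h
      simp only [h, hπ, h1, ne_eq, not_true_eq_false, iff_false, not_not]
      exact ⟨v, _, rfl⟩
    · simp only [ne_eq, h, not_false_eq_true, iff_true, hπ,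
        faceWalk_resolutionRot_oldDart_of_ne hsw h]
      exact hold _
  -- Old sides followed by old sides are the direction changes of the face: at least one of each
  -- kind by acyclicity, at most one by `hface`.
  have htwo : (Finset.univ.filter fun y => π.SameCycle z y ∧ ¬ isNew y ∧ ¬ isNew (π y)).card
      = 2 := by
    have : (Finset.univ : Finset Bool).card = 2 := rfl
    rw [← this]
    refine Finset.card_bij (fun y _ => y.2) (fun _ _ => Finset.mem_univ _) ?_ ?_
    · intro y hy y' hy' h
      simp only [Finset.mem_filter, Finset.mem_univ, true_and] at hy hy'
      obtain ⟨x, rfl⟩ := hcases y hy.2.1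
      obtain ⟨x', rfl⟩ := hcases y' hy'.2.1
      rw [hface x x' (hcyc _ hy.1)
        (sameCycle_of_sameCycle_oldDart hsw (hy.1.symm.trans hy'.1)) h
        ((hsw' x).1 hy.2.2) ((hsw' x').1 hy'.2.2)]
    · intro b _
      obtain ⟨x, hx⟩ : ∃ x, π.SameCycle z (oldDart x) := by
        by_cases h : isNew z
        · obtain ⟨x, hx⟩ := hcases _ (hπnew z (Perm.SameCycle.refl _ _) h)
          exact ⟨x, hx ▸ Perm.sameCycle_apply_right.2 (Perm.SameCycle.refl _ _)⟩
        · obtain ⟨x, hx⟩ := hcases _ h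
          exact ⟨x, hx ▸ Perm.SameCycle.refl _ _⟩
      obtain ⟨y, hy, hne⟩ := exists_keptFace_ne emb hacyc x
      obtain ⟨u, u', hxu, huu', hub, hne'⟩ : ∃ u u', (keptFace left right emb).SameCycle x u ∧
          (keptFace left right emb).SameCycle u u' ∧ u.1.2 = b ∧ u.1.2 ≠ u'.1.2 := by
        by_cases hb : x.1.2 = b
        · exact ⟨x, y, Perm.SameCycle.refl _ _, hy, hb, hne⟩
        · refine ⟨y, x, hy, hy.symm, ?_, hne.symm⟩
          revert hb hne
          cases x.1.2 <;> cases y.1.2 <;> cases b <;> simp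
      obtain ⟨w, hw1, hw2, hw3⟩ := exists_switch (fun x => x.1.2) huu' hne'
      refine ⟨oldDart w, ?_, hw2.trans hub⟩
      simp only [Finset.mem_filter, Finset.mem_univ, true_and]
      exact ⟨hx.trans (sameCycle_oldDart_of_sameCycle hsw (hxu.trans hw1)), hold _,
        (hsw' w).2 (by rw [hw2]; exact hw3)⟩
  -- With `m` new sides, all negative, the face has `m + (m + 2)` sides.
  rw [hneg, hs, hsplit, hbij, htwo, Nat.odd_iff]
  omega

end Flat

end DirectedMultigraph

/-! ### Path sums -/

namespace DirectedMultigraph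

section PathSum

variable {V E R : Type*} [CommRing R] (G : DirectedMultigraph V E)

/-- The total weight of all directed paths from `u` to `v`. -/
noncomputable def pathSum (w : E → R) (u v : V) : R :=
  ∑ᶠ p : {p : List E // G.IsPath u v p}, (p.1.map w).prod

/-- A path is trivial or starts with an edge. -/
def pathEquiv (u v : V) : {p : List E // G.IsPath u v p} ≃
    PLift (u = v) ⊕ Σ e : {e // G.tail e = u}, {p : List E // G.IsPath (G.head e.1) v p} where
  toFun
    | ⟨[], h⟩ => .inl ⟨h⟩
    | ⟨e :: p, h⟩ => .inr ⟨⟨e, h.1⟩, ⟨p, h.2⟩⟩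
  invFun
    | .inl h => ⟨[], h.down⟩
    | .inr ⟨e, p⟩ => ⟨e.1 :: p.1, e.2, p.2⟩
  left_inv := by
    rintro ⟨_ | ⟨e, p⟩, h⟩ <;> rfl
  right_inv := by
    rintro (h | ⟨e, p⟩) <;> rfl

variable {G} [Finite V]

theorem Acyclic.finite_paths [Finite E] (hacyc : G.Acyclic) (u v : V) :
    Finite {p : List E // G.IsPath u v p} := by
  induction u using hacyc.wellFounded_flip.induction with
  | _ u ih =>
    have : ∀ e : {e // G.tail e = u}, Finite {p : List E // G.IsPath (G.head e.1) v p} :=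
      fun e => ih _ ⟨e.1, e.2, rfl⟩
    exact Finite.of_equiv _ (G.pathEquiv u v).symm

open Classical in
theorem Acyclic.pathSum_eq [Fintype E] (hacyc : G.Acyclic) (w : E → R) (u v : V) :
    G.pathSum w u v = (if u = v then 1 else 0) +
      ∑ e, if G.tail e = u then w e * G.pathSum w (G.head e) v else 0 := by
  have : ∀ u, Fintype {p : List E // G.IsPath u v p} := fun u =>
    @Fintype.ofFinite _ (hacyc.finite_paths u v)
  simp only [pathSum, finsum_eq_sum_of_fintype]
  rw [← (G.pathEquiv u v).symm.sum_comp, Fintype.sum_sum_type, Fintype.sum_sigma]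
  congr 1
  · by_cases h : u = v
    · have : Unique (PLift (u = v)) := ⟨⟨⟨h⟩⟩, fun _ => rfl⟩
      rw [if_pos h, Fintype.sum_unique]
      rfl
    · have : IsEmpty (PLift (u = v)) := ⟨fun h' => h h'.down⟩
      rw [if_neg h, Finset.univ_eq_empty, Finset.sum_empty]
  · rw [← Finset.sum_filter, ← Finset.sum_subtype_eq_sum_filter]
    refine (Finset.sum_bij (fun e _ => ⟨e.1, by simp [e.2]⟩) ?_ ?_ ?_ ?_)
    · intros; simp
    · intro a _ b _ h
      exact Subtype.ext (Subtype.mk.inj h)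
    · rintro ⟨e, he⟩ _
      exact ⟨⟨e, by simpa using he⟩, Finset.mem_univ _, rfl⟩
    · intro e _
      rw [Finset.mul_sum]
      rfl

open Classical in
/-- The recursion of the path sums determines them. -/
theorem Acyclic.eq_of_recursion [Fintype E] (hacyc : G.Acyclic) {w : E → R} {a f g : V → R}
    (hf : ∀ u, f u = a u + ∑ e, if G.tail e = u then w e * f (G.head e) else 0)
    (hg : ∀ u, g u = a u + ∑ e, if G.tail e = u then w e * g (G.head e) else 0) (u : V) :
    f u = g u := by
  induction u using hacyc.wellFounded_flip.induction with
  | _ u ih =>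
    rw [hf, hg]
    congr 1
    refine Finset.sum_congr rfl fun e _ => ?_
    split_ifs with h
    · rw [ih _ ⟨e, h, rfl⟩]
    · rfl

end PathSum

/-! ### Eliminating the transit vertices by deleted pivots -/

section Pivots

variable {V E R : Type*} [CommRing R] [Finite V] [Fintype E] {G : DirectedMultigraph V E}
  {n : ℕ} (left right : Fin n → V) (w : E → R)

open Classical in
/-- The weights with the deleted edges weighted by zero. -/
noncomputable def keptWeight (e : E) : R := if G.Deleted left right e then 0 else w e

variable {left right}

theorem pathSum_keptWeight_of_mem_right (hacyc : G.Acyclic) {v : V} (hv : v ∈ Set.range right)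
    (c : V) :
    G.pathSum (G.keptWeight left right w) v c = open Classical in if v = c then 1 else 0 := by
  classical
  rw [hacyc.pathSum_eq, Finset.sum_eq_zero, add_zero]
  intro e _
  split_ifs with h
  · rw [keptWeight, if_pos (.out_of_right e (h ▸ hv)), zero_mul]
  · rfl

open Classical in
/-- The sum of the paths from `u` to `c` with all inner vertices in `T`, except the first. -/
noncomputable def innerPathSum (T : Set V) (u c : V) : R :=
  (if u = c then 1 else 0) + ∑ e, if G.tail e = u then G.keptWeight left right w e *
    ((if G.head e = c then 1 else 0) + if G.head e ∈ T then
      G.pathSum (G.keptWeight left right w) (G.head e) c else 0) else 0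

/-- The first kept edge from `u` leads either into `T`, where all continuations are already counted,
or to a right endpoint, where the path must stop. -/
theorem innerPathSum_eq_pathSum (hacyc : G.Acyclic) {T : Set V}
    (hT : ∀ v ∈ T, G.IsTransit left right v) {u c : V} (hc : ¬ G.IsTransit left right c)
    (hu : ∀ e, ¬ G.Deleted left right e → G.tail e = u → G.IsTransit left right (G.head e) →
      G.head e ∈ T) :
    innerPathSum (G := G) (left := left) (right := right) w T u c =
      G.pathSum (G.keptWeight left right w) u c := by
  classical
  rw [hacyc.pathSum_eq, innerPathSum]
  congr 1
  refine Finset.sum_congr rfl fun e _ => ?_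
  by_cases he : G.tail e = u
  swap
  · rw [if_neg he, if_neg he]
  rw [if_pos he, if_pos he]
  by_cases hd : G.Deleted left right e
  · simp [keptWeight, hd]
  congr 1
  by_cases hh : G.head e ∈ T
  · rw [if_pos hh, if_neg, zero_add]
    rintro rfl
    exact hc (hT _ hh)
  · rw [if_neg hh, add_zero, pathSum_keptWeight_of_mem_right w hacyc]
    exact (head_mem_white hd).resolve_right fun h => hh (hu e hd he h)

/-- The vertex of the graph at which a black vertex of the resolution arises. -/
def Black.vertex (b : G.Black left right) : V :=
  Subtype.val (p := fun v => v ∈ Set.range left ∨ G.IsTransit left right v) b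

/-- The vertex of the graph at which a white vertex of the resolution arises. -/
def White.vertex (c : G.White left right) : V :=
  Subtype.val (p := fun v => v ∈ Set.range right ∨ G.IsTransit left right v) c

omit [Finite V] [Fintype E] in
theorem Black.vertex_injective : Injective (Black.vertex (G := G) (left := left)
    (right := right)) := Subtype.val_injective

omit [Finite V] [Fintype E] in
theorem White.vertex_injective : Injective (White.vertex (G := G) (left := left)
    (right := right)) := Subtype.val_injective

omit [Finite V] [Fintype E] in
theorem Black.mem (b : G.Black left right) :
    b.vertex ∈ Set.range left ∨ G.IsTransit left right b.vertex := Subtype.property b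

omit [Finite V] [Fintype E] in
theorem White.mem (c : G.White left right) :
    c.vertex ∈ Set.range right ∨ G.IsTransit left right c.vertex := Subtype.property c

/-- The signed bipartite adjacency matrix of the resolution. -/
noncomputable def resolutionMatrix : Matrix (G.Black left right) (G.White left right) R :=
  fun b c => ∑ᶠ e : {e // (G.resolution left right).tail e = Sum.inl b ∧
      (G.resolution left right).head e = Sum.inr c},
    ((resolutionSign e.1 : ℤ) : R) * G.resolutionWeight left right w e.1

omit [Finite V] [Fintype E] in
theorem resolution_inl_iff (e : {e // ¬ G.Deleted left right e}) (b : G.Black left right)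
    (c : G.White left right) : ((G.resolution left right).tail (.inl e) = Sum.inl b ∧
      (G.resolution left right).head (.inl e) = Sum.inr c) ↔
    G.tail e.1 = b.vertex ∧ G.head e.1 = c.vertex :=
  and_congr
    ⟨fun h => congrArg Black.vertex (Sum.inl.inj h),
      fun h => congrArg Sum.inl (Black.vertex_injective h)⟩
    ⟨fun h => congrArg White.vertex (Sum.inr.inj h),
      fun h => congrArg Sum.inr (White.vertex_injective h)⟩

omit [Finite V] [Fintype E] in
theorem resolution_inr_iff (v : G.SplitVertex left right) (b : G.Black left right)
    (c : G.White left right) : ((G.resolution left right).tail (.inr v) = Sum.inl b ∧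
      (G.resolution left right).head (.inr v) = Sum.inr c) ↔
    v.1 = b.vertex ∧ v.1 = c.vertex :=
  and_congr
    ⟨fun h => congrArg Black.vertex (Sum.inl.inj h),
      fun h => congrArg Sum.inl (Black.vertex_injective h)⟩
    ⟨fun h => congrArg White.vertex (Sum.inr.inj h),
      fun h => congrArg Sum.inr (White.vertex_injective h)⟩

open Classical in
theorem resolutionMatrix_apply (b : G.Black left right) (c : G.White left right) :
    resolutionMatrix w b c =
      (∑ e, if G.tail e = b.vertex ∧ G.head e = c.vertex then
        G.keptWeight left right w e else 0) +
      if b.vertex = c.vertex then (if G.IsTransit left right b.vertex then -1 else 1) else 0 := by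
  have : Fintype (G.ResolutionEdge left right) := Fintype.ofFinite _
  have : Fintype (G.SplitVertex left right) := Fintype.ofFinite _
  rw [resolutionMatrix, finsum_eq_sum_of_fintype,
    ← Finset.sum_subtype (Finset.univ.filter fun e : G.ResolutionEdge left right =>
    (G.resolution left right).tail e = Sum.inl b ∧
      (G.resolution left right).head e = Sum.inr c) (by simp)
    (fun e => ((resolutionSign e : ℤ) : R) * G.resolutionWeight left right w e),
    Finset.sum_filter]
  let φ : {e // ¬ G.Deleted left right e} ⊕ G.SplitVertex left right ≃
    G.ResolutionEdge left right := Equiv.refl _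
  rw [← φ.sum_comp, Fintype.sum_sum_type]
  have e1 : ∀ e, φ (.inl e) = Sum.inl e := fun _ => rfl
  have e2 : ∀ v, φ (.inr v) = Sum.inr v := fun _ => rfl
  simp only [e1, e2, resolution_inl_iff, resolution_inr_iff]
  congr 1
  · rw [← Fintype.sum_subtype_add_sum_subtype (fun e => ¬ G.Deleted left right e)]
    rw [Finset.sum_eq_zero (s := Finset.univ (α := {e // ¬ ¬ G.Deleted left right e})), add_zero]
    · refine Finset.sum_congr rfl fun e _ => ?_
      simp [resolutionSign, resolutionWeight, keptWeight, e.2]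
    · rintro ⟨e, he⟩ _
      simp [keptWeight, not_not.1 he]
  · by_cases hbc : b.vertex = c.vertex
    · let v₀ : G.SplitVertex left right := ⟨b.vertex, b.mem, hbc ▸ c.mem⟩
      rw [if_pos hbc, Finset.sum_eq_single v₀]
      · rw [if_pos ⟨rfl, hbc⟩]
        by_cases hv : G.IsTransit left right b.vertex
        · simp [resolutionSign, resolutionWeight, v₀, hv]
        · simp [resolutionSign, resolutionWeight, v₀, hv]
      · intro v _ hv
        rw [if_neg]
        exact fun h => hv (Subtype.ext h.1)
      · simp
    · rw [if_neg hbc, Finset.sum_eq_zero]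
      intro v _
      rw [if_neg]
      exact fun h => hbc (h.1.symm.trans h.2)

/-- The pivots at the new edges of the transit vertices, sinks first, count the paths. -/
theorem exists_deletedPivotsReach (hacyc : G.Acyclic) :
    ∃ N, DeletedPivotsReach (resolutionMatrix (G := G) (left := left) (right := right) w)
      {b | ¬ G.IsTransit left right b.vertex} {c | ¬ G.IsTransit left right c.vertex} N ∧
      ∀ b c, ¬ G.IsTransit left right b.vertex → ¬ G.IsTransit left right c.vertex →
        N b c = G.pathSum (G.keptWeight left right w) b.vertex c.vertex := by
  classical
  let M := resolutionMatrix (G := G) (left := left) (right := right) w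
  -- The invariant after pivoting at `T`: remaining transit columns are untouched, while endpoint
  -- columns already count the continuations through `T`.
  let Good : Set V → Prop := fun T => (∀ v ∈ T, G.IsTransit left right v) ∧
    ∃ N, DeletedPivotsReach M {b | b.vertex ∉ T} {c | c.vertex ∉ T} N ∧
      ∀ b c, b.vertex ∉ T → c.vertex ∉ T → N b c =
        if G.IsTransit left right c.vertex then M b c else
          innerPathSum (G := G) (left := left) (right := right) w T b.vertex c.vertex
  have hgood : Good ∅ := by
    refine ⟨by simp, M, ?_, ?_⟩
    · have h1 : {b : G.Black left right | b.vertex ∉ (∅ : Set V)} = Set.univ := by simp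
      have h2 : {c : G.White left right | c.vertex ∉ (∅ : Set V)} = Set.univ := by simp
      rw [h1, h2]
      exact .nil
    · intro b c _ _
      split_ifs with hc
      · rfl
      · simp only [M, resolutionMatrix_apply, innerPathSum]
        rw [add_comm]
        congr 1
        · by_cases hbc : b.vertex = c.vertex
          · rw [if_pos hbc, if_pos hbc, if_neg (hbc ▸ hc)]
          · rw [if_neg hbc, if_neg hbc]
        · refine Finset.sum_congr rfl fun e _ => ?_
          by_cases h1 : G.tail e = b.vertex <;> by_cases h2 : G.head e = c.vertex <;> simp [h1, h2]
  obtain ⟨T, hT⟩ := (Set.toFinite {T | Good T}).exists_maximal ⟨∅, hgood⟩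
  obtain ⟨hTt, N, hN, hNT⟩ := hT.prop
  have hall : ∀ v, G.IsTransit left right v → v ∈ T := by
    by_contra hcon
    push Not at hcon
    -- The next pivot is a transit vertex all of whose transit successors are already eliminated.
    obtain ⟨v, ⟨hv, hvT⟩, hmin⟩ := hacyc.wellFounded_flip.has_min
      {v | G.IsTransit left right v ∧ v ∉ T} hcon
    have hsucc : ∀ e, ¬ G.Deleted left right e → G.tail e = v →
        G.IsTransit left right (G.head e) → G.head e ∈ T := by
      intro e he hev ht
      by_contra hh
      exact hmin _ ⟨ht, hh⟩ ⟨e, hev, rfl⟩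
    let i : G.Black left right := ⟨v, .inr hv⟩
    let j : G.White left right := ⟨v, .inr hv⟩
    have hiv : i.vertex = v := rfl
    have hjv : j.vertex = v := rfl
    have hNcol : ∀ b, b.vertex ∉ T → N b j = M b j := fun b hb =>
      (hNT b j hb hvT).trans (if_pos hv)
    have hMij : M i j = -1 := by
      simp only [M, resolutionMatrix_apply, hiv, hjv, if_true, if_pos hv]
      rw [Finset.sum_eq_zero, zero_add]
      intro e _
      rw [if_neg]
      exact fun h => hacyc v (.single ⟨e, h⟩)
    have hNij : N i j = -1 := (hNcol i hvT).trans hMij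
    have hgood' : Good (insert v T) := by
      refine ⟨?_, fun k l => N k l - (-(M k j)) * N i l, ?_, ?_⟩
      · rintro u (rfl | hu)
        · exact hv
        · exact hTt u hu
      · have h1 : {b : G.Black left right | b.vertex ∉ insert v T} =
            {b | b.vertex ∉ T} \ {i} := by
          ext b
          simp only [Set.mem_ofPred_eq, Set.mem_insert_iff, Set.mem_sdiff, Set.mem_singleton_iff,
            ← Black.vertex_injective.eq_iff (b := i), hiv]
          tauto
        have h2 : {c : G.White left right | c.vertex ∉ insert v T} =
            {c | c.vertex ∉ T} \ {j} := by
          ext c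
          simp only [Set.mem_ofPred_eq, Set.mem_insert_iff, Set.mem_sdiff, Set.mem_singleton_iff,
            ← White.vertex_injective.eq_iff (b := j), hjv]
          tauto
        rw [h1, h2]
        -- The pivot entry is `-1`, so the quotient is `-(M k j)` and the subtraction adds the paths
        -- through `v`.
        refine .pivot i j (fun k => -(M k j)) hN hvT hvT ?_ ?_
        · intro k hk
          rw [hNij, hNcol k hk.1]
          ring
        · intro l _
          rw [hNij]
          exact (isUnit_one.neg).dvd
      · intro k l hk hl
        rw [Set.mem_insert_iff, not_or] at hk hl
        have hMkj : M k j = ∑ e, if G.tail e = k.vertex ∧ G.head e = v then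
            G.keptWeight left right w e else 0 := by
          simp only [M, resolutionMatrix_apply, hjv, if_neg hk.1, add_zero]
        change N k l - (-(M k j)) * N i l = _
        rw [hNT k l hk.2 hl.2, hNT i l hvT hl.2]
        by_cases hlt : G.IsTransit left right l.vertex
        · rw [if_pos hlt, if_pos hlt, if_pos hlt]
          -- No kept edge joins `v` to a transit vertex outside `T`, so the pivot does not disturb
          -- the other transit columns.
          have : M i l = 0 := by
            simp only [M, resolutionMatrix_apply, hiv, if_neg (Ne.symm hl.1), add_zero]
            refine Finset.sum_eq_zero fun e _ => ?_
            split_ifs with h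
            · by_cases hd : G.Deleted left right e
              · exact if_pos hd
              · exact absurd (h.2 ▸ hsucc e hd h.1 (h.2.symm ▸ hlt)) hl.2
            · rfl
          rw [this, mul_zero, sub_zero]
        · rw [if_neg hlt, if_neg hlt, if_neg hlt, hiv,
            innerPathSum_eq_pathSum w hacyc hTt hlt hsucc, hMkj, neg_mul, sub_neg_eq_add,
            innerPathSum, innerPathSum, Finset.sum_mul, add_assoc, ← Finset.sum_add_distrib]
          congr 1
          refine Finset.sum_congr rfl fun e _ => ?_
          by_cases h1 : G.tail e = k.vertex
          · by_cases h2 : G.head e = v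
            · simp [h1, h2, hvT, Ne.symm hl.1]
            · simp [h1, h2]
          · simp [h1]
    exact hvT (hT.le_of_ge hgood' (Set.subset_insert v T) (Set.mem_insert v T))
  have hTeq : ∀ v, v ∈ T ↔ G.IsTransit left right v := fun v => ⟨hTt v, hall v⟩
  refine ⟨N, ?_, ?_⟩
  · simpa only [hTeq] using hN
  · intro b c hb hc
    rw [hNT b c (by rwa [hTeq]) (by rwa [hTeq]), if_neg hc]
    exact innerPathSum_eq_pathSum w hacyc hTt hc fun e _ _ ht => hall _ ht

theorem obtainedByDeletedPivots_resolutionMatrix (hacyc : G.Acyclic) (hleft : Injective left)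
    (hright : Injective right) :
    ObtainedByDeletedPivots (resolutionMatrix (G := G) w) (G.leftVertex left right)
      (G.rightVertex left right)
      (fun i j => G.pathSum (G.keptWeight left right w) (left i) (right j)) := by
  obtain ⟨N, hN, hNp⟩ := exists_deletedPivotsReach (G := G) (left := left) (right := right) w hacyc
  have hl : ∀ i, (G.leftVertex left right i).vertex = left i := fun _ => rfl
  have hr : ∀ i, (G.rightVertex left right i).vertex = right i := fun _ => rfl
  have h1 : Set.range (G.leftVertex left right) = {b | ¬ G.IsTransit left right b.vertex} := by
    ext b
    constructor
    · rintro ⟨i, rfl⟩ h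
      exact h.not_mem_left ⟨i, rfl⟩
    · intro h
      obtain ⟨i, hi⟩ := b.mem.resolve_right h
      exact ⟨i, Black.vertex_injective hi⟩
  have h2 : Set.range (G.rightVertex left right) = {c | ¬ G.IsTransit left right c.vertex} := by
    ext c
    constructor
    · rintro ⟨i, rfl⟩ h
      exact h.not_mem_right ⟨i, rfl⟩
    · intro h
      obtain ⟨i, hi⟩ := c.mem.resolve_right h
      exact ⟨i, White.vertex_injective hi⟩
  refine ⟨fun i j h => hleft (congrArg Black.vertex h),
    fun i j h => hright (congrArg White.vertex h), N, by rwa [h1, h2], ?_⟩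
  funext i j
  refine (hNp (G.leftVertex left right i) (G.rightVertex left right j) ?_ ?_).symm
  · exact fun h => h.not_mem_left ⟨i, rfl⟩
  · exact fun h => h.not_mem_right ⟨j, rfl⟩

end Pivots

end DirectedMultigraph

/-! ### Unitriangular matrices and elementary operations -/

section Elementary

variable {R I J : Type*} [CommRing R] [DecidableEq I] [DecidableEq J]

theorem ElementaryOperation.transpose {M N : Matrix I J R} (h : ElementaryOperation M N) :
    ElementaryOperation M.transpose N.transpose := by
  cases h with
  | scaleRow i u =>
    rw [← Matrix.updateCol_transpose]
    exact .scaleCol (M := M.transpose) i u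
  | addRow i k c h =>
    rw [← Matrix.updateCol_transpose]
    exact .addCol (M := M.transpose) i k c h
  | scaleCol j u =>
    rw [← Matrix.updateRow_transpose]
    exact .scaleRow (M := M.transpose) j u
  | addCol j l c h =>
    rw [← Matrix.updateRow_transpose]
    exact .addRow (M := M.transpose) j l c h

theorem ObtainedByElementaryOperations.transpose {M N : Matrix I J R}
    (h : ObtainedByElementaryOperations M N) :
    ObtainedByElementaryOperations M.transpose N.transpose := by
  induction h with
  | refl => exact .refl
  | tail _ h ih => exact ih.tail h.transpose

theorem obtainedByElementaryOperations_updateRow (M : Matrix I J R) (k : I) (c : I → R)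
    (F : Finset I) (hF : k ∉ F) :
    ObtainedByElementaryOperations M (M.updateRow k (M k + ∑ i ∈ F, c i • M i)) := by
  induction F using Finset.induction_on with
  | empty =>
    rw [Finset.sum_empty, add_zero, Matrix.updateRow_eq_self]
    exact .refl
  | insert i F hi ih =>
    rw [Finset.mem_insert, not_or] at hF
    refine (ih hF.2).tail ?_
    have h := ElementaryOperation.addRow (M := M.updateRow k (M k + ∑ i ∈ F, c i • M i)) i k (c i)
      (Ne.symm hF.1)
    rw [Matrix.updateRow_idem, Matrix.updateRow_self, Matrix.updateRow_ne (Ne.symm hF.1)] at h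
    rw [Finset.sum_insert hi, add_comm (c i • M i), ← add_assoc]
    exact h

/-- Multiplication by a unitriangular matrix on the left is a sequence of row operations. -/
theorem obtainedByElementaryOperations_mul_left [Fintype I] (A : Matrix I I R) (M : Matrix I J R)
    (hdiag : ∀ i, A i i = 1) {r : I → I → Prop} (hr : WellFounded r)
    (hA : ∀ i j, i ≠ j → A i j ≠ 0 → r i j) :
    ObtainedByElementaryOperations M (A * M) := by
  classical
  -- `S` is the set of finished rows, closed under `r`-predecessors. The next row `k` uses only rows
  -- `j` with `r k j`; these are not in `S`, hence still original.
  let P : Finset I → Prop := fun S => (∀ i j, j ∈ S → r i j → i ∈ S) ∧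
    ObtainedByElementaryOperations M (Matrix.of fun i => if i ∈ S then (A * M) i else M i)
  have h0 : P ∅ := ⟨by simp, by simpa using .refl⟩
  obtain ⟨S, hS⟩ := (Set.toFinite {S | P S}).exists_maximal ⟨∅, h0⟩
  have hall : ∀ i, i ∈ S := by
    by_contra hcon
    push Not at hcon
    obtain ⟨k, hk, hmin⟩ := hr.has_min {i | i ∉ S} hcon
    have hkS : k ∉ S := hk
    have hnew : P (insert k S) := by
      refine ⟨?_, ?_⟩
      · intro i j hj hij
        rw [Finset.mem_insert] at hj ⊢
        rcases hj with rfl | hj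
        · by_contra hi
          push Not at hi
          exact hmin i hi.2 hij
        · exact .inr (hS.prop.1 i j hj hij)
      · have h1 := obtainedByElementaryOperations_updateRow
          (Matrix.of fun i => if i ∈ S then (A * M) i else M i) k (A k) (Finset.univ.erase k)
          (Finset.notMem_erase _ _)
        have h2 := Relation.ReflTransGen.trans hS.prop.2 h1
        refine Eq.subst (motive := fun X => ObtainedByElementaryOperations M X) ?_ h2
        refine funext fun i => Eq.symm ?_
        by_cases hik : i = k
        · subst hik
          rw [Matrix.updateRow_self]
          change (if i ∈ insert i S then (A * M) i else M i) =
            (if i ∈ S then (A * M) i else M i) +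
              ∑ j ∈ Finset.univ.erase i, A i j • (if j ∈ S then (A * M) j else M j)
          rw [if_pos (Finset.mem_insert_self _ _), if_neg hkS]
          have : (A * M) i = ∑ j, A i j • M j := by
            funext l
            simp [Matrix.mul_apply, Finset.sum_apply]
          rw [this, ← Finset.add_sum_erase _ _ (Finset.mem_univ i), hdiag, one_smul]
          congr 1
          refine Finset.sum_congr rfl fun j hj => ?_
          by_cases hjS : j ∈ S
          · have : A i j = 0 := by
              by_contra hne
              exact hkS (hS.prop.1 i j hjS (hA i j (Finset.ne_of_mem_erase hj).symm hne))
            rw [this, zero_smul, zero_smul]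
          · rw [if_neg hjS]
        · rw [Matrix.updateRow_ne hik]
          change (if i ∈ insert k S then (A * M) i else M i) = if i ∈ S then (A * M) i else M i
          exact if_congr (by rw [Finset.mem_insert, or_iff_right hik]) rfl rfl
    exact hkS (hS.le_of_ge hnew (Finset.subset_insert k S) (Finset.mem_insert_self k S))
  have h := hS.prop.2
  rwa [show (Matrix.of fun i => if i ∈ S then (A * M) i else M i) = A * M from
    funext fun i => if_pos (hall i)] at h

theorem obtainedByElementaryOperations_mul_right [Fintype J] (M : Matrix I J R)
    (B : Matrix J J R) (hdiag : ∀ i, B i i = 1) {r : J → J → Prop} (hr : WellFounded (flip r))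
    (hB : ∀ i j, i ≠ j → B i j ≠ 0 → r i j) :
    ObtainedByElementaryOperations M (M * B) := by
  have := (obtainedByElementaryOperations_mul_left B.transpose M.transpose hdiag hr
    fun i j hij h => hB j i hij.symm h).transpose
  rwa [← Matrix.transpose_mul, Matrix.transpose_transpose, Matrix.transpose_transpose] at this

end Elementary

/-! ### Factoring the path matrix at the endpoints -/

namespace DirectedMultigraph

section Decomposition

variable {V E R : Type*} [CommRing R] [Finite V] [Fintype E] {G : DirectedMultigraph V E}
  {n : ℕ} {left right : Fin n → V} (w : E → R)

theorem transGen_of_pathSum_ne_zero (hacyc : G.Acyclic) {w : E → R} {u v : V} (huv : u ≠ v)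
    (h : G.pathSum w u v ≠ 0) : Relation.TransGen G.Step u v := by
  classical
  induction u using hacyc.wellFounded_flip.induction with
  | _ u ih =>
    rw [hacyc.pathSum_eq, if_neg huv, zero_add] at h
    obtain ⟨e, -, he⟩ := Finset.exists_ne_zero_of_sum_ne_zero h
    split_ifs at he with h1
    · have hs : G.Step u (G.head e) := ⟨e, h1, rfl⟩
      by_cases hv : G.head e = v
      · exact .single (hv ▸ hs)
      · exact .head hs (ih _ hs hv (right_ne_zero_of_mul he))
    · exact absurd rfl he

theorem pathSum_self (hacyc : G.Acyclic) (w : E → R) (u : V) : G.pathSum w u u = 1 := by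
  classical
  rw [hacyc.pathSum_eq, if_pos rfl, Finset.sum_eq_zero, add_zero]
  intro e _
  split_ifs with h
  · have hs : G.Step u (G.head e) := ⟨e, h, rfl⟩
    have : G.pathSum w (G.head e) u = 0 := by
      by_contra hne
      by_cases hv : G.head e = u
      · rw [hv] at hs
        exact hacyc u (.single hs)
      · exact hacyc u (.head hs (transGen_of_pathSum_ne_zero hacyc hv hne))
    rw [this, mul_zero]
  · rfl

variable (G left right) in
open Classical in
/-- The weights with edges into left endpoints weighted by zero. -/
noncomputable def avoidLeftWeight (e : E) : R := if G.head e ∈ Set.range left then 0 else w e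

variable (G left right) in
open Classical in
/-- The weights with edges into left endpoints or out of right endpoints weighted by zero. -/
noncomputable def avoidBothWeight (e : E) : R :=
  if G.tail e ∈ Set.range right then 0 else G.avoidLeftWeight left w e

/-- Each path is cut at the last left endpoint that it visits; the rest enters no left endpoint. -/
theorem pathSum_eq_sum_left (hacyc : G.Acyclic) (hleft : Injective left) (i : Fin n) (v : V) :
    G.pathSum w (left i) v =
      ∑ i', G.pathSum w (left i) (left i') * G.pathSum (G.avoidLeftWeight left w) (left i') v := by
  classical
  let Q : V → V → R := G.pathSum (G.avoidLeftWeight left w)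
  have key := hacyc.eq_of_recursion (w := w) (a := fun u => if u = v then (1 : R) else 0)
    (f := fun u => G.pathSum w u v)
    -- For a start `u` that need not be an endpoint, the term `Q u v` counts the paths that enter no
    -- left endpoint. The subtracted Kronecker delta prevents counting them twice when `u` is itself
    -- one.
    (g := fun u => Q u v + ∑ i', (G.pathSum w u (left i') - if u = left i' then 1 else 0) *
      Q (left i') v) (hacyc.pathSum_eq w · v) (by
      intro u
      have e1 : Q u v = (if u = v then 1 else 0) + ∑ e, if G.tail e = u then
          w e * (if G.head e ∈ Set.range left then 0 else Q (G.head e) v) else 0 := by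
        rw [show Q u v = _ from hacyc.pathSum_eq _ u v]
        congr 1
        refine Finset.sum_congr rfl fun e _ => ?_
        simp only [avoidLeftWeight, Q]
        split_ifs <;> simp
      have e2 : ∀ i', (G.pathSum w u (left i') - if u = left i' then 1 else 0) =
          ∑ e, if G.tail e = u then w e * G.pathSum w (G.head e) (left i') else 0 := by
        intro i'
        rw [hacyc.pathSum_eq w u (left i'), add_sub_cancel_left]
      simp only [e2]
      rw [e1, add_assoc]
      congr 1
      simp only [Finset.sum_mul]
      rw [Finset.sum_comm, ← Finset.sum_add_distrib]
      refine Finset.sum_congr rfl fun e _ => ?_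
      by_cases h : G.tail e = u
      swap
      · simp [h]
      simp only [if_pos h, sub_mul, Finset.sum_sub_distrib, mul_assoc]
      rw [← Finset.mul_sum, ← mul_add]
      congr 1
      have e3 : ∑ i', (if G.head e = left i' then (1 : R) else 0) * Q (left i') v =
          if G.head e ∈ Set.range left then Q (G.head e) v else 0 := by
        by_cases hm : G.head e ∈ Set.range left
        · obtain ⟨i₀, hi₀⟩ := id hm
          rw [if_pos hm, Finset.sum_eq_single i₀]
          · rw [if_pos hi₀.symm, one_mul, hi₀]
          · intro i' _ hne
            rw [if_neg, zero_mul]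
            exact fun h => hne (hleft (h.symm.trans hi₀.symm))
          · simp
        · rw [if_neg hm]
          refine Finset.sum_eq_zero fun i' _ => ?_
          rw [if_neg, zero_mul]
          exact fun h => hm ⟨i', h.symm⟩
      rw [e3]
      split_ifs <;> ring) (left i)
  rw [show G.pathSum w (left i) v = _ from key]
  simp only [sub_mul, Finset.sum_sub_distrib]
  have : ∑ i', (if left i = left i' then (1 : R) else 0) * Q (left i') v = Q (left i) v := by
    rw [Finset.sum_eq_single i]
    · simp
    · intro i' _ hne
      rw [if_neg, zero_mul]
      exact fun h => hne (hleft h).symm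
    · simp
  rw [this]
  ring

/-- Each path is cut at the first right endpoint that it visits, which suits induction on the first
edge. -/
theorem pathSum_eq_sum_right (hacyc : G.Acyclic) (hright : Injective right) (u : V) (j : Fin n) :
    G.pathSum (G.avoidLeftWeight left w) u (right j) =
      ∑ j', G.pathSum (G.avoidBothWeight left right w) u (right j') *
        G.pathSum (G.avoidLeftWeight left w) (right j') (right j) := by
  classical
  let Q : V → V → R := G.pathSum (G.avoidLeftWeight left w)
  have hbase : ∀ j₀ j', G.pathSum (G.avoidBothWeight left right w) (right j₀) (right j') =
      if j₀ = j' then 1 else 0 := by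
    intro j₀ j'
    rw [hacyc.pathSum_eq, Finset.sum_eq_zero, add_zero]
    · simp only [hright.eq_iff]
    · intro e _
      split_ifs with h
      · rw [avoidBothWeight, if_pos (h ▸ ⟨j₀, rfl⟩), zero_mul]
      · rfl
  induction u using hacyc.wellFounded_flip.induction with
  | _ u ih =>
    by_cases hu : u ∈ Set.range right
    · obtain ⟨j₀, rfl⟩ := hu
      simp [hbase]
    · have h1 : ∀ j', G.pathSum (G.avoidBothWeight left right w) u (right j') =
          ∑ e, if G.tail e = u then G.avoidLeftWeight left w e *
            G.pathSum (G.avoidBothWeight left right w) (G.head e) (right j') else 0 := by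
        intro j'
        rw [hacyc.pathSum_eq, if_neg (fun h => hu ⟨j', h.symm⟩), zero_add]
        refine Finset.sum_congr rfl fun e _ => ?_
        split_ifs with h
        · rw [avoidBothWeight, if_neg (h ▸ hu)]
        · rfl
      rw [hacyc.pathSum_eq, if_neg (fun h => hu ⟨j, h.symm⟩), zero_add]
      simp only [h1, Finset.sum_mul]
      rw [Finset.sum_comm]
      refine Finset.sum_congr rfl fun e _ => ?_
      split_ifs with h
      · rw [ih _ ⟨e, h, rfl⟩, Finset.mul_sum]
        simp only [mul_assoc]
      · simp

variable (G left right) in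
/-- There is an edge from `u` to `v`, and neither is `v` a left endpoint nor `u` a right one. -/
def InnerStep (u v : V) : Prop := ∃ e, G.tail e = u ∧ G.head e = v ∧
  G.head e ∉ Set.range left ∧ G.tail e ∉ Set.range right

-- A route between endpoints survives: an edge deleted at a source or sink would have a neighbour on
-- the route that was deleted before it.
omit [Finite V] [Fintype E] in
theorem Deleted.not_on_route {e : E} (h : G.Deleted left right e) (h1 : G.head e ∉ Set.range left)
    (h2 : G.tail e ∉ Set.range right)
    (hl : ∃ i, Relation.ReflTransGen (G.InnerStep left right) (left i) (G.tail e))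
    (hr : ∃ j, Relation.ReflTransGen (G.InnerStep left right) (G.head e) (right j)) : False := by
  induction h with
  | into_left e h => exact h1 h
  | out_of_right e h => exact h2 h
  | source e ht _ _ ih =>
    obtain ⟨i, hi⟩ := hl
    rcases hi.cases_tail with h | ⟨u, hu, e', rfl, he', h3, h4⟩
    · exact ht ⟨i, h.symm⟩
    · obtain ⟨j, hj⟩ := hr
      exact ih e' he' h3 h4 ⟨i, hu⟩ ⟨j, .head ⟨e, he'.symm, rfl, h1, h2⟩ hj⟩
  | sink e _ ht _ ih =>
    obtain ⟨j, hj⟩ := hr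
    rcases hj.cases_head with h | ⟨u, ⟨e', he', rfl, h3, h4⟩, hu⟩
    · exact ht ⟨j, h.symm⟩
    · obtain ⟨i, hi⟩ := hl
      exact ih e' he' h3 h4 ⟨i, .tail hi ⟨e, rfl, he'.symm, h1, h2⟩⟩ ⟨j, hu⟩

theorem pathSum_avoidBothWeight_eq_zero (hacyc : G.Acyclic) {u : V} (j : Fin n)
    (hu : ¬ Relation.ReflTransGen (G.InnerStep left right) u (right j)) :
    G.pathSum (G.avoidBothWeight left right w) u (right j) = 0 := by
  classical
  induction u using hacyc.wellFounded_flip.induction with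
  | _ u ih =>
    rw [hacyc.pathSum_eq, if_neg (fun h => hu (by rw [h])), zero_add]
    refine Finset.sum_eq_zero fun e _ => ?_
    split_ifs with h
    · by_cases h1 : G.head e ∈ Set.range left
      · simp [avoidBothWeight, avoidLeftWeight, h1]
      · by_cases h2 : G.tail e ∈ Set.range right
        · simp [avoidBothWeight, h2]
        · rw [ih _ ⟨e, h, rfl⟩ fun h3 => hu (.head ⟨e, h, rfl, h1, h2⟩ h3), mul_zero]
    · rfl

/-- Pruning sources and sinks loses no path: a pruned edge reachable from a left endpoint has no
inner route on to a right endpoint, so it contributes zero anyway. -/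
theorem pathSum_keptWeight_eq (hacyc : G.Acyclic) {u : V} (j : Fin n)
    (hu : ∃ i, Relation.ReflTransGen (G.InnerStep left right) (left i) u) :
    G.pathSum (G.keptWeight left right w) u (right j) =
      G.pathSum (G.avoidBothWeight left right w) u (right j) := by
  classical
  induction u using hacyc.wellFounded_flip.induction with
  | _ u ih =>
    rw [hacyc.pathSum_eq, hacyc.pathSum_eq (G.avoidBothWeight left right w)]
    congr 1
    refine Finset.sum_congr rfl fun e _ => ?_
    split_ifs with h
    swap
    · rfl
    by_cases h1 : G.head e ∈ Set.range left
    · rw [keptWeight, if_pos (.into_left e h1)]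
      simp [avoidBothWeight, avoidLeftWeight, h1]
    by_cases h2 : G.tail e ∈ Set.range right
    · rw [keptWeight, if_pos (.out_of_right e h2)]
      simp [avoidBothWeight, h2]
    have hw : G.avoidBothWeight left right w e = w e := by
      simp [avoidBothWeight, avoidLeftWeight, h1, h2]
    obtain ⟨i, hi⟩ := hu
    by_cases hd : G.Deleted left right e
    · rw [keptWeight, if_pos hd, zero_mul, pathSum_avoidBothWeight_eq_zero w hacyc, mul_zero]
      exact fun hj => hd.not_on_route h1 h2 ⟨i, h.symm ▸ hi⟩ ⟨j, hj⟩
    · rw [hw, keptWeight, if_neg hd, ih _ ⟨e, h, rfl⟩ ⟨i, hi.tail ⟨e, h, rfl, h1, h2⟩⟩]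

theorem obtainedByElementaryOperations_gesselViennot (hacyc : G.Acyclic) (hleft : Injective left)
    (hright : Injective right) :
    ObtainedByElementaryOperations
      (fun i j => G.pathSum (G.keptWeight left right w) (left i) (right j))
      (G.gesselViennot w left right) := by
  let A : Matrix (Fin n) (Fin n) R := fun i i' => G.pathSum w (left i) (left i')
  let B : Matrix (Fin n) (Fin n) R := fun j' j =>
    G.pathSum (G.avoidLeftWeight left w) (right j') (right j)
  set N : Matrix (Fin n) (Fin n) R :=
    fun i j => G.pathSum (G.keptWeight left right w) (left i) (right j) with hN
  -- The order of the cuts matters: `B` uses the weights that avoid left endpoints, because the cut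
  -- at the last left endpoint comes first.
  have hV : G.gesselViennot w left right = A * (N * B) := by
    funext i j
    rw [Matrix.mul_apply]
    refine (pathSum_eq_sum_left w hacyc hleft i (right j)).trans ?_
    refine Finset.sum_congr rfl fun i' _ => ?_
    rw [pathSum_eq_sum_right w hacyc hright, Matrix.mul_apply]
    congr 1
    refine Finset.sum_congr rfl fun j' _ => ?_
    rw [← pathSum_keptWeight_eq w hacyc j' ⟨i', .refl⟩]
  have hwf : ∀ f : Fin n → V, WellFounded (fun i j => Relation.TransGen G.Step (f i) (f j)) :=
    fun f => InvImage.wf f hacyc.wellFounded.transGen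
  have hwf' : ∀ f : Fin n → V,
      WellFounded (flip fun i j => Relation.TransGen G.Step (f i) (f j)) := by
    intro f
    have h := InvImage.wf f hacyc.wellFounded_flip.transGen
    refine h.mono fun i j hij => ?_
    exact Relation.transGen_swap.2 hij
  rw [hV]
  exact (obtainedByElementaryOperations_mul_right N B (fun j => pathSum_self hacyc _ _) (hwf' right)
    fun i j hij h => transGen_of_pathSum_ne_zero hacyc (hright.ne hij) h).trans
    (obtainedByElementaryOperations_mul_left A (N * B) (fun i => pathSum_self hacyc _ _) (hwf left)
      fun i j hij h => transGen_of_pathSum_ne_zero hacyc (hleft.ne hij) h)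

end Decomposition

end DirectedMultigraph

/-! ### Assembling the theorem -/

namespace DirectedMultigraph

variable {V E : Type*} {G : DirectedMultigraph V E} {n : ℕ} {left right : Fin n → V}

/-- No edge enters a source or leaves a sink, and pruning has nothing to remove when all sources and
sinks are endpoints. -/
theorem not_deleted_of_range_eq (hl : Set.range left = {v | G.IsSource v})
    (hr : Set.range right = {v | G.IsSink v}) (e : E) : ¬ G.Deleted left right e := by
  intro h
  induction h with
  | into_left e h =>
    rw [hl] at h
    exact h e rfl
  | out_of_right e h =>
    rw [hr] at h
    exact h e rfl
  | source e h1 _ _ ih =>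
    rw [hl] at h1
    exact h1 ih
  | sink e _ h1 _ ih =>
    rw [hr] at h1
    exact h1 ih

/-- Segregation makes the in-place splitting possible and the face lengths right. -/
theorem PlanarEmbedding.Segregated.switches [Finite V] [Finite E] {emb : G.PlanarEmbedding}
    (hseg : emb.Segregated (Set.range left) (Set.range right)) (hconn : G.Connected)
    (hacyc : G.Acyclic) :
    UniqueTransitSwitches left right emb ∧ UniqueFaceSwitches left right emb ∧
      ∀ e, G.tail e ∈ Set.range left → ∃ y ∈ emb.outer, G.origin y = G.tail e := by
  rcases hseg with hE | ⟨x₀, hx₀, k, -, hL, hR⟩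
  · exact ⟨fun x => hE.elim x.1.1, fun x => hE.elim x.1.1, fun e => hE.elim e⟩
  · obtain ⟨h1, h2⟩ := switches_of_segregated hconn hacyc hx₀ hL hR
    refine ⟨fun x y hxy ht => h1 x y hxy ht.not_mem_left ht.not_mem_right, h2, fun e he => ?_⟩
    obtain ⟨i, -, hi⟩ := hL _ he
    exact ⟨_, iterate_faceWalk_mem_outer hx₀ i, hi⟩

theorem isKasteleynPercus_resolutionMatrix {R : Type*} [CommRing R] [Finite V] [Finite E]
    {emb : G.PlanarEmbedding} (hsw : UniqueTransitSwitches left right emb)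
    (hface : UniqueFaceSwitches left right emb) (hconn : G.Connected) (hacyc : G.Acyclic)
    (hout : ∀ e, G.tail e ∈ Set.range left → ∃ y ∈ emb.outer, G.origin y = G.tail e)
    (w : E → R) :
    IsKasteleynPercus (resolutionEmbedding hsw hconn hacyc hout)
      (G.resolutionWeight left right w) (resolutionMatrix w) := by
  refine ⟨?_, resolutionSign, kasteleynFlat_resolutionEmbedding hsw hconn hacyc hout hface,
    fun _ _ => rfl⟩
  rintro (e | v)
  · exact ⟨⟨_, rfl⟩, _, rfl⟩
  · exact ⟨⟨_, rfl⟩, _, rfl⟩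

end DirectedMultigraph

theorem corollary2 {R : Type*} [CommRing R] {V E : Type*} [Finite V] [Finite E]
    (G : DirectedMultigraph V E) (emb : G.PlanarEmbedding)
    (hconn : G.Connected) (hacyc : G.Acyclic) (w : E → R)
    (n : ℕ) (left right : Fin n → V)
    (hleft : Function.Injective left) (hright : Function.Injective right)
    (hseg : emb.Segregated (Set.range left) (Set.range right)) :
    ((Set.range left = {v | G.IsSource v} ∧ Set.range right = {v | G.IsSink v}) →
      ∃ emb' : (G.resolution left right).PlanarEmbedding, emb.IsInduced emb' ∧
        ∃ M : Matrix (G.Black left right) (G.White left right) R,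
          DirectedMultigraph.IsKasteleynPercus emb' (G.resolutionWeight left right w) M ∧
          ObtainedByDeletedPivots M (G.leftVertex left right) (G.rightVertex left right)
            (G.gesselViennot w left right)) ∧
    (∃ emb' : (G.resolution left right).PlanarEmbedding, emb.IsInduced emb' ∧
      ∃ M : Matrix (G.Black left right) (G.White left right) R,
        DirectedMultigraph.IsKasteleynPercus emb' (G.resolutionWeight left right w) M ∧
        ∃ N : Matrix (Fin n) (Fin n) R,
          ObtainedByDeletedPivots M (G.leftVertex left right) (G.rightVertex left right) N ∧
          ObtainedByElementaryOperations N (G.gesselViennot w left right)) := by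
  have : Fintype E := Fintype.ofFinite E
  obtain ⟨hsw, hface, hout⟩ := hseg.switches hconn hacyc
  have hind := DirectedMultigraph.isInduced_resolutionEmbedding hsw hconn hacyc hout
  have hKP := DirectedMultigraph.isKasteleynPercus_resolutionMatrix hsw hface hconn hacyc hout w
  have hpiv := DirectedMultigraph.obtainedByDeletedPivots_resolutionMatrix w hacyc hleft hright
  refine ⟨fun ⟨hl, hr⟩ => ⟨_, hind, _, hKP, ?_⟩, _, hind, _, hKP, _, hpiv,
    DirectedMultigraph.obtainedByElementaryOperations_gesselViennot w hacyc hleft hright⟩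
  have hw : G.keptWeight left right w = w :=
    funext fun e => if_neg (DirectedMultigraph.not_deleted_of_range_eq hl hr e)
  rw [hw] at hpiv
  exact hpiv
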